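/- **Setting.** Let $\mathcal E$ be one of the equations on $\mathbb T=\mathbb R/\mathbb Z$ $$\text{(gKdV)}\ \ \partial_t u=\partial_x(-\partial_x^2u+f(u)),\qquad \text{(gBO)}\ \ \partial_t u=\partial_x(|\partial_x|u+f(u)),$$ with $f\in C^\infty(\mathbb R;\mathbb R)$ analytic near $0$ and $f(0)=f'(0)=0$. Let $\alpha=2$ for gKdV and $\alpha=1$ for gBO, and let $\sum_{m\ge3}a_my^m$ be the Taylor series at $0$ of the primitive $F$ of $f$ vanishing at $0$. Assume $4\pi^2k^2a_4+a_3^2\neq0$ for all integers $k\ge1$ (for gKdV), resp. $a_4\ne0$ (for gBO). A real function $u$ of zero average is identified with its Fourier coefficients $(u_k)_{k\in\mathbb Z^*}$, $u_{-k}=\overline{u_k}$; $I_k=|u_k|^2$; for $s\ge 0$, $\|u\|_{\dot H^s}^2=\sum_{k\in\mathbb Z^*}|k|^{2s}|u_k|^2$ and $\dot H^s$ is the set of those $u$ for which this is finite. **The coefficients $c_{p,q}(\ell)$.** For $k\in(\mathbb Z^*)^n$ write $u^k=u_{k_1}\cdots u_{k_n}$, let $\mathcal M_n=\{k\in(\mathbb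 Z^*)^n: k_1+\dots+k_n=0\}$, $\Omega(k)=\tfrac12(2\pi)^{1+\alpha}\sum_jk_j|k_j|^{\alpha}$ and $\mathcal R_n=\{k\in\mathcal M_n:\Omega(k)=0\}$. Let $\{P,Q\}=\sum_{j\in\mathbb Z^*}(\partial_{u_{-j}}P)(2i\pi j)(\partial_{u_j}Q)$ and define the formal homogeneous polynomials $$\mathcal L_n=\sum_{k\in\mathcal M_n}u^k,\quad \chi_3=\sum_{k\in\mathcal M_3}\frac{a_3}{i\Omega(k)}u^k,\quad G_4=a_4\mathcal L_4+\tfrac12\{\chi_3,a_3\mathcal L_3\}=\sum_{k\in\mathcal M_4}g_ku^k,$$ $$\chi_4=\sum_{k\in\mathcal M_4\setminus\mathcal R_4}\frac{g_k}{i\Omega(k)}u^k,\qquad Z_4=\sum_{k\in\mathcal R_4}g_ku^k,$$ $$P_6=a_6\mathcal L_6+\{\chi_3,a_5\mathcal L_5\}+\tfrac12\{\chi_3,\{\chi_3,a_4\mathcal L_4\}\}+\tfrac18\{\chi_3,\{\chi_3,\{\chi_3,a_3\mathcal L_3\}\}\}+\tfrac12\{\chi_4,G_4+Z_4\}.$$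 For $0<p\le q\le\ell$, $c_{p,q}(\ell)\in\mathbb R$ is the coefficient of $I_pI_qI_\ell=u_pu_{-p}u_qu_{-q}u_\ell u_{-\ell}$ in $P_6$, and for real $N$, $Z_{6,\le N}(I)=\sum_{0<p\le q\le\ell\le N}c_{p,q}(\ell)I_pI_qI_\ell$. **Small divisors.** Let $\mathcal{MI}_{\rm mult}$ be the set of pairs $(m,k)\in(\mathbb Z^*)^n\times\mathbb N^n$, $n\ge2$, with $k_1>\dots>k_n>0$, $\sum_jm_jk_j=0$ and $|m|_1=\sum_j|m_j|\ge5$. For $(m,k)\in\mathcal{MI}_{\rm mult}$ and $p\ge1$ let $$\text{(gKdV)}\quad(\delta_{m,k})_p=-\sum_{j}m_jk_j\Big(12a_4+\frac{3a_3^2}{\pi^2k_j^2}\Big)\mathbf 1_{k_j=p},$$ $$\text{(gBO)}\quad(\delta_{m,k})_p=-12a_4\sum_jm_jk_j\mathbf 1_{k_j=p}-\frac{18a_3^2}{\pi}\Big(\sum_{k_j\ge p}m_j+\frac1p\sum_{k_j<p}m_jk_j\Big),$$ $$\Delta^{(4)}_{m,k}(I)=\sum_{p\ge1}(\delta_{m,k})_pI_p,\qquad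 \Delta^{(4,6)}_{m,k,N}(I)=\Delta^{(4)}_{m,k}(I)+\sum_jm_jk_j\,\partial_{I_{k_j}}Z_{6,\le N}(I),$$ and $\kappa_{m,k}=\min\{p\ge1:(\delta_{m,k})_p\ne0\}$. For real $\gamma,N,r$, let $\mathcal U_{\gamma,N,r}^{s}$ be the set of all $u\in\dot H^s$ such that, for every $(m,k)\in\mathcal{MI}_{\rm mult}$ with $5\le|m|_1\le r$ and $k_1\le N$, $$|\Delta^{(4)}_{m,k}(I)|>\gamma N^{-5|m|_1}\|u\|_{\dot H^s}^2\kappa_{m,k}^{-2s}\quad\text{and}\quad|\Delta^{(4,6)}_{m,k,N}(I)|>\gamma N^{-21|m|_1}\|u\|_{\dot H^s}^2\max\big(\kappa_{m,k}^{-2s},\gamma\|u\|_{\dot H^s}^2\big).$$ **Proposition.** There are continuous functions $\sigma_0>0$ and $N_0$ of $(r,s,\nu,\lambda)\in[2,\infty)\times[0,\infty)\times(1,9]\times(0,1)$, depending only on $\mathcal E$ and $f$, such that the following holds for all such $(r,s,\nu,\lambda)$, all $\sigma\in(0,\sigma_0(r,s,\nu,\lambda)]$, all $\gamma\in(0,1)$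 and all sequences $(J_k)_{k\ge1}$ of nonnegative reals with $$2\sum_{k\ge1}J_kk^{2s}+2\sigma\zeta(\nu)\le4\sigma\zeta(\nu).$$ Let $(I_k)_{k\ge1}$ be independent random variables, $I_k$ being uniformly distributed in $J_k+\sigma(0,k^{-2s-\nu})$, and let $u=\sum_{k\ge1}2\sqrt{I_k}\cos(2\pi kx)$. Then, with probability at least $1-\lambda\gamma$, $$u\in\mathcal U_{\gamma,N,r}^{s}\quad\text{for every real } N \text{ with}\quad N_0(r,s,\nu,\lambda)\le N\le(\gamma\|u\|_{\dot H^s}^{-2})^{1/(21r+5)}.$$ -/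

import Mathlib

open MeasureTheory ProbabilityTheory
open scoped ContDiff Nat

namespace RationalNormalForm

/-- The two equations `∂ₜu = ∂ₓ(-∂ₓ²u + f(u))` (gKdV) and `∂ₜu = ∂ₓ(|∂ₓ|u + f(u))` (gBO). -/
inductive Equation
  | gKdV
  | gBO

/-- The dispersion exponent: `α = 2` for gKdV and `α = 1` for gBO. -/
def Equation.alpha : Equation → ℕ
  | .gKdV => 2
  | .gBO => 1

/-- `a_m`, the `m`-th Taylor coefficient at `0` of the primitive `F` of `f` vanishing at `0`. -/
noncomputable def taylorCoeff (f : ℝ → ℝ) (m : ℕ) : ℝ :=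
  iteratedDeriv m (fun y : ℝ => ∫ t in (0 : ℝ)..y, f t) 0 / (m ! : ℝ)

/-- The non-degeneracy assumptions on the Taylor coefficients. -/
def NonDegenerate (E : Equation) (a : ℕ → ℝ) : Prop :=
  match E with
  | .gKdV => ∀ k : ℕ, 1 ≤ k → 4 * Real.pi ^ 2 * (k : ℝ) ^ 2 * a 4 + a 3 ^ 2 ≠ 0
  | .gBO => a 4 ≠ 0

/-! ### The phase space -/

/-- `‖u‖²` in the homogeneous Sobolev space of order `s`, in terms of the Fourier coefficients
`(u_k)` of `u` (by convention `u_0 = 0`). -/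
noncomputable def normSq (s : ℝ) (u : ℤ → ℂ) : ℝ :=
  ∑' k : ℤ, |(k : ℝ)| ^ (2 * s) * ‖u k‖ ^ 2

/-- The homogeneous Sobolev space of order `s` of real valued functions of zero average on `ℝ/ℤ`;
functions are identified with their sequences of Fourier coefficients. -/
def HDot (s : ℝ) : Set (ℤ → ℂ) :=
  {u | u 0 = 0 ∧ (∀ k : ℤ, u (-k) = (starRingEnd ℂ) (u k)) ∧
    Summable fun k : ℤ => |(k : ℝ)| ^ (2 * s) * ‖u k‖ ^ 2}

/-- The actions `I_k = |u_k|²`. -/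
noncomputable def action (u : ℤ → ℂ) (k : ℕ) : ℝ := ‖u (k : ℤ)‖ ^ 2

/-! ### Formal Hamiltonians and the resonant normal form up to order six

A family `b : List ℤ → ℂ` of coefficients stands for the formal series `∑_k b_k u^k`, where
`u^k = u_{k_1} ⋯ u_{k_n}` for `k = [k_1, …, k_n]`. -/

/-- Multi-indices with nonzero entries satisfying the zero momentum condition. -/
def ZeroMomentum (k : List ℤ) : Prop := (∀ x ∈ k, x ≠ 0) ∧ k.sum = 0

/-- `k_1 |k_1|^α + ⋯ + k_n |k_n|^α`; a multi-index is resonant if this vanishes. -/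
def resonance (E : Equation) (k : List ℤ) : ℤ := (k.map fun x => x * |x| ^ E.alpha).sum

/-- The denominators `Ω(k)`. -/
noncomputable def Omega (E : Equation) (k : List ℤ) : ℝ :=
  1 / 2 * (2 * Real.pi) ^ (1 + E.alpha) * (resonance E k : ℝ)

/-- The Poisson bracket `{P, Q} = ∑_{j ≠ 0} (∂_{u_{-j}} P) (2iπj) (∂_{u_j} Q)` of two series
supported on zero momentum multi-indices. The monomials of `∂_{u_{-j}} P` (resp. `∂_{u_j} Q`) are
obtained by removing an entry `-j` (resp. `j`) from a multi-index of `P` (resp. `Q`), and `j` is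
prescribed by the zero momentum condition. -/
noncomputable def bracket (P Q : List ℤ → ℂ) (k : List ℤ) : ℂ :=
  ∑ n ∈ Finset.range (k.length + 1),
    ∑ i ∈ Finset.range (n + 1), ∑ i' ∈ Finset.range (k.length - n + 1),
      2 * Complex.I * (Real.pi : ℂ) * ((k.take n).sum : ℂ)
        * P ((k.take n).insertIdx i (-(k.take n).sum))
        * Q ((k.drop n).insertIdx i' (k.take n).sum)

open Classical in
/-- `a_n 𝓛_n`, where `𝓛_n(u) = ∫ u^n dx` is the sum of all the zero momentum monomials of
degree `n`. -/
noncomputable def monomialHam (a : ℕ → ℝ) (n : ℕ) (k : List ℤ) : ℂ :=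
  if k.length = n ∧ ZeroMomentum k then (a n : ℂ) else 0

open Classical in
/-- The solution `∑ b_k / (i Ω(k)) u^k`, the sum being over the non-resonant `k`, of the homological
equation associated with `∑ b_k u^k`. -/
noncomputable def homological (E : Equation) (b : List ℤ → ℂ) (k : List ℤ) : ℂ :=
  if resonance E k ≠ 0 then b k / (Complex.I * (Omega E k : ℂ)) else 0

open Classical in
/-- The resonant part of a series. -/
noncomputable def resonantPart (E : Equation) (b : List ℤ → ℂ) (k : List ℤ) : ℂ :=
  if resonance E k = 0 then b k else 0

/-- `χ₃`, removing the cubic terms `a_3 𝓛_3`. -/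
noncomputable def chi3 (E : Equation) (a : ℕ → ℝ) : List ℤ → ℂ :=
  homological E (monomialHam a 3)

/-- The quartic terms `a_4 𝓛_4 + ½ {χ₃, a_3 𝓛_3}` after the change of variables generated
by `χ₃`. -/
noncomputable def quartic (E : Equation) (a : ℕ → ℝ) : List ℤ → ℂ := fun k =>
  monomialHam a 4 k + 1 / 2 * bracket (chi3 E a) (monomialHam a 3) k

/-- `χ₄`, removing the non-resonant quartic terms. -/
noncomputable def chi4 (E : Equation) (a : ℕ → ℝ) : List ℤ → ℂ :=
  homological E (quartic E a)

/-- `P₆`, the sextic terms after the changes of variables generated by `χ₃` and `χ₄`. The resonant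
quartic terms are the integrable ones, i.e. `Z₄`. -/
noncomputable def sextic (E : Equation) (a : ℕ → ℝ) : List ℤ → ℂ := fun k =>
  monomialHam a 6 k
    + bracket (chi3 E a) (monomialHam a 5) k
    + 1 / 2 * bracket (chi3 E a) (bracket (chi3 E a) (monomialHam a 4)) k
    + 1 / 8 * bracket (chi3 E a) (bracket (chi3 E a)
        (bracket (chi3 E a) (monomialHam a 3))) k
    + 1 / 2 * bracket (chi4 E a)
        (fun l => quartic E a l + resonantPart E (quartic E a) l) k

/-- `c_{p,q}(ℓ)`: the coefficient of `I_p I_q I_ℓ` in the integrable part of `P₆`, i.e. the sum of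
the coefficients of all the multi-indices `k` with `u^k = I_p I_q I_ℓ` (it is a real number). -/
noncomputable def sexticCoeff (E : Equation) (a : ℕ → ℝ) (p q l : ℕ) : ℝ :=
  (∑ k ∈ ([(p : ℤ), -(p : ℤ), (q : ℤ), -(q : ℤ), (l : ℤ), -(l : ℤ)].permutations).toFinset,
    sextic E a k).re

/-- `Z_{6,≤N}(I) = ∑_{0 < p ≤ q ≤ ℓ ≤ N} c_{p,q}(ℓ) I_p I_q I_ℓ`. -/
noncomputable def Z6 (E : Equation) (a : ℕ → ℝ) (N : ℝ) : MvPolynomial ℕ ℝ :=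
  ∑ p ∈ Finset.Icc 1 ⌊N⌋₊, ∑ q ∈ Finset.Icc p ⌊N⌋₊, ∑ l ∈ Finset.Icc q ⌊N⌋₊,
    MvPolynomial.C (sexticCoeff E a p q l)
      * MvPolynomial.X p * MvPolynomial.X q * MvPolynomial.X l

/-! ### Small divisors

Multi-indices with multiplicity are pairs `(m, k)` of tuples of the same length `n + 2 ≥ 2`. -/

/-- `|m|₁`. -/
def l1 {n : ℕ} (m : Fin (n + 2) → ℤ) : ℕ := ∑ j, (m j).natAbs

/-- `(m, k)` is a multi-index with multiplicity. -/
structure IsMultIndex {n : ℕ} (m : Fin (n + 2) → ℤ) (k : Fin (n + 2) → ℕ) : Prop where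
  mult_ne_zero : ∀ j, m j ≠ 0
  index_pos : ∀ j, 0 < k j
  index_anti : StrictAnti k
  momentum : ∑ j, m j * (k j : ℤ) = 0
  five_le : 5 ≤ l1 m

/-- The coefficients `(δ_{m,k})_p`. -/
noncomputable def delta4 (E : Equation) (a : ℕ → ℝ) {n : ℕ} (m : Fin (n + 2) → ℤ)
    (k : Fin (n + 2) → ℕ) (p : ℕ) : ℝ :=
  match E with
  | .gKdV =>
      -∑ j, if k j = p then
        (m j : ℝ) * (k j : ℝ) * (12 * a 4 + 3 * a 3 ^ 2 / (Real.pi ^ 2 * (k j : ℝ) ^ 2)) else 0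
  | .gBO =>
      -12 * a 4 * (∑ j, if k j = p then (m j : ℝ) * (k j : ℝ) else 0)
        - 18 * a 3 ^ 2 / Real.pi *
          ((∑ j, if p ≤ k j then (m j : ℝ) else 0)
            + 1 / (p : ℝ) * ∑ j, if k j < p then (m j : ℝ) * (k j : ℝ) else 0)

/-- The small divisors associated with `Z₄`: `∑_{p ≥ 1} (δ_{m,k})_p I_p`. -/
noncomputable def Delta4 (E : Equation) (a : ℕ → ℝ) {n : ℕ} (m : Fin (n + 2) → ℤ)
    (k : Fin (n + 2) → ℕ) (I : ℕ → ℝ) : ℝ :=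
  ∑' p : ℕ+, delta4 E a m k p * I p

/-- The smallest effective index `κ_{m,k}`. -/
noncomputable def kappa (E : Equation) (a : ℕ → ℝ) {n : ℕ} (m : Fin (n + 2) → ℤ)
    (k : Fin (n + 2) → ℕ) : ℕ :=
  sInf {p : ℕ | 1 ≤ p ∧ delta4 E a m k p ≠ 0}

/-- The small divisors associated with `Z_{6,≤N}`: `∑_j m_j k_j ∂_{I_{k_j}} Z_{6,≤N}(I)`. -/
noncomputable def Delta6 (E : Equation) (a : ℕ → ℝ) {n : ℕ} (m : Fin (n + 2) → ℤ)
    (k : Fin (n + 2) → ℕ) (N : ℝ) (I : ℕ → ℝ) : ℝ :=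
  ∑ j, (m j : ℝ) * (k j : ℝ) * MvPolynomial.eval I (MvPolynomial.pderiv (k j) (Z6 E a N))

/-- The small divisors of degree two which are not homogeneous. -/
noncomputable def Delta46 (E : Equation) (a : ℕ → ℝ) {n : ℕ} (m : Fin (n + 2) → ℤ)
    (k : Fin (n + 2) → ℕ) (N : ℝ) (I : ℕ → ℝ) : ℝ :=
  Delta4 E a m k I + Delta6 E a m k N I

/-! ### The non-resonant sets -/

/-- The first non-resonance condition. -/
def U4 (E : Equation) (a : ℕ → ℝ) (s γ N r : ℝ) : Set (ℤ → ℂ) :=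
  {u | u ∈ HDot s ∧ ∀ (n : ℕ) (m : Fin (n + 2) → ℤ) (k : Fin (n + 2) → ℕ),
    IsMultIndex m k → 5 ≤ l1 m → (l1 m : ℝ) ≤ r → (k 0 : ℝ) ≤ N →
      γ * N ^ (-5 * (l1 m : ℝ)) * normSq s u * (kappa E a m k : ℝ) ^ (-2 * s)
        < |Delta4 E a m k (action u)|}

/-- The second non-resonance condition. -/
def U46 (E : Equation) (a : ℕ → ℝ) (s γ N r : ℝ) : Set (ℤ → ℂ) :=
  {u | u ∈ HDot s ∧ ∀ (n : ℕ) (m : Fin (n + 2) → ℤ) (k : Fin (n + 2) → ℕ),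
    IsMultIndex m k → 5 ≤ l1 m → (l1 m : ℝ) ≤ r → (k 0 : ℝ) ≤ N →
      γ * N ^ (-21 * (l1 m : ℝ)) * normSq s u
          * max ((kappa E a m k : ℝ) ^ (-2 * s)) (γ * normSq s u)
        < |Delta46 E a m k N (action u)|}

/-- The non-resonant set `𝒰_{γ,N,r}`. -/
def U (E : Equation) (a : ℕ → ℝ) (s γ N r : ℝ) : Set (ℤ → ℂ) :=
  U4 E a s γ N r ∩ U46 E a s γ N r

/-- The Fourier coefficients `u_k = √I_{|k|}` of `u(x) = ∑_{k ≥ 1} 2 √I_k cos(2πkx)`. -/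
noncomputable def cosSeries (I : ℕ → ℝ) (k : ℤ) : ℂ :=
  if k = 0 then 0 else (Real.sqrt (I k.natAbs) : ℂ)

end RationalNormalForm

namespace RationalNormalForm

/-! ### Sums over permutations of multi-indices -/

/-! The probability that one fixed small divisor is small is estimated by freezing all actions but
one and applying Fubini (`measure_le_of_volume_update_le`). The task is then to find, for each `(m,
k)`, one action along which the divisor is quantitatively not flat.

For Δ⁽⁴⁾, which is linear, this action is I_κ. Its slope is at least c / k_1 with c depending only
on a bound for |m|₁ (`exists_kappa_bound`): either κ is the smallest index k_n and non-degeneracy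
applies directly, or κ is bounded in terms of |m|₁ and δ_κ takes finitely many values. The weight
κ^(-2s) of the condition matches the length σ κ^(-2s-ν) of the interval up to a power of N. The same
action serves for Δ⁽⁴,⁶⁾ when κ^(-2s) dominates the maximum: the upper bound on N forces every
action below N^(-20), so the sextic part changes the slope by at most half.

When γ‖u‖² dominates, κ has to be large, hence κ = k_n. For small p, Δ⁽⁴⁾ does not involve I_p, and
Δ⁽⁴,⁶⁾ is quadratic in I_p with leading coefficient ∑ m_j k_j c_{p,p}(k_j). A quadratic sublevel set
costs a square root, which the extra factor γ‖u‖² in the threshold compensates. The leading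
coefficient is bounded below for some small p by `exists_quadCoeff_bound`: in the closed formulas
`sexticCoeff_gKdV` and `sexticCoeff_gBO` the leading terms in ℓ cancel after summation over j, and
what remains, as a rational function of p, has a pole attached to k_1 that no other k_j shares. The
numerator over the common denominator is a polynomial of bounded degree that is not small at this
pole, so by Lagrange interpolation it is not small at one of the first positive integers.

The closed formulas rest on symmetrisation: summed over all orderings of the indices, a Poisson
bracket becomes a sum over the splittings of the indices into two groups (`symSum_bracket`), and
bracketing with χ₃ becomes the contraction of a pair. For the indices ±p, ±p, ±L the iterated
contractions are sums of products of inverses of linear forms in (p, L), which are evaluated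
symbolically.

Each bad event then has probability O(ζ(ν) γ N^(-n-4)), where n + 2 is the number of indices. There
are at most N^(n+2) choices of k and boundedly many of m, and summing N^(-2) over integers N ≥ g
gives O(ζ(ν) γ / g), which is at most λγ for g large. Real N reduce to their integer parts. -/

/-- The lists obtained from `k` by removing one occurrence of `a`. -/
def removals {α : Type*} [DecidableEq α] (a : α) : List α → List (List α)
  | [] => []
  | y :: ys => (if y = a then [ys] else []) ++ (removals a ys).map (y :: ·)

theorem perm_of_mem_removals {α : Type*} [DecidableEq α] {a : α} :
    ∀ {k d : List α}, d ∈ removals a k → List.Perm (a :: d) k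
  | [], d, h => by simp [removals] at h
  | y :: ys, d, h => by
    simp only [removals, List.mem_append, List.mem_map] at h
    rcases h with h | ⟨d', hd', rfl⟩
    · split_ifs at h with hy
      · simp at h; subst h; subst hy; exact List.Perm.refl _
      · simp at h
    · exact (List.Perm.swap _ _ _).trans ((perm_of_mem_removals hd').cons y)

theorem length_removals {α : Type*} [DecidableEq α] (a : α) (k : List α) :
    (removals a k).length = k.count a := by
  induction k with
  | nil => rfl
  | cons y ys ih =>
    by_cases h : y = a
    · simp [removals, ih, h]
    · simp [removals, ih, h]

/-- Double counting: an insertion of `a` into `l` that produces `k` is the same datum as a deletion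
of `a` from `k` that produces `l`. -/
theorem count_permutations'Aux_eq {α : Type*} [DecidableEq α] (a : α) :
    ∀ l k : List α, (List.permutations'Aux a l).count k = (removals a k).count l
  | [], [] => by simp [removals, List.permutations'Aux]
  | [], [y] => by
    by_cases h : y = a
    · simp [removals, List.permutations'Aux, h]
    · simp [removals, List.permutations'Aux, h, Ne.symm h]
  | [], y :: z :: zs => by
    have h1 : ∀ (x : α) (L : List (List α)), (L.map (x :: ·)).count [] = 0 := fun x L =>
      List.count_eq_zero.2 (by simp)
    by_cases h : y = a <;>
      simp [removals, List.permutations'Aux, h1, h, -List.map_append,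
        -List.map_map]
  | y :: ys, [] => by
    have h1 : ∀ L : List (List α), (L.map (y :: ·)).count [] = 0 := fun L =>
      List.count_eq_zero.2 (by simp)
    simp [removals, List.permutations'Aux, h1]
  | y :: ys, z :: zs => by
    have key : ∀ (u v : α) (L : List (List α)) (w : List α),
        (L.map (u :: ·)).count (v :: w) = if u = v then L.count w else 0 := by
      intro u v L w
      split_ifs with h
      · subst h
        exact List.count_map_of_injective _ _ (List.cons_injective) _
      · exact List.count_eq_zero.2 (by simp [h])
    have ih := count_permutations'Aux_eq a ys zs
    simp only [List.permutations'Aux, removals, List.count_append, List.count_cons, key, ih]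
    by_cases h1 : z = a
    · subst h1
      by_cases h2 : y = z
      · subst h2; by_cases h3 : zs = y :: ys
        · subst h3; simp [add_comm]
        · simp [h3, Ne.symm h3]
      · by_cases h3 : zs = y :: ys
        · subst h3; simp [h2, Ne.symm h2]
        · simp [h3, Ne.symm h3, h2, Ne.symm h2]
    · by_cases h2 : y = z
      · subst h2; simp [h1, Ne.symm h1]
      · simp [h1, Ne.symm h1, h2, Ne.symm h2]

/-- The number of permutations of the positions leaving a list invariant. -/
def symmetryFactor {α : Type*} [DecidableEq α] : List α → ℕ
  | [] => 1
  | a :: l => (l.count a + 1) * symmetryFactor l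

theorem sum_map_count_comm {α : Type*} [BEq α] [LawfulBEq α] (A B : List α) :
    (A.map fun x => B.count x).sum = (B.map fun x => A.count x).sum := by
  induction A with
  | nil => simp
  | cons a A ih =>
    simp only [List.map_cons, List.sum_cons, ih, List.count_cons, List.sum_map_add]
    rw [add_comm]
    congr 1
    clear ih
    induction B with
    | nil => simp
    | cons b B ih =>
      by_cases h : b = a
      · simp [h, ih, add_comm]
      · simp [h, ih, Ne.symm h]

/-- By the double counting above, the head `a` can be deleted from `k` in `k.count a` ways, and
every deletion leaves a permutation of the tail; induction supplies the other factors. -/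
theorem count_permutations'_of_perm {α : Type*} [DecidableEq α] :
    ∀ (l : List α) {k : List α}, k.Perm l → l.permutations'.count k = symmetryFactor l
  | [], k, h => by
    rw [List.perm_nil] at h; subst h; simp [symmetryFactor]
  | a :: l, k, h => by
    rw [List.permutations', List.count_flatMap, symmetryFactor]
    have h1 : (List.map (List.count k ∘ List.permutations'Aux a) l.permutations').sum
        = ((removals a k).map fun d => l.permutations'.count d).sum := by
      refine Eq.trans ?_ (sum_map_count_comm _ _)
      congr 1
      refine List.map_congr_left fun l' _ => ?_
      exact count_permutations'Aux_eq a l' k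
    rw [h1]
    have h2 : ∀ d ∈ removals a k, l.permutations'.count d = symmetryFactor l := fun d hd =>
      count_permutations'_of_perm l ((perm_of_mem_removals hd).trans h).cons_inv
    rw [List.map_congr_left h2]
    simp [length_removals, h.count_eq]

/-- The sum of the coefficients over all permutations (with multiplicity) of a multi-index. -/
def symSum (P : List ℤ → ℂ) (l : List ℤ) : ℂ := (l.permutations'.map P).sum

/-- Orbit-stabiliser: the coefficient of a monomial sums over distinct orderings, whereas brackets
behave well under sums over all orderings with multiplicity. This converts one into the other. -/
theorem sum_toFinset_permutations (P : List ℤ → ℂ) (l : List ℤ) :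
    (symmetryFactor l : ℂ) * ∑ k ∈ l.permutations.toFinset, P k = symSum P l := by
  have h := Finset.sum_list_map_count l.permutations' P
  rw [symSum, h, Finset.mul_sum]
  have h2 : l.permutations.toFinset = l.permutations'.toFinset :=
    List.toFinset_eq_of_perm _ _ (List.permutations_perm_permutations' l)
  rw [h2]
  refine Finset.sum_congr rfl fun k hk => ?_
  rw [List.mem_toFinset, List.mem_permutations'] at hk
  rw [nsmul_eq_mul, ← count_permutations'_of_perm l hk]
  congr!

theorem symSum_perm (P : List ℤ → ℂ) {l l' : List ℤ} (h : l.Perm l') :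
    symSum P l = symSum P l' :=
  (h.permutations'.map P).sum_eq

theorem symSum_add (P Q : List ℤ → ℂ) (l : List ℤ) :
    symSum (fun k => P k + Q k) l = symSum P l + symSum Q l := by
  simp [symSum, List.sum_map_add]

theorem symSum_mul_left (c : ℂ) (P : List ℤ → ℂ) (l : List ℤ) :
    symSum (fun k => c * P k) l = c * symSum P l := by
  simp [symSum, List.sum_map_mul_left]

theorem length_permutations'_eq {α : Type*} (l : List α) :
    l.permutations'.length = l.length ! := by
  rw [← (List.permutations_perm_permutations' l).length_eq, List.length_permutations]

theorem symSum_of_const (P : List ℤ → ℂ) (l : List ℤ) (h : ∀ k, k.Perm l → P k = P l) :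
    symSum P l = (l.length ! : ℂ) * P l := by
  rw [symSum, List.map_congr_left (fun k hk => h k (List.mem_permutations'.1 hk))]
  simp [length_permutations'_eq]

theorem sum_permutations'Aux {M : Type*} [AddCommMonoid M] (a : ℤ) :
    ∀ (l : List ℤ) (P : List ℤ → M), ((List.permutations'Aux a l).map P).sum =
      ∑ i ∈ Finset.range (l.length + 1), P (l.insertIdx i a)
  | [], P => by simp [List.permutations'Aux]
  | y :: l, P => by
    rw [List.length_cons, Finset.sum_range_succ', List.permutations'Aux, List.map_cons,
      List.sum_cons, List.map_map, sum_permutations'Aux a l, add_comm]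
    simp

/-! ### Poisson brackets after symmetrisation -/

/-- All the ways of splitting a list into two complementary sublists. -/
def splits {α : Type*} : List α → List (List α × List α)
  | [] => [([], [])]
  | a :: l => (splits l).map (fun x => (a :: x.1, x.2)) ++ (splits l).map (fun x => (x.1, a :: x.2))

/-- The sum over all the ways of cutting a list in two. -/
def cutSum {M : Type*} [AddCommMonoid M] (f : List ℤ → List ℤ → M) (l : List ℤ) : M :=
  ∑ n ∈ Finset.range (l.length + 1), f (l.take n) (l.drop n)

theorem cutSum_cons {M : Type*} [AddCommMonoid M] (f : List ℤ → List ℤ → M) (a : ℤ) (l : List ℤ) :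
    cutSum f (a :: l) = cutSum (fun s t => f (a :: s) t) l + f [] (a :: l) := by
  simp [cutSum, Finset.sum_range_succ' _ (l.length + 1)]

theorem cutSum_nil {M : Type*} [AddCommMonoid M] (f : List ℤ → List ℤ → M) :
    cutSum f [] = f [] [] := by
  simp [cutSum]

theorem cutSum_add {M : Type*} [AddCommMonoid M] (f g : List ℤ → List ℤ → M) (l : List ℤ) :
    cutSum (fun s t => f s t + g s t) l = cutSum f l + cutSum g l := Finset.sum_add_distrib

/-- Inserting and then cutting agrees with cutting and then inserting into either piece: the two
cuts adjacent to the new entry correspond to insertion at the end of the left piece and at the start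
of the right one. -/
theorem sum_permutations'Aux_cutSum {M : Type*} [AddCommMonoid M] (a : ℤ) :
    ∀ (l : List ℤ) (f : List ℤ → List ℤ → M),
      ((List.permutations'Aux a l).map (cutSum f)).sum
        = cutSum (fun s t => ((List.permutations'Aux a s).map fun x => f x t).sum
            + ((List.permutations'Aux a t).map fun x => f s x).sum) l
  | [], f => by simp [List.permutations'Aux, cutSum_cons, cutSum_nil]
  | y :: l, f => by
    have ih := sum_permutations'Aux_cutSum a l (fun s t => f (y :: s) t)
    rw [cutSum_add] at ih
    simp only [List.permutations'Aux, cutSum_cons, List.map_cons, List.sum_cons, List.map_map,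
      Function.comp_def, List.sum_map_add, cutSum_add, List.map_nil, List.sum_nil, ih]
    abel

theorem sum_permutations'_cons {α M : Type*} [AddCommMonoid M] (a : α) (l : List α)
    (g : List α → M) : ((a :: l).permutations'.map g).sum
      = (l.permutations'.map fun k => ((List.permutations'Aux a k).map g).sum).sum := by
  rw [List.permutations', List.flatMap_def, List.map_flatten, List.sum_flatten, List.map_map,
    List.map_map]
  rfl

theorem list_sum_comm {α β M : Type*} [AddCommMonoid M] (A : List α) (B : List β)
    (f : α → β → M) : (A.map fun x => (B.map fun y => f x y).sum).sum
      = (B.map fun y => (A.map fun x => f x y).sum).sum := by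
  induction A with
  | nil => simp
  | cons a A ih => simp [ih, List.sum_map_add]

/-- An ordering together with a cut is a choice of the entries left of the cut and an ordering of
each side. -/
theorem sum_permutations'_cutSum {M : Type*} [AddCommMonoid M] :
    ∀ (l : List ℤ) (f : List ℤ → List ℤ → M),
      (l.permutations'.map (cutSum f)).sum
        = ((splits l).map fun x => (x.1.permutations'.map fun s =>
            (x.2.permutations'.map fun t => f s t).sum).sum).sum
  | [], f => by simp [splits, cutSum_nil]
  | a :: l, f => by
    have ih := sum_permutations'_cutSum (M := M) l
    rw [sum_permutations'_cons]
    simp only [sum_permutations'Aux_cutSum, ih, splits, List.map_append, List.sum_append,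
      List.map_map, Function.comp_def, List.sum_map_add, sum_permutations'_cons]
    congr 3
    funext x
    congr 2
    funext k
    exact list_sum_comm _ _ _

theorem symSum_cons (P : List ℤ → ℂ) (a : ℤ) (l : List ℤ) :
    symSum P (a :: l) = (l.permutations'.map fun s =>
      ∑ i ∈ Finset.range (s.length + 1), P (s.insertIdx i a)).sum := by
  simp only [symSum, sum_permutations'_cons, sum_permutations'Aux]

/-- The positions at which ∓j is inserted, combined with the orderings of the remaining entries, run
over all orderings of the enlarged list. Hence each factor of the bracket is itself symmetrised, and
only the choice of a sub-collection of indices survives. -/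
theorem symSum_bracket (P Q : List ℤ → ℂ) (l : List ℤ) :
    symSum (bracket P Q) l = ((splits l).map fun x =>
      2 * Complex.I * (Real.pi : ℂ) * (x.1.sum : ℂ) * symSum P (-x.1.sum :: x.1)
        * symSum Q (x.1.sum :: x.2)).sum := by
  have h : bracket P Q = cutSum (fun s t => 2 * Complex.I * (Real.pi : ℂ) * (s.sum : ℂ)
      * (∑ i ∈ Finset.range (s.length + 1), P (s.insertIdx i (-s.sum)))
      * (∑ i ∈ Finset.range (t.length + 1), Q (t.insertIdx i s.sum))) := by
    funext k
    refine Finset.sum_congr rfl fun n hn => ?_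
    have hn' : n ≤ k.length := Nat.lt_succ_iff.1 (Finset.mem_range.1 hn)
    beta_reduce
    rw [List.length_take, List.length_drop, min_eq_left hn', Finset.sum_comm]
    simp only [Finset.mul_sum, Finset.sum_mul]
  rw [symSum, h, sum_permutations'_cutSum]
  congr 1
  refine List.map_congr_left fun x _ => ?_
  have hs : ∀ s ∈ x.1.permutations', s.sum = x.1.sum := fun s hs =>
    (List.mem_permutations'.1 hs).sum_eq
  rw [List.map_congr_left (g := fun s => (2 * Complex.I * (Real.pi : ℂ) * (x.1.sum : ℂ)
      * symSum Q (x.1.sum :: x.2)) *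
      (∑ i ∈ Finset.range (s.length + 1), P (s.insertIdx i (-x.1.sum)))), List.sum_map_mul_left,
    symSum_cons P]
  · ring
  · intro s hs'
    rw [hs s hs', List.sum_map_mul_left, symSum_cons Q]
    ring

/-! ### Symmetrised coefficients of the normal form -/

theorem perm_of_mem_splits {α : Type*} :
    ∀ {l : List α} {x : List α × List α}, x ∈ splits l → (x.1 ++ x.2).Perm l
  | [], x, h => by
    simp only [splits, List.mem_singleton] at h
    subst h; simp
  | a :: l, x, h => by
    simp only [splits, List.mem_append, List.mem_map] at h
    rcases h with ⟨y, hy, rfl⟩ | ⟨y, hy, rfl⟩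
    · simpa using perm_of_mem_splits hy
    · exact List.perm_middle.trans ((perm_of_mem_splits hy).cons a)

theorem resonance_perm (E : Equation) {l l' : List ℤ} (h : l.Perm l') :
    resonance E l = resonance E l' := (h.map _).sum_eq

theorem Omega_perm (E : Equation) {l l' : List ℤ} (h : l.Perm l') :
    Omega E l = Omega E l' := by rw [Omega, Omega, resonance_perm E h]

theorem zeroMomentum_perm {l l' : List ℤ} (h : l.Perm l') :
    ZeroMomentum l ↔ ZeroMomentum l' := by
  simp only [ZeroMomentum, h.mem_iff, h.sum_eq]

theorem resonance_cons (E : Equation) (x : ℤ) (l : List ℤ) :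
    resonance E (x :: l) = x * |x| ^ E.alpha + resonance E l := by simp [resonance]

theorem resonance_append (E : Equation) (l l' : List ℤ) :
    resonance E (l ++ l') = resonance E l + resonance E l' := by simp [resonance]

theorem monomialHam_perm (a : ℕ → ℝ) (n : ℕ) {l l' : List ℤ} (h : l.Perm l') :
    monomialHam a n l = monomialHam a n l' := by
  by_cases hz : ZeroMomentum l
  · simp [monomialHam, h.length_eq, hz, (zeroMomentum_perm h).1 hz]
  · simp [monomialHam, hz, mt (zeroMomentum_perm h).2 hz]

theorem symSum_monomialHam (a : ℕ → ℝ) (n : ℕ) (l : List ℤ) :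
    symSum (monomialHam a n) l = (n ! : ℂ) * monomialHam a n l := by
  rw [symSum_of_const _ _ fun k hk => monomialHam_perm a n hk]
  by_cases h : l.length = n
  · rw [h]
  · simp [monomialHam, h]

theorem symSum_homological (E : Equation) (b : List ℤ → ℂ) (l : List ℤ) :
    symSum (homological E b) l
      = if resonance E l ≠ 0 then symSum b l / (Complex.I * (Omega E l : ℂ)) else 0 := by
  have h : ∀ k ∈ l.permutations', homological E b k = if resonance E l ≠ 0 then
      (1 / (Complex.I * (Omega E l : ℂ))) * b k else 0 := fun k hk => by
    have hk' := List.mem_permutations'.1 hk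
    rw [homological, resonance_perm E hk', Omega_perm E hk']
    simp only [div_eq_mul_inv, one_mul, mul_comm]
  rw [symSum, List.map_congr_left h]
  split_ifs with h0
  · rw [List.sum_map_mul_left, symSum, one_div, div_eq_mul_inv, mul_comm]
  · simp

theorem symSum_resonantPart (E : Equation) (b : List ℤ → ℂ) (l : List ℤ) :
    symSum (resonantPart E b) l = if resonance E l = 0 then symSum b l else 0 := by
  have h : ∀ k ∈ l.permutations', resonantPart E b k = if resonance E l = 0 then
      b k else 0 := fun k hk => by
    rw [resonantPart, resonance_perm E (List.mem_permutations'.1 hk)]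
  rw [symSum, List.map_congr_left h]
  split_ifs with h0
  · rw [symSum]
  · simp

theorem ofReal_list_sum {α : Type*} (L : List α) (f : α → ℝ) :
    (((L.map f).sum : ℝ) : ℂ) = (L.map fun x => (f x : ℂ)).sum := by
  induction L with
  | nil => simp
  | cons x L ih => simp [ih]

/-- The normalisation constant `2 / (2π)^α`. -/
noncomputable def dispersionConst (E : Equation) : ℝ := 2 / (2 * Real.pi) ^ E.alpha

theorem dispersionConst_pos (E : Equation) : 0 < dispersionConst E := by
  unfold dispersionConst; positivity

/-- The weight `j / (k_1|k_1|^α + ⋯ - j|j|^α)`, `j = k_1 + ⋯ + k_n`, of a contraction. -/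
noncomputable def weight (E : Equation) (S : List ℤ) : ℝ :=
  (S.sum : ℝ) / (resonance E (-S.sum :: S) : ℝ)

/-- Iterated contractions of pairs. -/
noncomputable def contractions (E : Equation) : ℕ → List ℤ → ℝ
  | 0, _ => 1
  | n + 1, l => ((splits l).map fun x =>
      if x.1.length = 2 then weight E x.1 * contractions E n (x.1.sum :: x.2) else 0).sum

/-- The factors i cancel and the powers of 2π combine into `dispersionConst`, so that the index
dependence is a ratio of integers. -/
theorem bracket_factor (E : Equation) (j : ℤ) (S : List ℤ) (c : ℂ)
    (h : resonance E S ≠ 0) :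
    2 * Complex.I * (Real.pi : ℂ) * (j : ℂ) * (c / (Complex.I * (Omega E S : ℂ)))
      = (dispersionConst E : ℂ) * ((j : ℂ) / (resonance E S : ℂ)) * c := by
  have hr : (resonance E S : ℂ) ≠ 0 := by exact_mod_cast h
  have hpi : (Real.pi : ℂ) ≠ 0 := by exact_mod_cast Real.pi_ne_zero
  have hI := Complex.I_ne_zero
  simp only [Omega, dispersionConst]
  push_cast
  rw [pow_add, pow_one]
  field_simp

theorem ne_zero_of_weight_ne_zero {E : Equation} {S : List ℤ} (h : weight E S ≠ 0) :
    S.sum ≠ 0 ∧ resonance E (-S.sum :: S) ≠ 0 := by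
  rw [weight] at h
  exact ⟨fun h0 => h (by simp [h0]), fun h0 => h (by simp [h0])⟩

theorem symSum_chi3 (E : Equation) (a : ℕ → ℝ) {S : List ℤ} (hS : ∀ x ∈ S, x ≠ 0) :
    2 * Complex.I * (Real.pi : ℂ) * (S.sum : ℂ) * symSum (chi3 E a) (-S.sum :: S)
      = ((if S.length = 2 then 6 * a 3 * dispersionConst E * weight E S else 0 : ℝ) : ℂ) := by
  rw [chi3, symSum_homological, symSum_monomialHam]
  by_cases h2 : S.length = 2
  · rw [if_pos h2]
    -- With `x / 0 = 0`, the weight vanishes exactly when j = 0, where the bracket has no term, or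
    -- when the contraction is resonant, where `χ₃` has no coefficient. No exceptional case is left
    -- in the final formula.
    by_cases hw : weight E S = 0
    · rw [hw]
      rw [weight, div_eq_zero_iff] at hw
      rcases hw with hw | hw
      · have : S.sum = 0 := by exact_mod_cast hw
        simp [this]
      · have : resonance E (-S.sum :: S) = 0 := by exact_mod_cast hw
        simp [this]
    · obtain ⟨h0, h1⟩ := ne_zero_of_weight_ne_zero hw
      rw [if_pos h1, bracket_factor _ _ _ _ h1, monomialHam, if_pos]
      · rw [weight]
        generalize resonance E (-S.sum :: S) = r
        generalize S.sum = j
        push_cast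
        simp [Nat.factorial]
        ring
      · refine ⟨by simp [h2], ?_, by simp⟩
        intro x hx
        rcases List.mem_cons.1 hx with rfl | hx
        · simpa using h0
        · exact hS x hx
  · have : monomialHam a 3 (-S.sum :: S) = 0 := by simp [monomialHam, h2]
    simp [this, h2]

theorem symSum_bracket_chi3 (E : Equation) (a : ℕ → ℝ) (Q : List ℤ → ℂ) {l : List ℤ}
    (hl : ∀ x ∈ l, x ≠ 0) :
    symSum (bracket (chi3 E a) Q) l = ((splits l).map fun x => if x.1.length = 2 then
      ((6 * a 3 * dispersionConst E * weight E x.1 : ℝ) : ℂ) * symSum Q (x.1.sum :: x.2)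
        else 0).sum := by
  rw [symSum_bracket]
  congr 1
  refine List.map_congr_left fun x hx => ?_
  rw [symSum_chi3 E a fun y hy => hl y ((perm_of_mem_splits hx).subset (by simp [hy]))]
  split_ifs <;> simp

/-- Since `χ₃` is cubic, a bracket with it replaces two entries by their sum, at the price of `6 * a
3 * dispersionConst E` (with 6 = 3!) times a weight. After `n` contractions a list of length `n₀`
remains, on which the coefficient is constant. -/
theorem symSum_iterate_bracket_chi3 (E : Equation) (a : ℕ → ℝ) (n₀ : ℕ) :
    ∀ (n : ℕ) (l : List ℤ), ZeroMomentum l → l.length = n₀ + n →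
      symSum ((bracket (chi3 E a))^[n] (monomialHam a n₀)) l
        = ((((6 * a 3 * dispersionConst E) ^ n * (n₀ ! * a n₀)) * contractions E n l : ℝ) : ℂ)
  | 0, l, hz, hl => by
    simp [symSum_monomialHam, monomialHam, hz, hl, contractions]
  | n + 1, l, hz, hl => by
    rw [Function.iterate_succ_apply', symSum_bracket_chi3 E a _ hz.1, contractions,
      ← List.sum_map_mul_left, ofReal_list_sum]
    congr 1
    refine List.map_congr_left fun x hx => ?_
    split_ifs with h2
    · by_cases hw : weight E x.1 = 0
      · simp [hw]
      · have hp := perm_of_mem_splits hx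
        obtain ⟨h0, h1⟩ := ne_zero_of_weight_ne_zero hw
        have hlen := hp.length_eq
        have hsum := hp.sum_eq
        rw [List.length_append] at hlen
        rw [List.sum_append, hz.2] at hsum
        rw [symSum_iterate_bracket_chi3 E a n₀ n]
        · push_cast; ring
        · refine ⟨fun y hy => ?_, by simpa using hsum⟩
          rcases List.mem_cons.1 hy with rfl | hy
          · exact h0
          · exact hz.1 y (hp.subset (by simp [hy]))
        · rw [List.length_cons]; omega
    · simp

/-- The symmetrised coefficients of the quartic part. -/
noncomputable def quarticSym (E : Equation) (a : ℕ → ℝ) (l : List ℤ) : ℝ :=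
  24 * a 4 + 18 * a 3 ^ 2 * dispersionConst E * contractions E 1 l

theorem symSum_quartic (E : Equation) (a : ℕ → ℝ) {l : List ℤ} (hz : ZeroMomentum l)
    (hl : l.length = 4) : symSum (quartic E a) l = (quarticSym E a l : ℂ) := by
  have h := symSum_iterate_bracket_chi3 E a 3 1 l hz hl
  simp only [Function.iterate_one] at h
  have : quartic E a = fun k => monomialHam a 4 k + 1 / 2 * bracket (chi3 E a) (monomialHam a 3) k :=
    rfl
  rw [this, symSum_add, symSum_mul_left, h, symSum_monomialHam, monomialHam, if_pos ⟨hl, hz⟩,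
    quarticSym]
  push_cast
  simp [Nat.factorial]
  ring

theorem symSum_quartic_of_length_ne (E : Equation) (a : ℕ → ℝ) {l : List ℤ}
    (h0 : ∀ x ∈ l, x ≠ 0) (hl : l.length ≠ 4) : symSum (quartic E a) l = 0 := by
  have : quartic E a = fun k => monomialHam a 4 k + 1 / 2 * bracket (chi3 E a) (monomialHam a 3) k :=
    rfl
  rw [this, symSum_add, symSum_mul_left, symSum_monomialHam, symSum_bracket_chi3 E a _ h0,
    monomialHam, if_neg (by tauto), List.map_congr_left (g := fun _ => (0 : ℂ))]
  · simp
  · intro x hx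
    have hlen := (perm_of_mem_splits hx).length_eq
    rw [List.length_append] at hlen
    split_ifs with h2
    · rw [symSum_monomialHam, monomialHam, if_neg]
      · simp
      · rintro ⟨h3, -⟩
        rw [List.length_cons] at h3
        omega
    · rfl

/-- On a resonant monomial the two factors of a splitting have opposite resonances. Wherever `χ₄`
contributes, the other factor is therefore non-resonant, and the `Z₄` part of the bracket drops out.
-/
theorem symSum_bracket_chi4 (E : Equation) (a : ℕ → ℝ) {l : List ℤ} (hz : ZeroMomentum l)
    (hr : resonance E l = 0) (hl : l.length = 6) :
    symSum (bracket (chi4 E a) fun k => quartic E a k + resonantPart E (quartic E a) k) l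
      = ((((splits l).map fun x => if x.1.length = 3 then dispersionConst E * weight E x.1
          * quarticSym E a (-x.1.sum :: x.1) * quarticSym E a (x.1.sum :: x.2) else 0).sum : ℝ) : ℂ)
      := by
  rw [symSum_bracket, ofReal_list_sum]
  congr 1
  refine List.map_congr_left fun x hx => ?_
  have hp := perm_of_mem_splits hx
  have hlen := hp.length_eq
  have hsum := hp.sum_eq
  have hres := resonance_perm E hp
  rw [List.length_append] at hlen
  rw [List.sum_append, hz.2] at hsum
  rw [resonance_append, hr] at hres
  have hx1 : ∀ y ∈ x.1, y ≠ 0 := fun y hy => hz.1 y (hp.subset (by simp [hy]))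
  have hx2 : ∀ y ∈ x.2, y ≠ 0 := fun y hy => hz.1 y (hp.subset (by simp [hy]))
  have hr' : resonance E (x.1.sum :: x.2) = -resonance E (-x.1.sum :: x.1) := by
    rw [resonance_cons, resonance_cons, abs_neg]; linarith
  rw [symSum_add, symSum_resonantPart, chi4, symSum_homological]
  by_cases hw : weight E x.1 = 0
  · have : ((if x.1.length = 3 then dispersionConst E * weight E x.1
          * quarticSym E a (-x.1.sum :: x.1) * quarticSym E a (x.1.sum :: x.2) else 0 : ℝ) : ℂ)
        = 0 := by simp [hw]
    rw [this]
    rw [weight, div_eq_zero_iff] at hw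
    rcases hw with hw | hw
    · have : x.1.sum = 0 := by exact_mod_cast hw
      simp [this]
    · have : resonance E (-x.1.sum :: x.1) = 0 := by exact_mod_cast hw
      simp [this]
  obtain ⟨h0, h1⟩ := ne_zero_of_weight_ne_zero hw
  have hz1 : ∀ y ∈ (-x.1.sum :: x.1), y ≠ 0 := by
    intro y hy
    rcases List.mem_cons.1 hy with rfl | hy
    · simpa using h0
    · exact hx1 y hy
  have h2 : resonance E (x.1.sum :: x.2) ≠ 0 := by rw [hr']; simpa using h1
  rw [if_pos h1, if_neg h2]
  by_cases h3 : x.1.length = 3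
  · rw [if_pos h3]
    have hz2 : ZeroMomentum (x.1.sum :: x.2) := by
      refine ⟨?_, by simpa using hsum⟩
      intro y hy
      rcases List.mem_cons.1 hy with rfl | hy
      · exact h0
      · exact hx2 y hy
    rw [bracket_factor _ _ _ _ h1, symSum_quartic E a ⟨hz1, by simp⟩ (by simp [h3]),
      symSum_quartic E a hz2 (by rw [List.length_cons]; omega), weight]
    generalize resonance E (-x.1.sum :: x.1) = r
    generalize quarticSym E a (x.1.sum :: x.2) = g
    generalize quarticSym E a (-x.1.sum :: x.1) = g'
    generalize x.1.sum = j
    push_cast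
    ring
  · rw [symSum_quartic_of_length_ne E a hz1 (by simpa using h3)]
    simp [h3]

/-- The symmetrised sextic coefficients of an integrable monomial. -/
theorem symSum_sextic (E : Equation) (a : ℕ → ℝ) {l : List ℤ} (hz : ZeroMomentum l)
    (hr : resonance E l = 0) (hl : l.length = 6) :
    symSum (sextic E a) l = ((720 * a 6 + 720 * a 5 * a 3 * dispersionConst E * contractions E 1 l
      + 432 * a 4 * a 3 ^ 2 * dispersionConst E ^ 2 * contractions E 2 l
      + 162 * a 3 ^ 4 * dispersionConst E ^ 3 * contractions E 3 l
      + 1 / 2 * ((splits l).map fun x => if x.1.length = 3 then dispersionConst E * weight E x.1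
          * quarticSym E a (-x.1.sum :: x.1) * quarticSym E a (x.1.sum :: x.2) else 0).sum : ℝ) : ℂ)
      := by
  have h5 := symSum_iterate_bracket_chi3 E a 5 1 l hz hl
  have h4 := symSum_iterate_bracket_chi3 E a 4 2 l hz hl
  have h3 := symSum_iterate_bracket_chi3 E a 3 3 l hz hl
  simp only [Function.iterate_succ, Function.iterate_zero, Function.comp_apply, id_eq] at h3 h4 h5
  have : sextic E a = fun k => monomialHam a 6 k
    + bracket (chi3 E a) (monomialHam a 5) k
    + 1 / 2 * bracket (chi3 E a) (bracket (chi3 E a) (monomialHam a 4)) k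
    + 1 / 8 * bracket (chi3 E a) (bracket (chi3 E a)
        (bracket (chi3 E a) (monomialHam a 3))) k
    + 1 / 2 * bracket (chi4 E a)
        (fun l => quartic E a l + resonantPart E (quartic E a) l) k := rfl
  rw [this]
  simp only [symSum_add, symSum_mul_left]
  -- The constants are 720 = 6! = 3!·5!, 432 = ½·(3!)²·4! and 162 = ⅛·(3!)³·3!.
  rw [h3, h4, h5, symSum_bracket_chi4 E a hz hr hl, symSum_monomialHam, monomialHam,
    if_pos ⟨hl, hz⟩]
  push_cast
  simp [Nat.factorial]
  ring

/-! ### Computing contractions of lists of linear forms in two variables -/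

/-- The value at `(p, L)` of the linear form `x.1 p + x.2 L`. -/
def formVal (p L : ℤ) (x : ℤ × ℤ) : ℤ := x.1 * p + x.2 * L

/-- The order on linear forms given by their values at `(p, L)` for `0 < p ≪ L`. -/
def formPos (x : ℤ × ℤ) : Bool := decide (0 < x.2) || (decide (x.2 = 0) && decide (0 < x.1))

/-- A signed monomial in the inverses of linear forms. -/
abbrev InvMonomial := ℤ × List (ℤ × ℤ)

/-- The value of a monomial. -/
noncomputable def InvMonomial.val (p L : ℤ) (m : InvMonomial) : ℝ :=
  m.1 * (m.2.map fun x => ((formVal p L x : ℤ) : ℝ)⁻¹).prod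

/-- The value of a sum of monomials. -/
noncomputable def sumVal (p L : ℤ) (A : List InvMonomial) : ℝ := (A.map (InvMonomial.val p L)).sum

/-- Lexicographic comparison of linear forms. -/
def formLe (x y : ℤ × ℤ) : Bool :=
  decide (x.2 < y.2) || (decide (x.2 = y.2) && decide (x.1 ≤ y.1))

/-- Insertion of a linear form in a sorted list. -/
def insertForm (x : ℤ × ℤ) : List (ℤ × ℤ) → List (ℤ × ℤ)
  | [] => [x]
  | y :: l => bif formLe x y then x :: y :: l else y :: insertForm x l

/-- Equality test for lists of linear forms. -/
def formsEq : List (ℤ × ℤ) → List (ℤ × ℤ) → Bool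
  | [], [] => true
  | x :: l, y :: l' => decide (x.1 = y.1) && (decide (x.2 = y.2) && formsEq l l')
  | _, _ => false

/-- Addition of a monomial to a sum, collecting like terms. -/
def addMonomial (m : InvMonomial) : List InvMonomial → List InvMonomial
  | [] => [m]
  | m' :: A => bif formsEq m.2 m'.2 then
      (bif decide (m.1 + m'.1 = 0) then A else (m.1 + m'.1, m'.2) :: A)
      else m' :: addMonomial m A

/-- The product of two monomials. -/
def mulMonomial (m m' : InvMonomial) : InvMonomial := (m.1 * m'.1, m.2.foldr insertForm m'.2)

/-- The weight of the contraction of a pair of forms, up to the factor `weightScale`. -/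
def formWeight (E : Equation) (x y : ℤ × ℤ) : List InvMonomial :=
  bif decide (x = 0) || (decide (y = 0) || decide (x + y = 0)) then [] else
  match E with
  | .gKdV =>
    bif formPos x then (bif formPos y then [(-1, [x, y])] else [(1, [x, -y])])
    else (bif formPos y then [(1, [-x, y])] else [(-1, [-x, -y])])
  | .gBO =>
    bif formPos x then
      (bif formPos y then [(-1, [x]), (-1, [y])] else
        (bif formPos (x + y) then [(1, [-y])] else [(1, [x])]))
    else
      (bif formPos y then (bif formPos (x + y) then [(1, [-x])] else [(1, [y])])
        else [(-1, [-x]), (-1, [-y])])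

/-- The common denominator of the weights. -/
def weightScale : Equation → ℤ
  | .gKdV => 3
  | .gBO => 2

/-- Iterated contractions of lists of forms. -/
def formContractions (E : Equation) : ℕ → List (ℤ × ℤ) → List InvMonomial
  | 0, _ => [(1, [])]
  | n + 1, l => (splits l).foldr (fun x A => match x.1 with
      | [f, g] => match formWeight E f g with
        | [] => A
        | W => W.foldr (fun m A => (formContractions E n ((f + g) :: x.2)).foldr
            (fun m' A => addMonomial (mulMonomial m m') A) A) A
      | _ => A) []

theorem formVal_add (p L : ℤ) (x y : ℤ × ℤ) :
    formVal p L (x + y) = formVal p L x + formVal p L y := by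
  simp only [formVal, Prod.fst_add, Prod.snd_add]; ring

theorem formVal_neg (p L : ℤ) (x : ℤ × ℤ) : formVal p L (-x) = -formVal p L x := by
  simp only [formVal, Prod.fst_neg, Prod.snd_neg]; ring

theorem formVal_zero (p L : ℤ) : formVal p L 0 = 0 := by simp [formVal]

/-- As soon as `8 * p < L`, a positive coefficient of `L` outweighs any coefficient of `p` of
modulus at most 8, so signs can be read off symbolically. -/
theorem formVal_pos {p L : ℤ} (hp : 0 < p) (hL : 8 * p < L) {x : ℤ × ℤ} (hx : x.1.natAbs ≤ 8)
    (h : formPos x = true) : 0 < formVal p L x := by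
  simp only [formPos, Bool.or_eq_true, Bool.and_eq_true, decide_eq_true_eq] at h
  have h8 : -8 ≤ x.1 := by omega
  unfold formVal
  rcases h with h | ⟨h, h'⟩
  · nlinarith
  · rw [h]; nlinarith

theorem formVal_neg_of_not {p L : ℤ} (hp : 0 < p) (hL : 8 * p < L) {x : ℤ × ℤ}
    (hx : x.1.natAbs ≤ 8) (h0 : x ≠ 0) (h : formPos x = false) : formVal p L x < 0 := by
  have : formPos (-x) = true := by
    simp only [formPos, Bool.or_eq_false_iff, Bool.and_eq_false_iff, decide_eq_false_iff_not] at h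
    simp only [formPos, Bool.or_eq_true, Bool.and_eq_true, decide_eq_true_eq, Prod.fst_neg,
      Prod.snd_neg]
    by_contra hc
    apply h0
    ext <;> simp <;> omega
  have h1 := formVal_pos hp hL (x := -x) (by simpa using hx) this
  rw [formVal_neg] at h1
  linarith

theorem formsEq_iff : ∀ l l' : List (ℤ × ℤ), formsEq l l' = true → l = l'
  | [], [], _ => rfl
  | x :: l, y :: l', h => by
    simp only [formsEq, Bool.and_eq_true, decide_eq_true_eq] at h
    rw [formsEq_iff l l' h.2.2, Prod.ext h.1 h.2.1]
  | [], _ :: _, h => by simp [formsEq] at h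
  | _ :: _, [], h => by simp [formsEq] at h

theorem sumVal_cons (p L : ℤ) (m : InvMonomial) (A : List InvMonomial) :
    sumVal p L (m :: A) = m.val p L + sumVal p L A := by simp [sumVal]

theorem sumVal_addMonomial (p L : ℤ) (m : InvMonomial) (A : List InvMonomial) :
    sumVal p L (addMonomial m A) = m.val p L + sumVal p L A := by
  induction A with
  | nil => simp [addMonomial, sumVal]
  | cons m' A ih =>
    rw [addMonomial]
    cases h : formsEq m.2 m'.2 with
    | false => simp only [cond_false, sumVal_cons, ih]; ring
    | true =>
      have hs := formsEq_iff _ _ h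
      have key : m.val p L + m'.val p L
          = InvMonomial.val p L (m.1 + m'.1, m'.2) := by
        simp only [InvMonomial.val, hs]; push_cast; ring
      by_cases h0 : m.1 + m'.1 = 0
      · have : InvMonomial.val p L (m.1 + m'.1, m'.2) = 0 := by simp [InvMonomial.val, h0]
        simp only [h0, decide_true, cond_true, sumVal_cons]
        linarith
      · simp only [h0, decide_false, cond_true, cond_false, sumVal_cons]
        linarith

theorem prod_insertForm (p L : ℤ) (x : ℤ × ℤ) (l : List (ℤ × ℤ)) :
    ((insertForm x l).map fun x => ((formVal p L x : ℤ) : ℝ)⁻¹).prod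
      = ((formVal p L x : ℤ) : ℝ)⁻¹ * (l.map fun x => ((formVal p L x : ℤ) : ℝ)⁻¹).prod := by
  induction l with
  | nil => simp [insertForm]
  | cons y l ih =>
    rw [insertForm]
    cases formLe x y with
    | false => simp only [cond_false, List.map_cons, List.prod_cons, ih]; ring
    | true => simp

theorem val_mulMonomial (p L : ℤ) (m m' : InvMonomial) :
    (mulMonomial m m').val p L = m.val p L * m'.val p L := by
  have h : ∀ l l' : List (ℤ × ℤ),
      ((l.foldr insertForm l').map fun x => ((formVal p L x : ℤ) : ℝ)⁻¹).prod
        = (l.map fun x => ((formVal p L x : ℤ) : ℝ)⁻¹).prod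
          * (l'.map fun x => ((formVal p L x : ℤ) : ℝ)⁻¹).prod := by
    intro l l'
    induction l with
    | nil => simp
    | cons x l ih => simp only [List.foldr_cons, prod_insertForm, ih, List.map_cons,
        List.prod_cons]; ring
  simp only [InvMonomial.val, mulMonomial, h]
  push_cast
  ring

theorem sumVal_foldr_mul (p L : ℤ) (m : InvMonomial) (A B : List InvMonomial) :
    sumVal p L (B.foldr (fun m' A => addMonomial (mulMonomial m m') A) A)
      = m.val p L * sumVal p L B + sumVal p L A := by
  induction B with
  | nil => simp [sumVal]
  | cons m' B ih =>
    simp only [List.foldr_cons, sumVal_addMonomial, val_mulMonomial, ih, sumVal_cons]; ring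

theorem sumVal_foldr_foldr_mul (p L : ℤ) (A B W : List InvMonomial) :
    sumVal p L (W.foldr (fun m A => B.foldr (fun m' A => addMonomial (mulMonomial m m') A) A) A)
      = sumVal p L W * sumVal p L B + sumVal p L A := by
  induction W with
  | nil => simp [sumVal]
  | cons m W ih =>
    simp only [List.foldr_cons, sumVal_foldr_mul, ih, sumVal_cons]; ring

theorem resonance_pair_gKdV (x y : ℤ) :
    resonance .gKdV (-[x, y].sum :: [x, y]) = -3 * (x * y * (x + y)) := by
  simp only [resonance, Equation.alpha, sq_abs, List.map_cons, List.map_nil, List.sum_cons,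
    List.sum_nil]
  ring

/-- The cubic identity x³ + y³ - (x + y)³ = -3xy(x + y) makes the transferred momentum cancel, so
the weight is a monomial in inverses. -/
theorem weight_pair_gKdV {x y : ℤ} (hxy : x + y ≠ 0) :
    3 * weight .gKdV [x, y] = -((x : ℝ)⁻¹ * (y : ℝ)⁻¹) := by
  rw [weight, resonance_pair_gKdV]
  have h : (x : ℝ) + y ≠ 0 := by exact_mod_cast hxy
  by_cases hx : x = 0
  · simp [hx]
  by_cases hy : y = 0
  · simp [hy]
  have hx' : (x : ℝ) ≠ 0 := by exact_mod_cast hx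
  have hy' : (y : ℝ) ≠ 0 := by exact_mod_cast hy
  simp only [List.sum_cons, List.sum_nil, add_zero]
  push_cast
  field_simp

theorem weight_pair_neg (E : Equation) (x y : ℤ) : weight E [-x, -y] = weight E [x, y] := by
  have : resonance E (-[-x, -y].sum :: [-x, -y]) = -resonance E (-[x, y].sum :: [x, y]) := by
    simp only [resonance, List.map_cons, List.map_nil, List.sum_cons,
      List.sum_nil, abs_neg]
    rw [show -x + (-y + 0) = -(x + (y + 0)) by ring, abs_neg]
    ring
  rw [weight, weight, this]
  simp only [List.sum_cons, List.sum_nil]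
  push_cast
  rw [← neg_div_neg_eq]
  congr 1 <;> ring

theorem weight_pair_comm (E : Equation) (x y : ℤ) : weight E [x, y] = weight E [y, x] := by
  have hs : [x, y].sum = [y, x].sum := by simp [add_comm]
  have hp : (-[x, y].sum :: [x, y]).Perm (-[y, x].sum :: [y, x]) := by
    rw [hs]; exact (List.Perm.swap _ _ _).cons _
  rw [weight, weight, resonance_perm E hp, hs]

theorem weight_pair_gBO_pos {x y : ℤ} (hx : 0 < x) (hy : 0 < y) :
    2 * weight .gBO [x, y] = -(x : ℝ)⁻¹ - (y : ℝ)⁻¹ := by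
  have hr : resonance .gBO (-[x, y].sum :: [x, y]) = -2 * (x * y) := by
    simp only [resonance, Equation.alpha, List.map_cons, List.map_nil, List.sum_cons,
      List.sum_nil, abs_neg, pow_one, add_zero]
    rw [abs_of_pos hx, abs_of_pos hy, abs_of_pos (by linarith)]
    ring
  have hx' : (x : ℝ) ≠ 0 := by exact_mod_cast hx.ne'
  have hy' : (y : ℝ) ≠ 0 := by exact_mod_cast hy.ne'
  rw [weight, hr]
  simp only [List.sum_cons, List.sum_nil]
  push_cast
  field_simp
  ring

/-- Here x² - y² - (x + y)² = -2y(x + y), so again the transferred momentum cancels. The remaining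
sign patterns reduce to this one and to two positive entries by the symmetries `weight_pair_neg` and
`weight_pair_comm`. -/
theorem weight_pair_gBO_neg {x y : ℤ} (hxy : 0 < x + y) (hy : y < 0) :
    2 * weight .gBO [x, y] = (-(y : ℝ))⁻¹ := by
  have hr : resonance .gBO (-[x, y].sum :: [x, y]) = -2 * (y * (x + y)) := by
    simp only [resonance, Equation.alpha, List.map_cons, List.map_nil, List.sum_cons,
      List.sum_nil, abs_neg, pow_one, add_zero]
    rw [abs_of_pos (show 0 < x by linarith), abs_of_neg hy, abs_of_pos (by linarith)]
    ring
  have hx' : (x : ℝ) + y ≠ 0 := by exact_mod_cast hxy.ne'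
  have hy' : (y : ℝ) ≠ 0 := by exact_mod_cast hy.ne
  rw [weight, hr]
  simp only [List.sum_cons, List.sum_nil, add_zero]
  push_cast
  field_simp

theorem weight_pair_of_eq_zero (E : Equation) {x y : ℤ} (h : x = 0 ∨ y = 0 ∨ x + y = 0) :
    weight E [x, y] = 0 := by
  rw [weight, div_eq_zero_iff]
  rcases h with h | h | h
  · right; simp [resonance, h]
  · right; simp [resonance, h]
  · left; simp [h]

theorem sumVal_formWeight (E : Equation) {p L : ℤ} (hp : 0 < p) (hL : 8 * p < L)
    {x y : ℤ × ℤ} (h : x.1.natAbs + y.1.natAbs ≤ 8) :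
    sumVal p L (formWeight E x y)
      = weightScale E * weight E [formVal p L x, formVal p L y] := by
  have hxy8 : (x + y).1.natAbs ≤ 8 := by simp only [Prod.fst_add]; omega
  unfold formWeight
  by_cases h0 : x = 0 ∨ y = 0 ∨ x + y = 0
  · have h1 : (decide (x = 0) || (decide (y = 0) || decide (x + y = 0))) = true := by
      simpa using h0
    rw [h1, weight_pair_of_eq_zero]
    · simp [sumVal]
    · rw [← formVal_add]
      rcases h0 with h0 | h0 | h0 <;> simp [h0, formVal_zero]
  have h1 : (decide (x = 0) || (decide (y = 0) || decide (x + y = 0))) = false := by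
    simpa using h0
  rw [h1, cond_false]
  push Not at h0
  have key : ∀ z : ℤ × ℤ, z ≠ 0 → z.1.natAbs ≤ 8 → (formPos z = true ∧ 0 < formVal p L z) ∨
      (formPos z = false ∧ formVal p L z < 0) := by
    intro z hz hz8
    cases hc : formPos z with
    | true => exact Or.inl ⟨rfl, formVal_pos hp hL hz8 hc⟩
    | false => exact Or.inr ⟨rfl, formVal_neg_of_not hp hL hz8 hz hc⟩
  have hadd := formVal_add p L x y
  cases E with
  | gKdV =>
    have hne : formVal p L x + formVal p L y ≠ 0 := by
      rw [← hadd]; rcases key _ h0.2.2 hxy8 with h | h <;> omega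
    simp only [weightScale]
    push_cast
    rw [weight_pair_gKdV hne]
    cases formPos x <;> cases formPos y <;>
      simp [sumVal, InvMonomial.val, formVal_neg, inv_neg]
  | gBO =>
    simp only [weightScale]
    push_cast
    rcases key x h0.1 (by omega) with ⟨hx, hx'⟩ | ⟨hx, hx'⟩ <;>
    rcases key y h0.2.1 (by omega) with ⟨hy, hy'⟩ | ⟨hy, hy'⟩ <;>
    rcases key (x + y) h0.2.2 hxy8 with ⟨hz, hz'⟩ | ⟨hz, hz'⟩ <;>
    rw [hadd] at hz' <;> simp only [hx, hy, hz, cond_true, cond_false]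
    · rw [weight_pair_gBO_pos hx' hy']; simp [sumVal, InvMonomial.val]; ring
    · omega
    · rw [weight_pair_gBO_neg hz' hy']; simp [sumVal, InvMonomial.val, formVal_neg]
    · rw [← weight_pair_neg, weight_pair_comm, weight_pair_gBO_neg (by omega) (by omega)]
      simp [sumVal, InvMonomial.val]
    · rw [weight_pair_comm, weight_pair_gBO_neg (by omega) hx']
      simp [sumVal, InvMonomial.val, formVal_neg]
    · rw [← weight_pair_neg, weight_pair_gBO_neg (by omega) (by omega)]
      simp [sumVal, InvMonomial.val]
    · omega
    · rw [← weight_pair_neg, weight_pair_gBO_pos (by omega) (by omega)]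
      simp [sumVal, InvMonomial.val, formVal_neg]

theorem splits_map {α β : Type*} (f : α → β) (l : List α) :
    splits (l.map f) = (splits l).map fun x => (x.1.map f, x.2.map f) := by
  induction l with
  | nil => rfl
  | cons a l ih => simp [splits, ih, Function.comp_def]

/-- Correctness of the symbolic evaluation. By the triangle inequality a contraction does not
increase the sum of the moduli of the coefficients of `p`, so the bound 8, and with it every sign
test, persists at all depths. -/
theorem sumVal_formContractions (E : Equation) {p L : ℤ} (hp : 0 < p) (hL : 8 * p < L) :
    ∀ (n : ℕ) (l : List (ℤ × ℤ)), (l.map fun x => x.1.natAbs).sum ≤ 8 →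
      sumVal p L (formContractions E n l)
        = (weightScale E : ℝ) ^ n * contractions E n (l.map (formVal p L))
  | 0, l, _ => by simp [formContractions, sumVal, InvMonomial.val, contractions]
  | n + 1, l, hl => by
    rw [formContractions, contractions, splits_map, List.map_map, ← List.sum_map_mul_left]
    have hsub : ∀ x ∈ splits l, (x.1.map fun x => x.1.natAbs).sum
        + (x.2.map fun x => x.1.natAbs).sum ≤ 8 := by
      intro x hx
      have := ((perm_of_mem_splits hx).map fun x : ℤ × ℤ => x.1.natAbs).sum_eq
      rw [List.map_append, List.sum_append] at this
      omega
    generalize splits l = Z at hsub ⊢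
    induction Z with
    | nil => simp [sumVal]
    | cons x Z ih =>
      have ih' := ih fun y hy => hsub y (List.mem_cons_of_mem _ hy)
      have hx := hsub x List.mem_cons_self
      rw [List.foldr_cons, List.map_cons, List.sum_cons, ← ih']
      obtain ⟨S, T⟩ := x
      simp only [Function.comp_apply, List.length_map] at *
      match S, hx with
      | [f, g], hx =>
        simp only [List.map_cons, List.map_nil, List.sum_cons, List.sum_nil, add_zero] at hx
        have hw := sumVal_formWeight E hp hL (x := f) (y := g) (by omega)
        have hrec := sumVal_formContractions E hp hL n ((f + g) :: T) (by
          simp only [List.map_cons, List.sum_cons, Prod.fst_add]; omega)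
        simp only [List.length_cons, List.length_nil, if_true, List.map_cons, List.map_nil,
          List.sum_cons, List.sum_nil, add_zero]
        rw [List.map_cons, formVal_add] at hrec
        have : sumVal p L (formWeight E f g) * sumVal p L (formContractions E n ((f + g) :: T))
            = weightScale E ^ (n + 1) * (weight E [formVal p L f, formVal p L g]
              * contractions E n ((formVal p L f + formVal p L g) :: T.map (formVal p L))) := by
          rw [hw, hrec]; ring
        rw [← this]
        cases hW : formWeight E f g with
        | nil => simp [sumVal]
        | cons m W => exact sumVal_foldr_foldr_mul p L _ _ (m :: W)
      | [], _ => simp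
      | [_], _ => simp
      | _ :: _ :: _ :: _, _ => simp

/-! ### The coefficients of `I_p ^ 2 I_L` -/

/-- A pair y, -y inside a triple makes the contracted index equal to the third entry and the
resonance identically zero. Of the twenty triples taken from ±p, ±p, ±L this leaves only four. -/
theorem weight_triple_eq_zero (E : Equation) (x y : ℤ) :
    weight E [x, y, -y] = 0 ∧ weight E [y, -y, x] = 0 := by
  have : ∀ S : List ℤ, resonance E (-S.sum :: S) = 0 → weight E S = 0 := fun S h => by
    simp [weight, h]
  refine ⟨this _ ?_, this _ ?_⟩ <;>
    simp only [resonance, List.map_cons, List.map_nil, List.sum_cons, List.sum_nil, abs_neg]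
  · rw [show x + (y + (-y + 0)) = x by ring]; ring
  · rw [show y + (-y + (x + 0)) = x by ring]; ring

theorem contractions_of_forms (E : Equation) {p L : ℤ} (hp : 0 < p) (hL : 8 * p < L) (n : ℕ)
    (l : List (ℤ × ℤ)) (hl : (l.map fun x => x.1.natAbs).sum ≤ 8) (l' : List ℤ)
    (hl' : l.map (formVal p L) = l') (A : List InvMonomial) (hA : formContractions E n l = A) :
    contractions E n l' = sumVal p L A / (weightScale E : ℝ) ^ n := by
  rw [← hl', ← hA, sumVal_formContractions E hp hL n l hl, mul_div_cancel_left₀]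
  cases E <;> norm_num [weightScale]

/-- The sum of the contributions of the quartic terms. -/
theorem sum_quartic_splits (E : Equation) (a : ℕ → ℝ) (p L : ℤ) :
    ((splits [p, p, -p, -p, L, -L]).map fun x => if x.1.length = 3 then
        dispersionConst E * weight E x.1
          * quarticSym E a (-x.1.sum :: x.1) * quarticSym E a (x.1.sum :: x.2) else 0).sum
      = dispersionConst E * (weight E [p, p, L] * quarticSym E a [-(2 * p + L), p, p, L]
          * quarticSym E a [2 * p + L, -p, -p, -L]
        + weight E [p, p, -L] * quarticSym E a [-(2 * p - L), p, p, -L]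
          * quarticSym E a [2 * p - L, -p, -p, L]
        + weight E [-p, -p, L] * quarticSym E a [2 * p - L, -p, -p, L]
          * quarticSym E a [-(2 * p - L), p, p, -L]
        + weight E [-p, -p, -L] * quarticSym E a [2 * p + L, -p, -p, -L]
          * quarticSym E a [-(2 * p + L), p, p, L]) := by
  have h1 := fun x y => (weight_triple_eq_zero E x y).1
  have h2 := fun x y => (weight_triple_eq_zero E x y).2
  simp only [splits, List.map_cons, List.map_nil,
    List.nil_append, List.cons_append, List.length_cons, List.length_nil, List.sum_cons,
    List.sum_nil, Nat.reduceAdd, Nat.reduceEqDiff, if_true, if_false, h1, h2, mul_zero,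
    zero_mul, add_zero, zero_add, OfNat.zero_ne_ofNat, OfNat.one_ne_ofNat]
  have e1 : p + (p + L) = 2 * p + L := by ring
  have e2 : p + (p + -L) = 2 * p - L := by ring
  have e3 : -p + (-p + L) = -(2 * p - L) := by ring
  have e4 : -p + (-p + -L) = -(2 * p + L) := by ring
  rw [e1, e2, e3, e4, neg_neg, neg_neg]
  ring

/-- The factor 1/4 inverts the symmetry factor 2!·2!, since p and -p both occur twice. -/
theorem sexticCoeff_eq (E : Equation) (a : ℕ → ℝ) {p L : ℕ} (hp : 0 < p) (hL : 8 * p < L) :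
    sexticCoeff E a p p L = 1 / 4 * (720 * a 6 + 720 * a 5 * a 3 * dispersionConst E
        * contractions E 1 [(p : ℤ), p, -p, -p, L, -L]
      + 432 * a 4 * a 3 ^ 2 * dispersionConst E ^ 2
        * contractions E 2 [(p : ℤ), p, -p, -p, L, -L]
      + 162 * a 3 ^ 4 * dispersionConst E ^ 3
        * contractions E 3 [(p : ℤ), p, -p, -p, L, -L]
      + 1 / 2 * ((splits [(p : ℤ), p, -p, -p, L, -L]).map fun x => if x.1.length = 3 then
        dispersionConst E * weight E x.1 * quarticSym E a (-x.1.sum :: x.1)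
          * quarticSym E a (x.1.sum :: x.2) else 0).sum) := by
  have hp' : (0 : ℤ) < p := by exact_mod_cast hp
  have hL' : 8 * (p : ℤ) < L := by exact_mod_cast hL
  have hs : symmetryFactor [(p : ℤ), -p, p, -p, L, -L] = 4 := by
    have h1 : (-(p : ℤ) = p) = False := by simp; omega
    have h2 : ((p : ℤ) = -p) = False := by simp; omega
    have h3 : ((L : ℤ) = p) = False := by simp; omega
    have h4 : ((L : ℤ) = -p) = False := by simp; omega
    have h5 : (-(L : ℤ) = p) = False := by simp; omega
    have h6 : (-(L : ℤ) = -p) = False := by simp; omega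
    have h7 : (-(L : ℤ) = L) = False := by simp; omega
    simp [symmetryFactor, h1, h2, h3, h4, h5, h6, h7, -neg_inj]
  have h := sum_toFinset_permutations (sextic E a) [(p : ℤ), -p, p, -p, L, -L]
  have hperm : ([(p : ℤ), -p, p, -p, L, -L]).Perm [(p : ℤ), p, -p, -p, L, -L] :=
    (List.Perm.swap _ _ _).cons _
  rw [hs, symSum_perm _ hperm, symSum_sextic E a ⟨?_, ?_⟩ ?_ rfl] at h
  · have h2 : ∑ k ∈ ([(p : ℤ), -p, p, -p, L, -L]).permutations.toFinset, sextic E a k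
        = 1 / 4 * (((4 : ℕ) : ℂ) * ∑ k ∈ ([(p : ℤ), -p, p, -p, L, -L]).permutations.toFinset,
          sextic E a k) := by push_cast; ring
    rw [sexticCoeff, h2, h, show (1 / 4 : ℂ) = ((1 / 4 : ℝ) : ℂ) by push_cast; rfl,
      ← Complex.ofReal_mul, Complex.ofReal_re]
  · intro x hx
    simp only [List.mem_cons, List.not_mem_nil, or_false] at hx
    omega
  · simp
  · simp [resonance]

theorem resonance_triple_gKdV (x y z : ℤ) :
    resonance .gKdV (-[x, y, z].sum :: [x, y, z]) = -3 * ((x + y) * (y + z) * (x + z)) := by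
  simp only [resonance, Equation.alpha, sq_abs, List.map_cons, List.map_nil, List.sum_cons,
    List.sum_nil]
  ring

theorem resonance_triple_gBO {p L : ℤ} (hp : 0 < p) (hL : 8 * p < L) :
    resonance .gBO (-[p, p, L].sum :: [p, p, L]) = -2 * (p * (p + 2 * L)) ∧
    resonance .gBO (-[p, p, -L].sum :: [p, p, -L]) = -2 * (p * (2 * L - 3 * p)) ∧
    resonance .gBO (-[-p, -p, L].sum :: [-p, -p, L]) = 2 * (p * (2 * L - 3 * p)) ∧
    resonance .gBO (-[-p, -p, -L].sum :: [-p, -p, -L]) = 2 * (p * (p + 2 * L)) := by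
  have hp' := abs_of_pos hp
  have hL' := abs_of_pos (show 0 < L by linarith)
  simp only [resonance, Equation.alpha, List.map_cons, List.map_nil, List.sum_cons,
    List.sum_nil, abs_neg, pow_one, add_zero, hp', hL']
  rw [abs_of_pos (show 0 < p + (p + L) by linarith),
    abs_of_neg (show p + (p + -L) < 0 by linarith),
    abs_of_pos (show 0 < -p + (-p + L) by linarith),
    abs_of_neg (show -p + (-p + -L) < 0 by linarith)]
  refine ⟨?_, ?_, ?_, ?_⟩ <;> ring

/-- The apparent poles of the contractions at L = 0 and L = ±2p cancel, and all dependence on L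
collapses to a single fraction. The part free of L is isolated because zero momentum will eliminate
it; the squared factor is, up to normalisation, the non-degeneracy expression at k = p. -/
theorem sexticCoeff_gKdV (a : ℕ → ℝ) {p L : ℕ} (hp : 0 < p) (hL : 8 * p < L) :
    sexticCoeff .gKdV a p p L = (180 * a 6 - 120 * a 3 * a 5 * dispersionConst .gKdV / p ^ 2)
      - 24 * dispersionConst .gKdV * p ^ 2 * (2 * a 4 + dispersionConst .gKdV * a 3 ^ 2 / p ^ 2) ^ 2
        / (((L : ℝ) ^ 2 - p ^ 2) ^ 2) := by
  have hp' : (0 : ℤ) < p := by exact_mod_cast hp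
  have hL' : 8 * (p : ℤ) < L := by exact_mod_cast hL
  have hpr : (0 : ℝ) < p := by exact_mod_cast hp
  have hLr : 8 * (p : ℝ) < L := by exact_mod_cast hL
  -- The pair (x, y) stands for the form x p + y L. Each displayed list is the output of
  -- `formContractions`, confirmed by kernel evaluation.
  have c1 := contractions_of_forms .gKdV hp' hL' 1
    [(1, 0), (1, 0), (-1, 0), (-1, 0), (0, 1), (0, -1)] (by decide)
    [(p : ℤ), p, -p, -p, L, -L] (by simp [formVal])
    [(-2, [(1, 0), (1, 0)])]
    (by decide +kernel)
  have c2 := contractions_of_forms .gKdV hp' hL' 2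
    [(1, 0), (1, 0), (-1, 0), (-1, 0), (0, 1), (0, -1)] (by decide)
    [(p : ℤ), p, -p, -p, L, -L] (by simp [formVal])
    [(-4, [(1, 0), (1, 0), (0, 1), (1, 1)]), (-4, [(1, 0), (0, 1), (0, 1), (1, 1)]), (8, [(1,
    0), (1, 0), (0, 1), (0, 1)]), (-4, [(1, 0), (1, 0), (-1, 1), (0, 1)]), (4, [(1, 0), (-1,
    1), (0, 1), (0, 1)]), (-4, [(1, 0), (1, 0), (1, 0), (2, 0)]), (2, [(1, 0), (1, 0), (1,
    0), (1, 0)])]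
    (by decide +kernel)
  have c3 := contractions_of_forms .gKdV hp' hL' 3
    [(1, 0), (1, 0), (-1, 0), (-1, 0), (0, 1), (0, -1)] (by decide)
    [(p : ℤ), p, -p, -p, L, -L] (by simp [formVal])
    [(4, [(1, 0), (1, 0), (0, 1), (0, 1), (1, 1), (2, 1)]), (8, [(1, 0), (1, 0), (1, 0), (0,
    1), (1, 1), (2, 1)]), (-12, [(1, 0), (1, 0), (1, 0), (1, 0), (0, 1), (1, 1)]), (-24, [(1,
    0), (1, 0), (1, 0), (2, 0), (0, 1), (0, 1)]), (8, [(1, 0), (1, 0), (1, 0), (2, 0), (0,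
    1), (1, 1)]), (24, [(1, 0), (1, 0), (1, 0), (1, 0), (0, 1), (0, 1)]), (-8, [(1, 0), (1,
    0), (1, 0), (0, 1), (0, 1), (1, 1)]), (8, [(1, 0), (1, 0), (1, 0), (-1, 1), (0, 1), (0,
    1)]), (-8, [(1, 0), (1, 0), (-1, 1), (0, 1), (0, 1), (1, 1)]), (4, [(1, 0), (1, 0), (-2,
    1), (-1, 1), (0, 1), (0, 1)]), (-8, [(1, 0), (1, 0), (1, 0), (-2, 1), (-1, 1), (0, 1)]),
    (-12, [(1, 0), (1, 0), (1, 0), (1, 0), (-1, 1), (0, 1)]), (8, [(1, 0), (1, 0), (1, 0),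
    (2, 0), (-1, 1), (0, 1)]), (-2, [(1, 0), (1, 0), (2, 0), (-2, 1), (0, 1), (0, 1)]), (4,
    [(1, 0), (1, 0), (1, 0), (2, 0), (-2, 1), (0, 1)]), (2, [(1, 0), (1, 0), (2, 0), (0, 1),
    (0, 1), (2, 1)]), (4, [(1, 0), (1, 0), (1, 0), (2, 0), (0, 1), (2, 1)])]
    (by decide +kernel)
  have qP := contractions_of_forms .gKdV hp' hL' 1
    [(-2, -1), (1, 0), (1, 0), (0, 1)] (by decide)
    [-(2 * (p : ℤ) + L), p, p, L] (by simp [formVal]; try ring)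
    [(-2, [(1, 0), (0, 1)]), (-1, [(1, 0), (1, 0)]), (1, [(0, 1), (2, 1)]), (2, [(1, 0), (2,
    1)])]
    (by decide +kernel)
  have qP2 := contractions_of_forms .gKdV hp' hL' 1
    [(2, 1), (-1, 0), (-1, 0), (0, -1)] (by decide)
    [2 * (p : ℤ) + L, -p, -p, -L] (by simp [formVal]; try ring)
    [(-2, [(1, 0), (0, 1)]), (-1, [(1, 0), (1, 0)]), (1, [(0, 1), (2, 1)]), (2, [(1, 0), (2,
    1)])]
    (by decide +kernel)
  have qM := contractions_of_forms .gKdV hp' hL' 1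
    [(-2, 1), (1, 0), (1, 0), (0, -1)] (by decide)
    [-(2 * (p : ℤ) - L), p, p, -L] (by simp [formVal]; try ring)
    [(2, [(1, 0), (0, 1)]), (-1, [(1, 0), (1, 0)]), (1, [(-2, 1), (0, 1)]), (-2, [(1, 0),
    (-2, 1)])]
    (by decide +kernel)
  have qM2 := contractions_of_forms .gKdV hp' hL' 1
    [(2, -1), (-1, 0), (-1, 0), (0, 1)] (by decide)
    [2 * (p : ℤ) - L, -p, -p, L] (by simp [formVal]; try ring)
    [(2, [(1, 0), (0, 1)]), (-1, [(1, 0), (1, 0)]), (1, [(-2, 1), (0, 1)]), (-2, [(1, 0),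
    (-2, 1)])]
    (by decide +kernel)
  rw [sexticCoeff_eq .gKdV a hp hL, sum_quartic_splits]
  simp only [quarticSym, c1, c2, c3, qP, qP2, qM, qM2]
  clear c1 c2 c3 qP qP2 qM qM2
  have hLp : (L : ℝ) - p ≠ 0 := by linarith
  have hLp2 : (L : ℝ) - 2 * p ≠ 0 := by linarith
  have hL0 : (L : ℝ) ≠ 0 := by linarith
  have hpL : (L : ℝ) + p ≠ 0 := by linarith
  have hpL2 : (L : ℝ) + 2 * p ≠ 0 := by linarith
  simp only [weight, resonance_triple_gKdV]
  simp only [List.sum_cons, List.sum_nil, add_zero]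
  simp only [sumVal, InvMonomial.val, formVal, weightScale, List.map_cons, List.map_nil,
    List.prod_cons, List.prod_nil, List.sum_cons, List.sum_nil]
  push_cast
  generalize dispersionConst .gKdV = t
  generalize a 3 = a3
  generalize a 4 = a4
  generalize a 5 = a5
  generalize a 6 = a6
  generalize (p : ℝ) = x at *
  generalize (L : ℝ) = y at *
  have e1 : -x + y = y - x := by ring
  have e2 : -(2 * x) + y = y - 2 * x := by ring
  have e3 : x + y = y + x := by ring
  have e4 : 2 * x + y = y + 2 * x := by ring
  have e5 : x + -y = -(y - x) := by ring
  have e6 : -x + -y = -(y + x) := by ring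
  have e7 : y ^ 2 - x ^ 2 = (y - x) * (y + x) := by ring
  simp only [zero_mul, one_mul, add_zero, zero_add, neg_mul]
  simp only [e1, e2, e3, e4, e5, e6, e7]
  clear e1 e2 e3 e4 e5 e6 e7
  have hx := hpr.ne'
  field_simp
  ring

/-- The terms are sorted by their dependence on L. Weighted by m_j k_j at L = k_j, the first group
is eliminated by zero momentum and the 1/L group becomes a multiple of ∑ m_j whose factor contains
a_3. The last fraction, with the non-zero factor a_4², carries the pole p = -2L used later. -/
theorem sexticCoeff_gBO (a : ℕ → ℝ) {p L : ℕ} (hp : 0 < p) (hL : 8 * p < L) :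
    sexticCoeff .gBO a p p L = (180 * a 6 - 360 * a 3 * a 5 * dispersionConst .gBO / p)
      + (-360 * a 3 * a 5 * dispersionConst .gBO
          + 648 * a 3 ^ 2 * a 4 * dispersionConst .gBO ^ 2 / p) / L
      - 108 * a 3 ^ 2 * a 4 * dispersionConst .gBO ^ 2 * p / ((L : ℝ) ^ 2 * (L - p))
      - 288 * dispersionConst .gBO * a 4 ^ 2 * (L - p) / ((2 * L + p) * (2 * L - 3 * p)) := by
  have hp' : (0 : ℤ) < p := by exact_mod_cast hp
  have hL' : 8 * (p : ℤ) < L := by exact_mod_cast hL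
  have hpr : (0 : ℝ) < p := by exact_mod_cast hp
  have hLr : 8 * (p : ℝ) < L := by exact_mod_cast hL
  have c1 := contractions_of_forms .gBO hp' hL' 1
    [(1, 0), (1, 0), (-1, 0), (-1, 0), (0, 1), (0, -1)] (by decide)
    [(p : ℤ), p, -p, -p, L, -L] (by simp [formVal])
    [(-4, [(0, 1)]), (-4, [(1, 0)])]
    (by decide +kernel)
  have c2 := contractions_of_forms .gBO hp' hL' 2
    [(1, 0), (1, 0), (-1, 0), (-1, 0), (0, 1), (0, -1)] (by decide)
    [(p : ℤ), p, -p, -p, L, -L] (by simp [formVal])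
    [(4, [(0, 1), (1, 1)]), (20, [(1, 0), (0, 1)]), (4, [(0, 1), (0, 1)]), (4, [(1, 0), (1,
    1)]), (-4, [(1, 0), (-1, 1)])]
    (by decide +kernel)
  have c3 := contractions_of_forms .gBO hp' hL' 3
    [(1, 0), (1, 0), (-1, 0), (-1, 0), (0, 1), (0, -1)] (by decide)
    [(p : ℤ), p, -p, -p, L, -L] (by simp [formVal])
    [(24, [(1, 0), (0, 1), (0, 1)]), (-60, [(1, 0), (0, 1), (1, 1)]), (-20, [(0, 1), (0, 1),
    (1, 1)]), (76, [(1, 0), (1, 0), (0, 1)]), (24, [(1, 0), (-1, 1), (0, 1)]), (-40, [(1, 0),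
    (1, 0), (1, 1)]), (-24, [(1, 0), (1, 0), (-1, 1)]), (-4, [(1, 0), (1, 0), (-2, 1)]), (4,
    [(1, 0), (2, 0), (-2, 1)]), (-4, [(1, 0), (2, 0), (0, 1)])]
    (by decide +kernel)
  have qP := contractions_of_forms .gBO hp' hL' 1
    [(-2, -1), (1, 0), (1, 0), (0, 1)] (by decide)
    [-(2 * (p : ℤ) + L), p, p, L] (by simp [formVal]; try ring)
    [(-1, [(0, 1)]), (-2, [(1, 0)])]
    (by decide +kernel)
  have qP2 := contractions_of_forms .gBO hp' hL' 1
    [(2, 1), (-1, 0), (-1, 0), (0, -1)] (by decide)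
    [2 * (p : ℤ) + L, -p, -p, -L] (by simp [formVal]; try ring)
    [(-1, [(0, 1)]), (-2, [(1, 0)])]
    (by decide +kernel)
  have qM := contractions_of_forms .gBO hp' hL' 1
    [(-2, 1), (1, 0), (1, 0), (0, -1)] (by decide)
    [-(2 * (p : ℤ) - L), p, p, -L] (by simp [formVal]; try ring)
    [(-2, [(1, 0)]), (-1, [(-2, 1)])]
    (by decide +kernel)
  have qM2 := contractions_of_forms .gBO hp' hL' 1
    [(2, -1), (-1, 0), (-1, 0), (0, 1)] (by decide)
    [2 * (p : ℤ) - L, -p, -p, L] (by simp [formVal]; try ring)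
    [(-2, [(1, 0)]), (-1, [(-2, 1)])]
    (by decide +kernel)
  rw [sexticCoeff_eq .gBO a hp hL, sum_quartic_splits]
  simp only [quarticSym, c1, c2, c3, qP, qP2, qM, qM2]
  clear c1 c2 c3 qP qP2 qM qM2
  have hLp : (L : ℝ) - p ≠ 0 := by linarith
  have hLp2 : (L : ℝ) - 2 * p ≠ 0 := by linarith
  have hL0 : (L : ℝ) ≠ 0 := by linarith
  have hpL : (L : ℝ) + p ≠ 0 := by linarith
  have hpL2 : (L : ℝ) + 2 * p ≠ 0 := by linarith
  obtain ⟨r1, r2, r3, r4⟩ := resonance_triple_gBO hp' hL'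
  simp only [weight, r1, r2, r3, r4]
  simp only [List.sum_cons, List.sum_nil, add_zero]
  have hL3 : 2 * (L : ℝ) - 3 * p ≠ 0 := by linarith
  have hpL3 : 2 * (L : ℝ) + p ≠ 0 := by linarith
  simp only [sumVal, InvMonomial.val, formVal, weightScale, List.map_cons, List.map_nil,
    List.prod_cons, List.prod_nil, List.sum_cons, List.sum_nil]
  push_cast
  generalize dispersionConst .gBO = t
  generalize a 3 = a3
  generalize a 4 = a4
  generalize a 5 = a5
  generalize a 6 = a6
  generalize (p : ℝ) = x at *
  generalize (L : ℝ) = y at *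
  have e1 : -x + y = y - x := by ring
  have e2 : -(2 * x) + y = y - 2 * x := by ring
  have e3 : x + y = y + x := by ring
  have e5 : x + -y = -(y - x) := by ring
  have e6 : -x + -y = -(y + x) := by ring
  have e7 : x + 2 * y = 2 * y + x := by ring
  simp only [zero_mul, one_mul, add_zero, zero_add, neg_mul]
  simp only [e1, e2, e3, e5, e6, e7]
  clear e1 e2 e3 e5 e6 e7
  have hx := hpr.ne'
  have hL2' : y - x * 2 ≠ 0 := by rwa [mul_comm]
  have hL3' : y * 2 - x * 3 ≠ 0 := by rwa [mul_comm y, mul_comm x]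
  have hpL3' : y * 2 + x ≠ 0 := by rwa [mul_comm]
  field_simp
  ring

/-! ### Polynomial bounds on the coefficients -/

/-- Polynomial growth of a family of coefficients, at bounded degree. -/
def PolyBounded (P : List ℤ → ℂ) (d : ℕ) : Prop :=
  ∀ n : ℕ, ∃ C : ℝ, 0 ≤ C ∧ ∀ N : ℝ, 1 ≤ N → ∀ k : List ℤ, k.length ≤ n →
    (∀ x ∈ k, |(x : ℝ)| ≤ N) → ‖P k‖ ≤ C * N ^ d

theorem PolyBounded.mono {P : List ℤ → ℂ} {d d' : ℕ} (h : PolyBounded P d) (hd : d ≤ d') :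
    PolyBounded P d' := fun n => by
  obtain ⟨C, hC, H⟩ := h n
  exact ⟨C, hC, fun N hN k hk hkN => (H N hN k hk hkN).trans
    (mul_le_mul_of_nonneg_left (pow_le_pow_right₀ hN hd) hC)⟩

theorem PolyBounded.add {P Q : List ℤ → ℂ} {d : ℕ} (hP : PolyBounded P d) (hQ : PolyBounded Q d) :
    PolyBounded (fun k => P k + Q k) d := fun n => by
  obtain ⟨C, hC, H⟩ := hP n
  obtain ⟨C', hC', H'⟩ := hQ n
  refine ⟨C + C', by positivity, fun N hN k hk hkN => (norm_add_le _ _).trans ?_⟩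
  rw [add_mul]
  exact add_le_add (H N hN k hk hkN) (H' N hN k hk hkN)

theorem PolyBounded.const_mul {P : List ℤ → ℂ} {d : ℕ} (hP : PolyBounded P d) (c : ℂ) :
    PolyBounded (fun k => c * P k) d := fun n => by
  obtain ⟨C, hC, H⟩ := hP n
  refine ⟨‖c‖ * C, by positivity, fun N hN k hk hkN => ?_⟩
  rw [norm_mul, mul_assoc]
  exact mul_le_mul_of_nonneg_left (H N hN k hk hkN) (norm_nonneg _)

theorem PolyBounded.of_norm_le {P Q : List ℤ → ℂ} {d : ℕ} (hP : PolyBounded P d)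
    (h : ∀ k, ‖Q k‖ ≤ ‖P k‖) : PolyBounded Q d := fun n => by
  obtain ⟨C, hC, H⟩ := hP n
  exact ⟨C, hC, fun N hN k hk hkN => (h k).trans (H N hN k hk hkN)⟩

theorem polyBounded_monomialHam (a : ℕ → ℝ) (n : ℕ) : PolyBounded (monomialHam a n) 0 := fun _ => by
  refine ⟨|a n|, abs_nonneg _, fun N _ k _ _ => ?_⟩
  rw [monomialHam]
  split_ifs <;> simp

/-- The resonance is an integer, so the denominators of `χ₃` and `χ₄` cause no loss in the
polynomial bounds. -/
theorem one_le_abs_Omega (E : Equation) (k : List ℤ) (h : resonance E k ≠ 0) :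
    1 ≤ |Omega E k| := by
  have h1 : (1 : ℝ) ≤ |(resonance E k : ℝ)| := by exact_mod_cast Int.one_le_abs h
  have hpi := Real.pi_gt_three
  have h2 : (2 * Real.pi) ≤ (2 * Real.pi) ^ (1 + E.alpha) :=
    le_self_pow₀ (by linarith) (by omega)
  rw [Omega, abs_mul, abs_of_pos (by positivity)]
  nlinarith

theorem PolyBounded.homological {E : Equation} {b : List ℤ → ℂ} {d : ℕ} (h : PolyBounded b d) :
    PolyBounded (homological E b) d := h.of_norm_le fun k => by
  rw [RationalNormalForm.homological]
  split_ifs with h0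
  · rw [norm_div, norm_mul, Complex.norm_I, one_mul, Complex.norm_real]
    exact div_le_self (norm_nonneg _) (one_le_abs_Omega E k h0)
  · simp

theorem PolyBounded.resonantPart {E : Equation} {b : List ℤ → ℂ} {d : ℕ} (h : PolyBounded b d) :
    PolyBounded (resonantPart E b) d := h.of_norm_le fun k => by
  rw [RationalNormalForm.resonantPart]
  split_ifs with h0 <;> simp

theorem abs_list_sum_le (k : List ℤ) {N : ℝ} (h : ∀ x ∈ k, |(x : ℝ)| ≤ N) :
    |(k.sum : ℝ)| ≤ k.length * N := by
  induction k with
  | nil => simp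
  | cons x k ih =>
    have h1 := h x (by simp)
    have h2 := ih fun y hy => h y (by simp [hy])
    simp only [List.sum_cons, List.length_cons]
    push_cast [-Int.cast_list_sum]
    calc |(x : ℝ) + (k.sum : ℝ)| ≤ |(x : ℝ)| + |(k.sum : ℝ)| := abs_add_le _ _
      _ ≤ N + k.length * N := add_le_add h1 h2
      _ = _ := by ring

/-- Only the factor j of the bracket costs a power of `N`; the inserted index is still bounded by a
fixed multiple of `N`. -/
theorem PolyBounded.bracket {P Q : List ℤ → ℂ} {d e : ℕ} (hP : PolyBounded P d)
    (hQ : PolyBounded Q e) : PolyBounded (bracket P Q) (d + e + 1) := fun n => by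
  obtain ⟨C, hC, H⟩ := hP (n + 1)
  obtain ⟨C', hC', H'⟩ := hQ (n + 1)
  set B : ℝ := 2 * Real.pi * n * (C * (n + 1) ^ d) * (C' * (n + 1) ^ e) with hB
  have hB0 : 0 ≤ B := by have := Real.pi_pos; positivity
  refine ⟨(n + 1) * ((n + 1) * ((n + 1) * B)), by positivity, fun N hN k hk hkN => ?_⟩
  have hN0 : 0 ≤ N := by linarith
  have hlen : (k.length : ℝ) ≤ n := by exact_mod_cast hk
  have hn0 : (0 : ℝ) ≤ n := Nat.cast_nonneg n
  have hN' : (1 : ℝ) ≤ (n + 1) * N := by nlinarith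
  have hNN' : N ≤ (n + 1) * N := by nlinarith
  have hrange : ∀ (m : ℕ) (f : ℕ → ℂ) (M : ℝ), m ≤ n + 1 → 0 ≤ M →
      (∀ i ∈ Finset.range m, ‖f i‖ ≤ M) → ‖∑ i ∈ Finset.range m, f i‖ ≤ (n + 1) * M := by
    intro m f M hm hM hf
    calc ‖∑ i ∈ Finset.range m, f i‖ ≤ ∑ i ∈ Finset.range m, ‖f i‖ := norm_sum_le _ _
      _ ≤ ∑ _i ∈ Finset.range m, M := Finset.sum_le_sum hf
      _ = m * M := by simp
      _ ≤ (n + 1) * M := by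
        apply mul_le_mul_of_nonneg_right _ hM
        exact_mod_cast hm
  have hNd : (0 : ℝ) ≤ N ^ (d + e + 1) := by positivity
  have hBN : 0 ≤ B * N ^ (d + e + 1) := by positivity
  rw [RationalNormalForm.bracket, show (n + 1) * ((n + 1) * ((n + 1) * B)) * N ^ (d + e + 1)
    = (n + 1) * ((n + 1) * ((n + 1) * (B * N ^ (d + e + 1)))) by ring]
  refine hrange (k.length + 1) _ _ (by omega) (by positivity) fun m hm => ?_
  have hm' : m ≤ k.length := Nat.lt_succ_iff.1 (Finset.mem_range.1 hm)
  refine hrange (m + 1) _ _ (by omega) (by positivity) fun i hi => ?_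
  refine hrange (k.length - m + 1) _ _ (by omega) (by positivity) fun i' hi' => ?_
  have hi := Nat.lt_succ_iff.1 (Finset.mem_range.1 hi)
  have hi' := Nat.lt_succ_iff.1 (Finset.mem_range.1 hi')
  set j := (k.take m).sum with hj
  have hjN : |(j : ℝ)| ≤ n * N := by
    refine (abs_list_sum_le _ fun x hx => hkN x (List.mem_of_mem_take hx)).trans ?_
    apply mul_le_mul_of_nonneg_right _ hN0
    refine le_trans ?_ hlen
    exact_mod_cast (by simp)
  have hP' : ‖P ((k.take m).insertIdx i (-j))‖ ≤ C * ((n + 1) * N) ^ d := by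
    refine H _ hN' _ ?_ fun x hx => ?_
    · rw [List.length_insertIdx_of_le_length (by simp; omega)]
      simp; omega
    · rcases List.eq_or_mem_of_mem_insertIdx hx with rfl | hx
      · push_cast; rw [abs_neg]; linarith
      · exact (hkN x (List.mem_of_mem_take hx)).trans hNN'
  have hQ' : ‖Q ((k.drop m).insertIdx i' j)‖ ≤ C' * ((n + 1) * N) ^ e := by
    refine H' _ hN' _ ?_ fun x hx => ?_
    · rw [List.length_insertIdx_of_le_length (by simp; omega)]
      simp; omega
    · rcases List.eq_or_mem_of_mem_insertIdx hx with rfl | hx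
      · linarith
      · exact (hkN x (List.mem_of_mem_drop hx)).trans hNN'
  rw [norm_mul, norm_mul, norm_mul, norm_mul, norm_mul, Complex.norm_I, Complex.norm_real,
    Real.norm_of_nonneg Real.pi_pos.le, Complex.norm_intCast]
  have h2 : ‖(2 : ℂ)‖ = 2 := by simp
  rw [h2, mul_one]
  calc 2 * Real.pi * |(j : ℝ)| * ‖P ((k.take m).insertIdx i (-j))‖
        * ‖Q ((k.drop m).insertIdx i' j)‖
      ≤ 2 * Real.pi * (n * N) * (C * ((n + 1) * N) ^ d) * (C' * ((n + 1) * N) ^ e) := by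
        have := Real.pi_pos
        gcongr
    _ = B * N ^ (d + e + 1) := by
        rw [hB, mul_pow, mul_pow]; ring

/-- Degree 3 counts brackets: three nested ones with `χ₃`, or one bracket of `χ₄` with quartic
terms, each of which already contains one. -/
theorem polyBounded_sextic (E : Equation) (a : ℕ → ℝ) : PolyBounded (sextic E a) 3 := by
  have h3 : PolyBounded (chi3 E a) 0 := (polyBounded_monomialHam a 3).homological
  have h4 : PolyBounded (quartic E a) 1 :=
    ((polyBounded_monomialHam a 4).mono (by norm_num)).add
      ((h3.bracket (polyBounded_monomialHam a 3)).const_mul _)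
  have h4' : PolyBounded (chi4 E a) 1 := h4.homological
  exact (((((polyBounded_monomialHam a 6).mono (by norm_num)).add
    ((h3.bracket (polyBounded_monomialHam a 5)).mono (by norm_num))).add
    (((h3.bracket (h3.bracket (polyBounded_monomialHam a 4))).mono (by norm_num)).const_mul _)).add
    ((h3.bracket (h3.bracket (h3.bracket (polyBounded_monomialHam a 3)))).const_mul _)).add
    ((h4'.bracket (h4.add h4.resonantPart)).const_mul _)

theorem exists_sexticCoeff_bound (E : Equation) (a : ℕ → ℝ) : ∃ C : ℝ, 0 ≤ C ∧ ∀ N : ℝ, 1 ≤ N →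
    ∀ p q l : ℕ, (p : ℝ) ≤ N → (q : ℝ) ≤ N → (l : ℝ) ≤ N →
      |sexticCoeff E a p q l| ≤ C * N ^ 3 := by
  obtain ⟨C, hC, H⟩ := polyBounded_sextic E a 6
  refine ⟨720 * C, by positivity, fun N hN p q l hp hq hl => ?_⟩
  have hCN : 0 ≤ C * N ^ 3 := by positivity
  rw [sexticCoeff]
  refine (Complex.abs_re_le_norm _).trans ((norm_sum_le _ _).trans ?_)
  refine (Finset.sum_le_card_nsmul _ _ (C * N ^ 3) fun k hk => ?_).trans ?_
  · rw [List.mem_toFinset, List.mem_permutations] at hk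
    refine H N hN k (by rw [hk.length_eq]; simp) fun x hx => ?_
    have := hk.subset hx
    simp only [List.mem_cons, List.not_mem_nil, or_false] at this
    rcases this with rfl | rfl | rfl | rfl | rfl | rfl <;> push_cast <;>
      simpa [abs_neg] using by assumption
  · rw [nsmul_eq_mul, mul_assoc]
    apply mul_le_mul_of_nonneg_right _ hCN
    have h1 := List.toFinset_card_le
      ([(p : ℤ), -(p : ℤ), (q : ℤ), -(q : ℤ), (l : ℤ), -(l : ℤ)].permutations)
    rw [List.length_permutations] at h1
    have h2 : [(p : ℤ), -(p : ℤ), (q : ℤ), -(q : ℤ), (l : ℤ), -(l : ℤ)].length ! = 720 := by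
      simp [Nat.factorial]
    rw [h2] at h1
    exact_mod_cast h1

/-! ### The smallest effective index -/

theorem exists_pos_le_of_eventually_one_le (f : ℕ → ℝ) (hf : ∀ k, 1 ≤ k → 0 < f k)
    (h : ∃ K, ∀ k, K ≤ k → 1 ≤ f k) : ∃ c : ℝ, 0 < c ∧ ∀ k, 1 ≤ k → c ≤ f k := by
  obtain ⟨K, hK⟩ := h
  induction K with
  | zero => exact ⟨1, one_pos, fun k _ => hK k (Nat.zero_le k)⟩
  | succ K _ =>
    have hne : (Finset.Icc 1 (K + 1)).Nonempty := ⟨1, by simp⟩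
    obtain ⟨k₀, hk₀, hmin⟩ := Finset.exists_min_image _ f hne
    refine ⟨min 1 (f k₀), lt_min one_pos (hf k₀ (Finset.mem_Icc.1 hk₀).1), fun k hk => ?_⟩
    by_cases hkK : k ≤ K + 1
    · exact (min_le_right _ _).trans (hmin k (Finset.mem_Icc.2 ⟨hk, hkK⟩))
    · exact (min_le_left _ _).trans (hK k (by omega))

theorem exists_pos_le_abs_of_finset (T : Finset ℝ) : ∃ c : ℝ, 0 < c ∧ ∀ x ∈ T, x ≠ 0 → c ≤ |x| := by
  induction T using Finset.induction_on with
  | empty => exact ⟨1, one_pos, by simp⟩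
  | insert y T _ ih =>
    obtain ⟨c, hc, H⟩ := ih
    by_cases hy : y = 0
    · exact ⟨c, hc, fun x hx hx0 => by
        rcases Finset.mem_insert.1 hx with rfl | hx
        · exact absurd hy hx0
        · exact H x hx hx0⟩
    · exact ⟨min c |y|, lt_min hc (abs_pos.2 hy), fun x hx hx0 => by
        rcases Finset.mem_insert.1 hx with rfl | hx
        · exact min_le_right _ _
        · exact (min_le_left _ _).trans (H x hx hx0)⟩

section MultIndex

variable {n : ℕ} {m : Fin (n + 2) → ℤ} {k : Fin (n + 2) → ℕ}

theorem IsMultIndex.le_l1 (h : IsMultIndex m k) : n + 2 ≤ l1 m := by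
  have : ∑ _j : Fin (n + 2), 1 ≤ l1 m := Finset.sum_le_sum fun j _ =>
    Nat.one_le_iff_ne_zero.2 (Int.natAbs_ne_zero.2 (h.mult_ne_zero j))
  simpa using this

theorem natAbs_le_l1 (m : Fin (n + 2) → ℤ) (j : Fin (n + 2)) : (m j).natAbs ≤ l1 m :=
  Finset.single_le_sum (f := fun j => (m j).natAbs) (fun _ _ => Nat.zero_le _) (Finset.mem_univ j)

theorem IsMultIndex.last_le (h : IsMultIndex m k) (j : Fin (n + 2)) : k (Fin.last _) ≤ k j :=
  h.index_anti.antitone (Fin.le_last j)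

theorem IsMultIndex.le_zero (h : IsMultIndex m k) (j : Fin (n + 2)) : k j ≤ k 0 :=
  h.index_anti.antitone (Fin.zero_le j)

theorem IsMultIndex.one_le_abs (h : IsMultIndex m k) (j : Fin (n + 2)) : 1 ≤ |(m j : ℝ)| := by
  exact_mod_cast Int.one_le_abs (h.mult_ne_zero j)

theorem sum_ite_index_eq (h : IsMultIndex m k) (f : Fin (n + 2) → ℝ) (b : Fin (n + 2)) :
    (∑ j, if k j = k b then f j else 0) = f b := by
  simp only [h.index_anti.injective.eq_iff]
  simp

theorem delta4_eq_zero_of_lt_gKdV (a : ℕ → ℝ) (h : IsMultIndex m k) {p : ℕ}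
    (hp : p < k (Fin.last _)) : delta4 .gKdV a m k p = 0 := by
  have : ∀ j, k j ≠ p := fun j => by have := h.last_le j; omega
  simp [delta4, this]

theorem delta4_last_gKdV (a : ℕ → ℝ) (h : IsMultIndex m k) :
    delta4 .gKdV a m k (k (Fin.last _)) * k (Fin.last _)
      = -(m (Fin.last _) * (3 / Real.pi ^ 2) *
        (4 * Real.pi ^ 2 * (k (Fin.last _) : ℝ) ^ 2 * a 4 + a 3 ^ 2)) := by
  have hk : (k (Fin.last _) : ℝ) ≠ 0 := by exact_mod_cast (h.index_pos _).ne'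
  have hpi := Real.pi_ne_zero
  simp only [delta4]
  rw [sum_ite_index_eq h (fun j => (m j : ℝ) * (k j : ℝ) * (12 * a 4 + 3 * a 3 ^ 2 /
    (Real.pi ^ 2 * (k j : ℝ) ^ 2)))]
  field_simp
  ring

theorem delta4_of_le_last_gBO (a : ℕ → ℝ) (h : IsMultIndex m k) {p : ℕ}
    (hp : p ≤ k (Fin.last _)) (hS : a 3 = 0 ∨ ∑ j, m j = 0) :
    delta4 .gBO a m k p = -12 * a 4 * (∑ j, if k j = p then (m j : ℝ) * (k j : ℝ) else 0) := by
  have h1 : ∀ j, p ≤ k j := fun j => hp.trans (h.last_le j)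
  have h2 : ∀ j, ¬ k j < p := fun j => not_lt.2 (h1 j)
  simp only [delta4, h1, h2, if_true, if_false, Finset.sum_const_zero, mul_zero, add_zero]
  rcases hS with hS | hS
  · simp [hS]
  · have : (∑ j, (m j : ℝ)) = 0 := by exact_mod_cast hS
    simp [this]

/-- Away from the k_j, δ_p is proportional to U + V / p, with U and V unchanged between consecutive
such p. If it vanishes at two consecutive values then U = V = 0. At the largest k_b below them the
two non-local sums become m_b and -m_b k_b and still cancel, so only the diagonal term -12 a_4 m_b
k_b remains. -/
theorem exists_delta4_ne_zero_gBO (a : ℕ → ℝ) (h3 : a 3 ≠ 0) (h4 : a 4 ≠ 0) (h : IsMultIndex m k)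
    (hS : ∑ j, m j ≠ 0) : ∃ p, 1 ≤ p ∧ p ≤ 2 * l1 m + 2 ∧ delta4 .gBO a m k p ≠ 0 := by
  -- a pair of consecutive indices avoiding all the `k j`
  obtain ⟨t, ht, htn⟩ : ∃ t ∈ Finset.range (l1 m + 1),
      t ∉ Finset.univ.image fun j => (k j - 1) / 2 := by
    -- Pigeonhole: there are |m|₁ + 1 disjoint pairs {2t + 1, 2t + 2}, but at most |m|₁ indices k_j.
    apply Finset.exists_mem_notMem_of_card_lt_card
    refine Finset.card_image_le.trans_lt ?_
    have := h.le_l1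
    simp
    omega
  have ht' : ∀ j, k j ≠ 2 * t + 1 ∧ k j ≠ 2 * t + 2 := by
    intro j
    have h1 := h.index_pos j
    have h2 : (k j - 1) / 2 ≠ t := fun hh => htn (Finset.mem_image.2 ⟨j, Finset.mem_univ _, hh⟩)
    omega
  have ht2 := Finset.mem_range.1 ht
  set p := 2 * t + 1 with hp
  set U : ℝ := ∑ j, if p ≤ k j then (m j : ℝ) else 0 with hU
  set V : ℝ := ∑ j, if k j < p then (m j : ℝ) * (k j : ℝ) else 0 with hV
  have hc : 18 * a 3 ^ 2 / Real.pi ≠ 0 := by have := Real.pi_ne_zero; positivity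
  have hp0 : (0 : ℝ) < p := by positivity
  have d1 : delta4 .gBO a m k p = -(18 * a 3 ^ 2 / Real.pi * (U + 1 / p * V)) := by
    simp only [delta4, (ht' _).1, if_false, ← hU, ← hV]
    simp
  have d2 : delta4 .gBO a m k (p + 1)
      = -(18 * a 3 ^ 2 / Real.pi * (U + 1 / ((p : ℝ) + 1) * V)) := by
    have e1 : ∀ j, (p + 1 ≤ k j) = (p ≤ k j) := fun j => by
      have := ht' j; apply propext; omega
    have e2 : ∀ j, (k j < p + 1) = (k j < p) := fun j => by
      have := ht' j; apply propext; omega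
    have e3 : ∀ j, (k j = p + 1) = False := fun j => by
      have := ht' j; apply propext; simp; omega
    simp only [delta4, e1, e2, e3, if_false, ← hU, ← hV]
    simp
  by_cases hz1 : U + 1 / p * V = 0
  swap
  · exact ⟨p, by omega, by omega, by rw [d1]; exact neg_ne_zero.2 (mul_ne_zero hc hz1)⟩
  by_cases hz2 : U + 1 / ((p : ℝ) + 1) * V = 0
  swap
  · exact ⟨p + 1, by omega, by omega, by rw [d2]; exact neg_ne_zero.2 (mul_ne_zero hc hz2)⟩
  field_simp at hz1 hz2
  have hU0 : U = 0 := by linarith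
  have hV0 : V = 0 := by simpa [hU0] using hz1
  -- If every k_j were at least p, then U would be the full sum of the m_j, which is non-zero.
  have hne : (Finset.univ.filter fun j => k j < p).Nonempty := by
    by_contra hcon
    rw [Finset.not_nonempty_iff_eq_empty, Finset.filter_eq_empty_iff] at hcon
    apply hS
    have : (∑ j, (m j : ℝ)) = U := by
      rw [hU]
      refine Finset.sum_congr rfl fun j _ => ?_
      rw [if_pos (not_lt.1 (hcon (Finset.mem_univ j)))]
    rw [hU0] at this
    exact_mod_cast this
  obtain ⟨b, hb, hmax⟩ := Finset.exists_max_image _ k hne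
  have hb' := (Finset.mem_filter.1 hb).2
  refine ⟨k b, h.index_pos b, by omega, ?_⟩
  have s1 : (∑ j, if k b ≤ k j then (m j : ℝ) else 0) = U + m b := by
    rw [hU, ← sum_ite_index_eq h (fun j => (m j : ℝ)) b, ← Finset.sum_add_distrib]
    refine Finset.sum_congr rfl fun j _ => ?_
    by_cases hj : k j < p
    · have := hmax j (by simp [hj])
      by_cases hjb : k j = k b
      · simp [hjb, hb']
      · rw [if_neg (by omega), if_neg (by omega), if_neg hjb]; simp
    · rw [if_pos (by omega), if_pos (by omega), if_neg (by omega)]; simp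
  have s2 : (∑ j, if k j < k b then (m j : ℝ) * (k j : ℝ) else 0) = V - m b * k b := by
    rw [hV, ← sum_ite_index_eq h (fun j => (m j : ℝ) * (k j : ℝ)) b, ← Finset.sum_sub_distrib]
    refine Finset.sum_congr rfl fun j _ => ?_
    by_cases hj : k j < p
    · have := hmax j (by simp [hj])
      by_cases hjb : k j = k b
      · simp [hjb, hb']
      · rw [if_pos (by omega), if_pos (by omega), if_neg hjb]; simp
    · rw [if_neg (by omega), if_neg (by omega), if_neg (by omega)]; simp
  have hkb : (k b : ℝ) ≠ 0 := by exact_mod_cast (h.index_pos b).ne'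
  have hmb : (m b : ℝ) ≠ 0 := by exact_mod_cast h.mult_ne_zero b
  have : delta4 .gBO a m k (k b) = -12 * a 4 * (m b * k b) := by
    simp only [delta4]
    rw [s1, s2, sum_ite_index_eq h (fun j => (m j : ℝ) * (k j : ℝ)) b, hU0, hV0]
    field_simp
    ring
  rw [this]
  exact mul_ne_zero (mul_ne_zero (by norm_num) h4) (mul_ne_zero hmb hkb)

/-- For bounded p, the indices k_j > p enter δ_p only through m_j. Hence δ_p ranges over a finite
set although k is unbounded. -/
theorem exists_int_delta4_gBO (a : ℕ → ℝ) {p : ℕ} {R : ℕ} (hR : l1 m ≤ R) (hp : p ≤ 2 * R + 2) :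
    ∃ A B D : ℤ, |A| ≤ R * (2 * R + 2) ∧ |B| ≤ R ∧ |D| ≤ R * (2 * R + 2) ∧
      delta4 .gBO a m k p = -12 * a 4 * A - 18 * a 3 ^ 2 / Real.pi * (B + 1 / (p : ℝ) * D) := by
  have hl : ∑ j, |m j| ≤ R := by
    have : ((l1 m : ℕ) : ℤ) = ∑ j, |m j| := by simp [l1]
    rw [← this]; exact_mod_cast hR
  have key : ∀ (P : Fin (n + 2) → Prop) [DecidablePred P] (w : Fin (n + 2) → ℤ) (M : ℤ), 0 ≤ M →
      (∀ j, P j → |w j| ≤ M) → |∑ j, if P j then m j * w j else 0| ≤ R * M := by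
    intro P _ w M hM hw
    calc |∑ j, if P j then m j * w j else 0| ≤ ∑ j, |if P j then m j * w j else 0| :=
          Finset.abs_sum_le_sum_abs _ _
      _ ≤ ∑ j, |m j| * M := by
          refine Finset.sum_le_sum fun j _ => ?_
          split_ifs with hj
          · rw [abs_mul]; exact mul_le_mul_of_nonneg_left (hw j hj) (abs_nonneg _)
          · simpa using mul_nonneg (abs_nonneg _) hM
      _ = (∑ j, |m j|) * M := by rw [Finset.sum_mul]
      _ ≤ R * M := mul_le_mul_of_nonneg_right hl hM
  refine ⟨∑ j, if k j = p then m j * k j else 0, ∑ j, if p ≤ k j then m j * 1 else 0,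
    ∑ j, if k j < p then m j * k j else 0, ?_, ?_, ?_, ?_⟩
  · refine key _ _ _ (by positivity) fun j hj => ?_
    rw [abs_of_nonneg (by positivity)]; omega
  · simpa using key (fun j => p ≤ k j) (fun _ => 1) 1 zero_le_one fun j _ => by simp
  · refine key _ _ _ (by positivity) fun j hj => ?_
    rw [abs_of_nonneg (by positivity)]; omega
  · simp only [delta4]
    push_cast
    simp only [mul_one]

end MultIndex

theorem kappa_mem (E : Equation) (a : ℕ → ℝ) {n : ℕ} {m : Fin (n + 2) → ℤ} {k : Fin (n + 2) → ℕ}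
    {p : ℕ} (h1 : 1 ≤ p) (hp : delta4 E a m k p ≠ 0) :
    1 ≤ kappa E a m k ∧ delta4 E a m k (kappa E a m k) ≠ 0 ∧ kappa E a m k ≤ p := by
  have hne : {p : ℕ | 1 ≤ p ∧ delta4 E a m k p ≠ 0}.Nonempty := ⟨p, h1, hp⟩
  have := Nat.sInf_mem hne
  exact ⟨this.1, this.2, Nat.sInf_le ⟨h1, hp⟩⟩

theorem delta4_of_lt_kappa (E : Equation) (a : ℕ → ℝ) {n : ℕ} {m : Fin (n + 2) → ℤ}
    {k : Fin (n + 2) → ℕ} {p : ℕ} (h1 : 1 ≤ p) (hp : p < kappa E a m k) :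
    delta4 E a m k p = 0 := by
  by_contra h
  exact Nat.notMem_of_lt_sInf hp ⟨h1, h⟩

theorem kappa_eq_last (E : Equation) (a : ℕ → ℝ) {n : ℕ} {m : Fin (n + 2) → ℤ}
    {k : Fin (n + 2) → ℕ} (h : IsMultIndex m k)
    (h0 : ∀ p, p < k (Fin.last _) → delta4 E a m k p = 0)
    (h1 : delta4 E a m k (k (Fin.last _)) ≠ 0) : kappa E a m k = k (Fin.last _) := by
  obtain ⟨h2, h3, h4⟩ := kappa_mem E a (h.index_pos _) h1
  refine le_antisymm h4 (not_lt.1 fun hlt => h3 (h0 _ hlt))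

/-- The constant depends on `R` but not on `k`. The dichotomy records what is needed when κ is
large: κ is the smallest index, and for gBO one of the two conditions that cancel the 1/ℓ terms of
the sextic coefficients holds. -/
theorem exists_kappa_bound (E : Equation) (a : ℕ → ℝ) (hE : NonDegenerate E a) (R : ℕ) :
    ∃ c : ℝ, 0 < c ∧ ∀ (n : ℕ) (m : Fin (n + 2) → ℤ) (k : Fin (n + 2) → ℕ), IsMultIndex m k →
      l1 m ≤ R → 1 ≤ kappa E a m k ∧ c ≤ |delta4 E a m k (kappa E a m k)| * k 0 ∧
        (kappa E a m k ≤ 2 * R + 2 ∨ (kappa E a m k = k (Fin.last _) ∧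
          (E = .gBO → a 3 = 0 ∨ ∑ j, m j = 0))) := by
  have hzero : ∀ {n : ℕ} {m : Fin (n + 2) → ℤ} {k : Fin (n + 2) → ℕ}, IsMultIndex m k →
      (1 : ℝ) ≤ k 0 := fun h => by exact_mod_cast h.index_pos 0
  have hlast : ∀ {n : ℕ} {m : Fin (n + 2) → ℤ} {k : Fin (n + 2) → ℕ}, IsMultIndex m k →
      (k (Fin.last _) : ℝ) ≤ k 0 := fun h => by exact_mod_cast h.last_le 0
  cases E with
  | gKdV =>
    have hE' : ∀ k : ℕ, 1 ≤ k → 4 * Real.pi ^ 2 * (k : ℝ) ^ 2 * a 4 + a 3 ^ 2 ≠ 0 := hE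
    obtain ⟨c, hc, H⟩ : ∃ c : ℝ, 0 < c ∧ ∀ k : ℕ, 1 ≤ k →
        c ≤ 3 / Real.pi ^ 2 * |4 * Real.pi ^ 2 * (k : ℝ) ^ 2 * a 4 + a 3 ^ 2| := by
      by_cases h4 : a 4 = 0
      · have h3 : a 3 ≠ 0 := fun h3 => hE' 1 le_rfl (by simp [h3, h4])
        refine ⟨3 / Real.pi ^ 2 * |a 3 ^ 2|, by have := Real.pi_pos; positivity, fun k _ => ?_⟩
        simp [h4]
      · refine exists_pos_le_of_eventually_one_le
          (fun k => 3 / Real.pi ^ 2 * |4 * Real.pi ^ 2 * (k : ℝ) ^ 2 * a 4 + a 3 ^ 2|)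
          (fun k hk => ?_) ?_
        · have := Real.pi_pos
          have := abs_pos.2 (hE' k hk)
          positivity
        · obtain ⟨K, hK⟩ := exists_nat_gt ((a 3 ^ 2 + Real.pi ^ 2) / (4 * Real.pi ^ 2 * |a 4|))
          refine ⟨K + 1, fun k hk => ?_⟩
          have hpi := Real.pi_pos
          have ha4 := abs_pos.2 h4
          have hk1 : (K : ℝ) ≤ k := by exact_mod_cast (by omega : K ≤ k)
          have hk2 : (1 : ℝ) ≤ k := by exact_mod_cast (by omega : 1 ≤ k)
          rw [div_lt_iff₀ (by positivity)] at hK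
          have e1 : a 3 ^ 2 + Real.pi ^ 2 ≤ (k : ℝ) ^ 2 * (4 * Real.pi ^ 2 * |a 4|) := by
            refine hK.le.trans (mul_le_mul_of_nonneg_right ?_ (by positivity))
            nlinarith
          have e2 : |4 * Real.pi ^ 2 * (k : ℝ) ^ 2 * a 4| - |a 3 ^ 2|
              ≤ |4 * Real.pi ^ 2 * (k : ℝ) ^ 2 * a 4 + a 3 ^ 2| := by
            have := abs_sub_abs_le_abs_sub (4 * Real.pi ^ 2 * (k : ℝ) ^ 2 * a 4) (-(a 3 ^ 2))
            rwa [abs_neg, sub_neg_eq_add] at this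
          rw [abs_mul, abs_of_nonneg (by positivity : 0 ≤ 4 * Real.pi ^ 2 * (k : ℝ) ^ 2),
            abs_of_nonneg (sq_nonneg (a 3))] at e2
          have e3 : Real.pi ^ 2 ≤ |4 * Real.pi ^ 2 * (k : ℝ) ^ 2 * a 4 + a 3 ^ 2| := by linarith
          calc (1 : ℝ) ≤ 3 / Real.pi ^ 2 * Real.pi ^ 2 := by
                rw [div_mul_cancel₀ _ (by positivity)]; norm_num
            _ ≤ _ := mul_le_mul_of_nonneg_left e3 (by positivity)
    refine ⟨c, hc, fun n m k h hR => ?_⟩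
    have hb : c ≤ |delta4 .gKdV a m k (k (Fin.last _))| * k (Fin.last _) := by
      have h1 := delta4_last_gKdV a h
      have h2 : |delta4 .gKdV a m k (k (Fin.last _))| * k (Fin.last _)
          = |delta4 .gKdV a m k (k (Fin.last _)) * k (Fin.last _)| := by
        rw [abs_mul, Nat.abs_cast]
      rw [h2, h1, abs_neg, abs_mul, abs_mul, abs_of_nonneg (show 0 ≤ 3 / Real.pi ^ 2 by positivity),
        mul_assoc]
      refine (H _ (h.index_pos (Fin.last _))).trans (le_mul_of_one_le_left (by positivity)
        (h.one_le_abs _))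
    have hne : delta4 .gKdV a m k (k (Fin.last _)) ≠ 0 := fun h0 => by
      rw [h0] at hb; simp at hb; linarith
    have hk := kappa_eq_last .gKdV a h (fun p hp => delta4_eq_zero_of_lt_gKdV a h hp) hne
    refine ⟨hk ▸ h.index_pos _, ?_, Or.inr ⟨hk, by simp⟩⟩
    rw [hk]
    exact hb.trans (mul_le_mul_of_nonneg_left (hlast h) (abs_nonneg _))
  | gBO =>
    have h4 : a 4 ≠ 0 := hE
    set T : Finset ℝ := ((Finset.range (2 * R + 3) ×ˢ Finset.Icc (-(R * (2 * R + 2) : ℤ))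
      (R * (2 * R + 2))) ×ˢ (Finset.Icc (-(R : ℤ)) R ×ˢ Finset.Icc (-(R * (2 * R + 2) : ℤ))
      (R * (2 * R + 2)))).image fun x => -12 * a 4 * (x.1.2 : ℝ)
        - 18 * a 3 ^ 2 / Real.pi * ((x.2.1 : ℝ) + 1 / (x.1.1 : ℝ) * (x.2.2 : ℝ)) with hT
    obtain ⟨c, hc, H⟩ := exists_pos_le_abs_of_finset T
    refine ⟨min c (12 * |a 4|), lt_min hc (by positivity), fun n m k h hR => ?_⟩
    by_cases hS : a 3 = 0 ∨ ∑ j, m j = 0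
    · have hd := delta4_of_le_last_gBO a h le_rfl hS
      rw [sum_ite_index_eq h (fun j => (m j : ℝ) * (k j : ℝ))] at hd
      have hk1 : (1 : ℝ) ≤ k (Fin.last _) := by exact_mod_cast h.index_pos _
      have hb : 12 * |a 4| ≤ |delta4 .gBO a m k (k (Fin.last _))| := by
        rw [hd, abs_mul, abs_mul, abs_mul, Nat.abs_cast, show |(-12 : ℝ)| = 12 by norm_num]
        exact le_mul_of_one_le_right (by positivity) (one_le_mul_of_one_le_of_one_le
          (h.one_le_abs _) hk1)
      have hne : delta4 .gBO a m k (k (Fin.last _)) ≠ 0 := fun h0 => by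
        rw [h0, abs_zero] at hb
        have := abs_pos.2 h4
        linarith
      have hk := kappa_eq_last .gBO a h (fun p hp => by
        rw [delta4_of_le_last_gBO a h hp.le hS]
        have : ∀ j, k j ≠ p := fun j => by have := h.last_le j; omega
        simp [this]) hne
      refine ⟨hk ▸ h.index_pos _, ?_, Or.inr ⟨hk, fun _ => hS⟩⟩
      rw [hk]
      exact ((min_le_right _ _).trans hb).trans (le_mul_of_one_le_right (abs_nonneg _) (hzero h))
    · push Not at hS
      obtain ⟨p, hp1, hp2, hp3⟩ := exists_delta4_ne_zero_gBO a hS.1 h4 h hS.2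
      obtain ⟨hk1, hk2, hk3⟩ := kappa_mem .gBO a hp1 hp3
      have hk4 : kappa .gBO a m k ≤ 2 * R + 2 := by omega
      refine ⟨hk1, ?_, Or.inl hk4⟩
      obtain ⟨A, B, D, hA, hB, hD, hd⟩ := exists_int_delta4_gBO (k := k) a hR hk4
      rw [abs_le] at hA hB hD
      have hmem : delta4 .gBO a m k (kappa .gBO a m k) ∈ T := by
        rw [hT, Finset.mem_image]
        refine ⟨((kappa .gBO a m k, A), (B, D)), ?_, hd.symm⟩
        simp only [Finset.mem_product, Finset.mem_range, Finset.mem_Icc]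
        exact ⟨⟨by omega, hA⟩, hB, hD⟩
      exact ((min_le_left _ _).trans (H _ hmem hk2)).trans
        (le_mul_of_one_le_right (abs_nonneg _) (hzero h))

/-! ### Lower bounds on the quadratic coefficients of the small divisors -/

open Polynomial in
/-- A polynomial which is not small at some point is not small at some small positive integer. -/
theorem exists_nat_le_abs_eval (F : ℝ[X]) (d : ℕ) (hF : F.natDegree ≤ d) (y Y : ℝ)
    (hy : |y| ≤ Y) (hY : (d : ℝ) + 1 ≤ Y) :
    ∃ p : ℕ, 1 ≤ p ∧ p ≤ d + 1 ∧ |F.eval y| ≤ (d + 1) * (2 * Y) ^ d * |F.eval (p : ℝ)| := by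
  have hY0 : 0 ≤ Y := by have : (0 : ℝ) ≤ d := Nat.cast_nonneg d; linarith
  by_contra hcon
  push Not at hcon
  -- The nodes are 1, …, d + 1. Distinct nodes are at distance at least 1 and |y - v l| ≤ 2Y, so
  -- each Lagrange basis polynomial is at most (2Y)^d at y.
  set v : ℕ → ℝ := fun i => ((i + 1 : ℕ) : ℝ) with hv
  have hinj : Set.InjOn v (Finset.range (d + 1)) := fun i _ j _ h => by
    simpa [hv] using h
  have hdeg : F.degree < (Finset.range (d + 1)).card := by
    rw [Finset.card_range]
    exact (degree_le_of_natDegree_le hF).trans_lt (by exact_mod_cast Nat.lt_succ_self d)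
  have hint := Lagrange.eq_interpolate hinj hdeg
  have hev : F.eval y = ∑ i ∈ Finset.range (d + 1), F.eval (v i)
      * ∏ l ∈ (Finset.range (d + 1)).erase i, (v i - v l)⁻¹ * (y - v l) := by
    conv_lhs => rw [hint]
    simp only [Lagrange.interpolate_apply, eval_finsetSum, eval_mul, eval_C, Lagrange.basis,
      eval_prod, Lagrange.basisDivisor, eval_sub, eval_X]
  have hbasis : ∀ i ∈ Finset.range (d + 1),
      |∏ l ∈ (Finset.range (d + 1)).erase i, (v i - v l)⁻¹ * (y - v l)| ≤ (2 * Y) ^ d := by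
    intro i hi
    rw [Finset.abs_prod]
    have hcard : ((Finset.range (d + 1)).erase i).card = d := by
      rw [Finset.card_erase_of_mem hi, Finset.card_range]; rfl
    calc ∏ l ∈ (Finset.range (d + 1)).erase i, |(v i - v l)⁻¹ * (y - v l)|
        ≤ ∏ _l ∈ (Finset.range (d + 1)).erase i, (2 * Y) := by
          refine Finset.prod_le_prod (fun _ _ => abs_nonneg _) fun l hl => ?_
          have hl' := Finset.mem_erase.1 hl
          have h1 : (1 : ℝ) ≤ |v i - v l| := by
            have : (1 : ℤ) ≤ |((i : ℤ) - l)| := Int.one_le_abs (by have := hl'.1; omega)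
            have h2 : (1 : ℝ) ≤ |((i : ℝ) - l)| := by exact_mod_cast this
            simpa [hv] using h2
          have h2 : |y - v l| ≤ 2 * Y := by
            have h3 : |v l| ≤ Y := by
              rw [hv, Nat.abs_cast]
              have : ((l + 1 : ℕ) : ℝ) ≤ (d : ℝ) + 1 := by
                exact_mod_cast Finset.mem_range.1 hl'.2
              linarith
            linarith [abs_sub y (v l)]
          rw [abs_mul, abs_inv]
          calc |v i - v l|⁻¹ * |y - v l| ≤ 1 * (2 * Y) :=
                mul_le_mul (inv_le_one_of_one_le₀ h1) h2 (abs_nonneg _) zero_le_one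
            _ = 2 * Y := one_mul _
      _ = (2 * Y) ^ d := by rw [Finset.prod_const, hcard]
  have hpow : 0 < (2 * Y) ^ d := by
    have : (0 : ℝ) ≤ d := Nat.cast_nonneg d
    have : 0 < Y := by linarith
    positivity
  have hd1 : (0 : ℝ) < d + 1 := by positivity
  have hsmall : ∀ i ∈ Finset.range (d + 1), |F.eval (v i)| * (2 * Y) ^ d < |F.eval y| / (d + 1) := by
    intro i hi
    have := hcon (i + 1) (by omega) (by have := Finset.mem_range.1 hi; omega)
    rw [lt_div_iff₀ hd1]
    calc _ = (d + 1) * (2 * Y) ^ d * |F.eval (v i)| := by ring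
      _ < _ := this
  have : |F.eval y| < |F.eval y| := by
    calc |F.eval y| ≤ ∑ i ∈ Finset.range (d + 1), |F.eval (v i)| * (2 * Y) ^ d := by
          conv_lhs => rw [hev]
          refine (Finset.abs_sum_le_sum_abs _ _).trans (Finset.sum_le_sum fun i hi => ?_)
          rw [abs_mul]
          exact mul_le_mul_of_nonneg_left (hbasis i hi) (abs_nonneg _)
      _ < ∑ _i ∈ Finset.range (d + 1), |F.eval y| / (d + 1) :=
          Finset.sum_lt_sum_of_nonempty (by simp) hsmall
      _ = |F.eval y| := by
          rw [Finset.sum_const, Finset.card_range, nsmul_eq_mul]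
          push_cast
          field_simp
  exact lt_irrefl _ this

open Polynomial in
/-- A sum of rational functions with an isolated pole is not small at some small positive
integer. -/
theorem exists_nat_le_abs_sum_div {n : ℕ} (w : Fin (n + 1) → ℝ) (U D : Fin (n + 1) → ℝ[X])
    (hU : ∀ j, (U j).natDegree ≤ 4) (hD : ∀ j, (D j).natDegree ≤ 4) (u y Y : ℝ)
    (hy : |y| ≤ Y) (hY : ((4 * (n + 1) : ℕ) : ℝ) + 1 ≤ Y) (hw : 1 ≤ |w 0|) (hu : u ≤ |(U 0).eval y|)
    (h0 : (D 0).eval y = 0) (h1 : ∀ j, j ≠ 0 → 1 ≤ |(D j).eval y|)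
    (hp : ∀ (p : ℕ) (j : Fin (n + 1)), 1 ≤ p → p ≤ 4 * (n + 1) + 1 →
      (D j).eval (p : ℝ) ≠ 0 ∧ |(D j).eval (p : ℝ)| ≤ Y ^ 4) :
    ∃ p : ℕ, 1 ≤ p ∧ p ≤ 4 * (n + 1) + 1 ∧
      u ≤ ((4 * (n + 1) : ℕ) + 1) * (2 * Y) ^ (4 * (n + 1)) * (Y ^ (4 * (n + 1)) *
        |∑ j, w j * ((U j).eval (p : ℝ) / (D j).eval (p : ℝ))|) := by
  -- The numerator over the common denominator. At the pole `y` every summand with j ≠ 0 contains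
  -- the factor D 0 and vanishes.
  set F : ℝ[X] := ∑ j, C (w j) * (U j * ∏ i ∈ Finset.univ.erase j, D i) with hF
  have hdeg : F.natDegree ≤ 4 * (n + 1) := by
    refine natDegree_sum_le_of_forall_le _ _ fun j _ => ?_
    refine (natDegree_C_mul_le _ _).trans ?_
    refine natDegree_mul_le.trans ?_
    have h2 : (∏ i ∈ Finset.univ.erase j, D i).natDegree ≤ 4 * n := by
      refine (natDegree_prod_le _ _).trans ?_
      refine (Finset.sum_le_card_nsmul _ _ 4 fun i _ => hD i).trans ?_
      rw [Finset.card_erase_of_mem (Finset.mem_univ j), Finset.card_univ, Fintype.card_fin]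
      simp [mul_comm]
    have := hU j
    omega
  obtain ⟨p, hp1, hp2, hp3⟩ := exists_nat_le_abs_eval F _ hdeg y Y hy hY
  refine ⟨p, hp1, hp2, ?_⟩
  have hFy : u ≤ |F.eval y| := by
    have : F.eval y = w 0 * ((U 0).eval y * ∏ i ∈ Finset.univ.erase 0, (D i).eval y) := by
      rw [hF, eval_finsetSum, Finset.sum_eq_single 0]
      · simp [eval_prod]
      · intro j _ hj
        have : (∏ i ∈ Finset.univ.erase j, D i).eval y = 0 := by
          rw [eval_prod]
          exact Finset.prod_eq_zero (Finset.mem_erase.2 ⟨hj.symm, Finset.mem_univ _⟩) h0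
        simp [this]
      · simp
    have hprod : 1 ≤ |∏ i ∈ Finset.univ.erase 0, (D i).eval y| := by
      rw [Finset.abs_prod]
      have := Finset.prod_le_prod (s := Finset.univ.erase (0 : Fin (n + 1))) (f := fun _ => (1 : ℝ))
        (g := fun i => |(D i).eval y|) (fun _ _ => zero_le_one)
        fun i hi => h1 i (Finset.ne_of_mem_erase hi)
      simpa using this
    rw [this, abs_mul, abs_mul]
    calc u ≤ |(U 0).eval y| := hu
      _ ≤ |(U 0).eval y| * |∏ i ∈ Finset.univ.erase 0, (D i).eval y| :=
        le_mul_of_one_le_right (abs_nonneg _) hprod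
      _ ≤ _ := le_mul_of_one_le_left (by positivity) hw
  have hFp : F.eval (p : ℝ) = (∏ i, (D i).eval (p : ℝ)) *
      ∑ j, w j * ((U j).eval (p : ℝ) / (D j).eval (p : ℝ)) := by
    rw [hF, eval_finsetSum, Finset.mul_sum]
    refine Finset.sum_congr rfl fun j _ => ?_
    rw [← Finset.mul_prod_erase Finset.univ (fun i => (D i).eval (p : ℝ)) (Finset.mem_univ j)]
    have := (hp p j hp1 hp2).1
    simp only [eval_mul, eval_C, eval_prod]
    field_simp
  have hY0 : 0 ≤ Y := (abs_nonneg y).trans hy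
  refine hFy.trans (hp3.trans (mul_le_mul_of_nonneg_left ?_ (by positivity)))
  rw [hFp, abs_mul]
  refine mul_le_mul_of_nonneg_right ?_ (abs_nonneg _)
  rw [Finset.abs_prod, pow_mul]
  refine (Finset.prod_le_prod (fun _ _ => abs_nonneg _) fun i _ => (hp p i hp1 hp2).2).trans ?_
  simp

theorem exists_pos_le_abs_of_nat (f : ℕ → ℝ) (P : ℕ) (hf : ∀ p, 1 ≤ p → f p ≠ 0) :
    ∃ c : ℝ, 0 < c ∧ ∀ p, 1 ≤ p → p ≤ P → c ≤ |f p| := by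
  obtain ⟨c, hc, H⟩ := exists_pos_le_abs_of_finset ((Finset.Icc 1 P).image f)
  exact ⟨c, hc, fun p h1 h2 => H _ (Finset.mem_image.2 ⟨p, Finset.mem_Icc.2 ⟨h1, h2⟩, rfl⟩)
    (hf p h1)⟩

/-- The coefficient of `I_p ^ 2` in the small divisors. -/
noncomputable def quadCoeff (E : Equation) (a : ℕ → ℝ) {n : ℕ} (m : Fin (n + 2) → ℤ)
    (k : Fin (n + 2) → ℕ) (p : ℕ) : ℝ :=
  ∑ j, (m j : ℝ) * (k j : ℝ) * sexticCoeff E a p p (k j)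

section

variable {n : ℕ} {m : Fin (n + 2) → ℤ} {k : Fin (n + 2) → ℕ}

theorem IsMultIndex.momentum_real (h : IsMultIndex m k) : ∑ j, (m j : ℝ) * (k j : ℝ) = 0 := by
  exact_mod_cast h.momentum

theorem quadCoeff_gKdV (a : ℕ → ℝ) (h : IsMultIndex m k) {p : ℕ} (hp : 0 < p)
    (hpk : 8 * p < k (Fin.last _)) :
    quadCoeff .gKdV a m k p = -(24 * dispersionConst .gKdV * p ^ 2
      * (2 * a 4 + dispersionConst .gKdV * a 3 ^ 2 / p ^ 2) ^ 2) *
        ∑ j, (m j : ℝ) * (k j : ℝ) * (1 / (((k j : ℝ) ^ 2 - p ^ 2) ^ 2)) := by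
  have h0 := h.momentum_real
  rw [quadCoeff, Finset.mul_sum]
  have : ∀ j, (m j : ℝ) * (k j : ℝ) * sexticCoeff .gKdV a p p (k j)
      = (180 * a 6 - 120 * a 3 * a 5 * dispersionConst .gKdV / p ^ 2) * ((m j : ℝ) * (k j : ℝ))
        + -(24 * dispersionConst .gKdV * p ^ 2
      * (2 * a 4 + dispersionConst .gKdV * a 3 ^ 2 / p ^ 2) ^ 2) *
          ((m j : ℝ) * (k j : ℝ) * (1 / (((k j : ℝ) ^ 2 - p ^ 2) ^ 2))) := fun j => by
    rw [sexticCoeff_gKdV a hp (hpk.trans_le (h.last_le j))]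
    ring
  simp only [this]
  rw [Finset.sum_add_distrib, ← Finset.mul_sum, h0, mul_zero, zero_add]

/-- Either alternative of `hS` removes the 1/ℓ terms, and zero momentum removes the constant ones.
The two remaining fractions are put over one denominator, polynomial in p, in preparation for the
pole argument. -/
theorem quadCoeff_gBO (a : ℕ → ℝ) (h : IsMultIndex m k) {p : ℕ} (hp : 0 < p)
    (hpk : 8 * p < k (Fin.last _)) (hS : a 3 = 0 ∨ ∑ j, m j = 0) :
    quadCoeff .gBO a m k p = -∑ j, (m j : ℝ) * (k j : ℝ) *
      ((108 * a 3 ^ 2 * a 4 * dispersionConst .gBO ^ 2 / (k j : ℝ) ^ 2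
          * (p * (2 * k j + p) * (2 * k j - 3 * p))
        + 288 * dispersionConst .gBO * a 4 ^ 2 * (k j - p) ^ 2)
        / ((2 * k j + p) * (2 * k j - 3 * p) * (k j - p))) := by
  have h0 := h.momentum_real
  rw [quadCoeff, ← Finset.sum_neg_distrib]
  have : ∀ j, (m j : ℝ) * (k j : ℝ) * sexticCoeff .gBO a p p (k j)
      = (180 * a 6 - 360 * a 3 * a 5 * dispersionConst .gBO / p) * ((m j : ℝ) * (k j : ℝ))
        + (-360 * a 3 * a 5 * dispersionConst .gBO
          + 648 * a 3 ^ 2 * a 4 * dispersionConst .gBO ^ 2 / p) * (m j : ℝ)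
        + -((m j : ℝ) * (k j : ℝ) *
      ((108 * a 3 ^ 2 * a 4 * dispersionConst .gBO ^ 2 / (k j : ℝ) ^ 2
          * (p * (2 * k j + p) * (2 * k j - 3 * p))
        + 288 * dispersionConst .gBO * a 4 ^ 2 * (k j - p) ^ 2)
        / ((2 * k j + p) * (2 * k j - 3 * p) * (k j - p)))) := fun j => by
    have hlt := hpk.trans_le (h.last_le j)
    rw [sexticCoeff_gBO a hp hlt]
    have hlt' : 8 * (p : ℝ) < k j := by exact_mod_cast hlt
    have hp' : (0 : ℝ) < p := by exact_mod_cast hp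
    generalize (k j : ℝ) = y at *
    generalize (p : ℝ) = x at *
    have e1 : y - x ≠ 0 := by linarith
    have e2 : y ≠ 0 := by linarith
    have e3 : y * 2 - x * 3 ≠ 0 := by linarith
    have e4 : y * 2 + x ≠ 0 := by linarith
    field_simp
    ring
  simp only [this]
  rw [Finset.sum_add_distrib, Finset.sum_add_distrib, ← Finset.mul_sum, ← Finset.mul_sum, h0,
    mul_zero, zero_add]
  rcases hS with hS | hS
  · simp [hS]
  · have : (∑ j, (m j : ℝ)) = 0 := by exact_mod_cast hS
    rw [this, mul_zero, zero_add]

end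

-- The isolated pole is p = -k_1 for gKdV and p = -2k_1 for gBO; it belongs to the largest index
-- only because the k_j are distinct. The condition on `k (Fin.last _)` guarantees `8 * p < k j` at
-- every integer p tested, so that the closed formulas apply.
open Polynomial in
theorem exists_quadCoeff_bound (E : Equation) (a : ℕ → ℝ) (hE : NonDegenerate E a) (R : ℕ) :
    ∃ c : ℝ, 0 < c ∧ ∀ (n : ℕ) (m : Fin (n + 2) → ℤ) (k : Fin (n + 2) → ℕ), IsMultIndex m k →
      l1 m ≤ R → 8 * (4 * R + 1) < k (Fin.last _) → (E = .gBO → a 3 = 0 ∨ ∑ j, m j = 0) →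
      ∃ p : ℕ, 1 ≤ p ∧ p ≤ 4 * R + 1 ∧ c ≤ |quadCoeff E a m k p| * (k 0 : ℝ) ^ (8 * l1 m) := by
  -- the common part of the two cases
  have main : ∀ (u : ℝ), 0 < u → ∃ c : ℝ, 0 < c ∧ ∀ (n : ℕ) (m : Fin (n + 2) → ℤ)
      (k : Fin (n + 2) → ℕ), IsMultIndex m k → l1 m ≤ R → 8 * (4 * R + 1) < k (Fin.last _) →
      ∀ (U D : Fin (n + 2) → ℝ[X]) (y : ℝ), (∀ j, (U j).natDegree ≤ 4) →
      (∀ j, (D j).natDegree ≤ 4) → |y| ≤ 2 * k 0 → u ≤ |(U 0).eval y| → (D 0).eval y = 0 →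
      (∀ j, j ≠ 0 → 1 ≤ |(D j).eval y|) → (∀ (p : ℕ) (j : Fin (n + 2)), 1 ≤ p → 8 * p < k j →
        (D j).eval (p : ℝ) ≠ 0 ∧ |(D j).eval (p : ℝ)| ≤ (2 * k 0) ^ 4) →
      ∃ p : ℕ, 1 ≤ p ∧ p ≤ 4 * R + 1 ∧ c ≤ |∑ j, (m j : ℝ) * (k j : ℝ)
        * ((U j).eval (p : ℝ) / (D j).eval (p : ℝ))| * (k 0 : ℝ) ^ (8 * l1 m) := by
    intro u hu
    -- The interpolation loss is (d + 1)(2Y)^d Y^d with Y = 2k_1 and d = 4(n + 2) ≤ 4R, whence 8^d =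
    -- 4^d · 2^d and the power 2d ≤ 8|m|₁ of k_1.
    refine ⟨u / ((4 * R + 1) * 8 ^ (4 * R)), by positivity, ?_⟩
    intro n m k h hR hk U D y hU hD hy huy h0 h1 hp
    have hn := h.le_l1
    have hk0 : (1 : ℝ) ≤ k 0 := by exact_mod_cast h.index_pos 0
    have hkR : 8 * (4 * R + 1) < k 0 := hk.trans_le (h.last_le 0)
    obtain ⟨p, hp1, hp2, hp3⟩ := exists_nat_le_abs_sum_div (fun j => (m j : ℝ) * (k j : ℝ)) U D hU
      hD u y (2 * k 0) hy (by exact_mod_cast (by omega)) (by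
        rw [abs_mul, Nat.abs_cast]
        exact one_le_mul_of_one_le_of_one_le (h.one_le_abs _) hk0) huy h0 h1
      (fun p j h1 h2 => hp p j h1 (by have := h.last_le j; omega))
    refine ⟨p, hp1, by omega, ?_⟩
    rw [div_le_iff₀ (by positivity)]
    refine hp3.trans ?_
    set A := |∑ j, (m j : ℝ) * (k j : ℝ) * ((U j).eval (p : ℝ) / (D j).eval (p : ℝ))| with hA
    have hA0 : 0 ≤ A := abs_nonneg _
    calc (((4 * (n + 1 + 1) : ℕ) : ℝ) + 1) * (2 * (2 * (k 0 : ℝ))) ^ (4 * (n + 1 + 1))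
          * ((2 * (k 0 : ℝ)) ^ (4 * (n + 1 + 1)) * A)
        = (((4 * (n + 1 + 1) : ℕ) : ℝ) + 1) * (8 ^ (4 * (n + 1 + 1))
          * (k 0 : ℝ) ^ (8 * (n + 1 + 1))) * A := by
          have e8 : (8 : ℝ) ^ (4 * (n + 1 + 1)) = 4 ^ (4 * (n + 1 + 1)) * 2 ^ (4 * (n + 1 + 1)) := by
            rw [← mul_pow]; norm_num
          have ek : (k 0 : ℝ) ^ (8 * (n + 1 + 1))
              = (k 0 : ℝ) ^ (4 * (n + 1 + 1)) * (k 0 : ℝ) ^ (4 * (n + 1 + 1)) := by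
            rw [← pow_add]; congr 1; ring
          rw [e8, ek, mul_pow, mul_pow,
            show (4 : ℝ) ^ (4 * (n + 1 + 1)) = 2 ^ (4 * (n + 1 + 1)) * 2 ^ (4 * (n + 1 + 1)) by
              rw [← mul_pow]; norm_num]
          ring
      _ ≤ ((4 * R : ℝ) + 1) * (8 ^ (4 * R) * (k 0 : ℝ) ^ (8 * l1 m)) * A := by
          refine mul_le_mul_of_nonneg_right ?_ hA0
          refine mul_le_mul ?_ (mul_le_mul ?_ ?_ (by positivity) (by positivity)) (by positivity)
            (by positivity)
          · exact_mod_cast (by omega : 4 * (n + 1 + 1) + 1 ≤ 4 * R + 1)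
          · exact pow_le_pow_right₀ (by norm_num) (by omega)
          · exact pow_le_pow_right₀ hk0 (by omega)
      _ = _ := by ring
  cases E with
  | gKdV =>
    have hE' : ∀ k : ℕ, 1 ≤ k → 4 * Real.pi ^ 2 * (k : ℝ) ^ 2 * a 4 + a 3 ^ 2 ≠ 0 := hE
    obtain ⟨c, hc, H⟩ := main 1 one_pos
    obtain ⟨c', hc', H'⟩ := exists_pos_le_abs_of_nat (fun p => -(24 * dispersionConst .gKdV * p ^ 2
      * (2 * a 4 + dispersionConst .gKdV * a 3 ^ 2 / p ^ 2) ^ 2)) (4 * R + 1) (fun p hp => by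
        have hp' : (p : ℝ) ≠ 0 := by exact_mod_cast (by omega : p ≠ 0)
        have h1 := dispersionConst_pos .gKdV
        have h2 : 2 * a 4 + dispersionConst .gKdV * a 3 ^ 2 / p ^ 2
            = (4 * Real.pi ^ 2 * (p : ℝ) ^ 2 * a 4 + a 3 ^ 2) / (2 * Real.pi ^ 2 * p ^ 2) := by
          have := Real.pi_ne_zero
          simp only [dispersionConst, Equation.alpha]
          field_simp
          ring
        have h3 : 2 * a 4 + dispersionConst .gKdV * a 3 ^ 2 / p ^ 2 ≠ 0 := by
          rw [h2]
          have := Real.pi_ne_zero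
          exact div_ne_zero (hE' p hp) (by positivity)
        exact neg_ne_zero.2 (by positivity))
    refine ⟨c' * c, by positivity, fun n m k h hR hk _ => ?_⟩
    obtain ⟨p, hp1, hp2, hp3⟩ := H n m k h hR hk (fun _ => 1)
      (fun j => (C ((k j : ℝ) ^ 2) - X ^ 2) ^ 2) (-(k 0 : ℝ)) (fun _ => by simp)
      (fun j => by compute_degree) (by rw [abs_neg, Nat.abs_cast]; linarith [(k 0).cast_nonneg (α := ℝ)])
      (by simp) (by simp) (fun j hj => by
        have hlt : k j < k 0 := h.index_anti (Fin.pos_iff_ne_zero.2 hj)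
        have h1 : (1 : ℤ) ≤ ((k j : ℤ) ^ 2 - (k 0 : ℤ) ^ 2) ^ 2 := by
          have : (k j : ℤ) ^ 2 - (k 0 : ℤ) ^ 2 < 0 := by
            have : (k j : ℤ) < k 0 := by exact_mod_cast hlt
            nlinarith [Int.natCast_nonneg (k j)]
          nlinarith
        have h2 : (1 : ℝ) ≤ ((k j : ℝ) ^ 2 - (k 0 : ℝ) ^ 2) ^ 2 := by exact_mod_cast h1
        simp only [eval_pow, eval_sub, eval_C, eval_X, neg_sq]
        rwa [abs_of_nonneg (by positivity)])
      (fun p j hp1 hp => by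
        have hp' : 8 * (p : ℝ) < k j := by exact_mod_cast hp
        have hp0 : (0 : ℝ) < p := by exact_mod_cast hp1
        have hk0 : (k j : ℝ) ≤ k 0 := by exact_mod_cast h.le_zero j
        have h1 : 0 < (k j : ℝ) ^ 2 - p ^ 2 := by nlinarith
        simp only [eval_pow, eval_sub, eval_C, eval_X]
        refine ⟨by positivity, ?_⟩
        rw [abs_of_nonneg (by positivity), show ((2 * (k 0 : ℝ)) ^ 4) = ((2 * (k 0 : ℝ)) ^ 2) ^ 2 by
          ring]
        exact pow_le_pow_left₀ h1.le (by nlinarith) 2)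
    refine ⟨p, hp1, hp2, ?_⟩
    rw [quadCoeff_gKdV a h hp1 (by omega), abs_mul, mul_assoc]
    refine mul_le_mul (H' p hp1 hp2) ?_ hc.le (abs_nonneg _)
    simpa using hp3
  | gBO =>
    have h4 : a 4 ≠ 0 := hE
    have hτ := dispersionConst_pos .gBO
    obtain ⟨c, hc, H⟩ := main (288 * dispersionConst .gBO * a 4 ^ 2) (by positivity)
    refine ⟨c, hc, fun n m k h hR hk hS => ?_⟩
    obtain ⟨p, hp1, hp2, hp3⟩ := H n m k h hR hk
      (fun j => C (108 * a 3 ^ 2 * a 4 * dispersionConst .gBO ^ 2 / (k j : ℝ) ^ 2)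
          * (X * (C (2 * (k j : ℝ)) + X) * (C (2 * (k j : ℝ)) - C 3 * X))
        + C (288 * dispersionConst .gBO * a 4 ^ 2) * (C (k j : ℝ) - X) ^ 2)
      (fun j => (C (2 * (k j : ℝ)) + X) * (C (2 * (k j : ℝ)) - C 3 * X) * (C (k j : ℝ) - X))
      (-(2 * (k 0 : ℝ))) (fun j => by compute_degree!) (fun j => by compute_degree!)
      (by rw [abs_neg, abs_of_nonneg (by positivity)]) (by
        have hk1 : (1 : ℝ) ≤ k 0 := by exact_mod_cast h.index_pos 0
        simp only [eval_add, eval_mul, eval_pow, eval_sub, eval_C, eval_X]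
        rw [show 2 * (k 0 : ℝ) + -(2 * (k 0 : ℝ)) = 0 by ring, mul_zero, zero_mul, mul_zero,
          zero_add, abs_of_nonneg (by positivity)]
        refine le_mul_of_one_le_right (by positivity) ?_
        nlinarith) (by simp) (fun j hj => by
        have hlt : k j < k 0 := h.index_anti (Fin.pos_iff_ne_zero.2 hj)
        have hk1 : (1 : ℝ) ≤ k j := by exact_mod_cast h.index_pos j
        have h1 : (1 : ℝ) ≤ k 0 - k j := by
          have : (k j : ℝ) + 1 ≤ k 0 := by exact_mod_cast hlt
          linarith
        simp only [eval_mul, eval_add, eval_sub, eval_C, eval_X]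
        rw [abs_mul, abs_mul]
        refine one_le_mul_of_one_le_of_one_le (one_le_mul_of_one_le_of_one_le ?_ ?_) ?_
        · rw [abs_of_nonpos (by linarith)]; linarith
        · rw [abs_of_nonneg (by linarith)]; linarith
        · rw [abs_of_nonneg (by linarith)]; linarith)
      (fun p j hp1 hp => by
        have hp' : 8 * (p : ℝ) < k j := by exact_mod_cast hp
        have hp0 : (0 : ℝ) < p := by exact_mod_cast hp1
        have hk0 : (k j : ℝ) ≤ k 0 := by exact_mod_cast h.le_zero j
        have hk1 : (1 : ℝ) ≤ k 0 := by exact_mod_cast h.index_pos 0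
        have e1 : 0 < 2 * (k j : ℝ) + p := by linarith
        have e2 : 0 < 2 * (k j : ℝ) - 3 * p := by linarith
        have e3 : 0 < (k j : ℝ) - p := by linarith
        simp only [eval_mul, eval_add, eval_sub, eval_C, eval_X]
        refine ⟨by positivity, ?_⟩
        rw [abs_of_nonneg (by positivity)]
        calc (2 * (k j : ℝ) + p) * (2 * (k j : ℝ) - 3 * p) * ((k j : ℝ) - p)
            ≤ (4 * k 0) * (2 * k 0) * (2 * k 0 * k 0) := by
              refine mul_le_mul (mul_le_mul (by linarith) (by linarith) e2.le (by positivity)) ?_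
                e3.le (by positivity)
              nlinarith
          _ = (2 * (k 0 : ℝ)) ^ 4 := by ring)
    refine ⟨p, hp1, hp2, ?_⟩
    rw [quadCoeff_gBO a h hp1 (by omega) (hS rfl), abs_neg]
    simpa using hp3

/-! ### The small divisors as functions of a single action -/

section

variable {n : ℕ} {m : Fin (n + 2) → ℤ} {k : Fin (n + 2) → ℕ}

/-- For gBO the non-local part beyond k_1 is a multiple of ∑ m_j k_j, hence zero; so Δ⁽⁴⁾ is a
finite sum. -/
theorem delta4_eq_zero_of_lt (E : Equation) (a : ℕ → ℝ) (h : IsMultIndex m k) {p : ℕ}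
    (hp : k 0 < p) : delta4 E a m k p = 0 := by
  have h1 : ∀ j, k j < p := fun j => (h.le_zero j).trans_lt hp
  have h2 : ∀ j, k j ≠ p := fun j => (h1 j).ne
  have h3 : ∀ j, ¬ p ≤ k j := fun j => not_le.2 (h1 j)
  cases E with
  | gKdV => simp [delta4, h2]
  | gBO => simp [delta4, h1, h2, h3, h.momentum_real]

theorem Delta4_eq_sum (E : Equation) (a : ℕ → ℝ) (h : IsMultIndex m k) {N : ℕ} (hN : k 0 ≤ N)
    (I : ℕ → ℝ) : Delta4 E a m k I = ∑ p ∈ Finset.Icc 1 N, delta4 E a m k p * I p := by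
  have h1 : Delta4 E a m k I = ∑' p : ℕ, delta4 E a m k (p + 1) * I (p + 1) :=
    (tsum_pnat_eq_tsum_succ (f := fun p : ℕ => delta4 E a m k p * I p))
  rw [h1, tsum_eq_sum (s := Finset.range N)]
  · rw [Finset.range_eq_Ico, Finset.sum_Ico_add' (fun p => delta4 E a m k p * I p) 0 N 1]
    rfl
  · intro p hp
    rw [delta4_eq_zero_of_lt E a h (by simp at hp; omega), zero_mul]

theorem Delta4_update (E : Equation) (a : ℕ → ℝ) (h : IsMultIndex m k) {q : ℕ} (hq : 1 ≤ q)
    (I : ℕ → ℝ) (x y : ℝ) :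
    Delta4 E a m k (Function.update I q x)
      = Delta4 E a m k (Function.update I q y) + delta4 E a m k q * (x - y) := by
  have hqm : q ∈ Finset.Icc 1 (max (k 0) q) := Finset.mem_Icc.2 ⟨hq, le_max_right _ _⟩
  rw [Delta4_eq_sum E a h (le_max_left (k 0) q), Delta4_eq_sum E a h (le_max_left (k 0) q),
    ← Finset.add_sum_erase _ _ hqm, ← Finset.add_sum_erase _ _ hqm,
    Finset.sum_congr rfl (g := fun p => delta4 E a m k p * Function.update I q y p) fun p hp => by
      rw [Function.update_of_ne (Finset.ne_of_mem_erase hp),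
        Function.update_of_ne (Finset.ne_of_mem_erase hp)]]
  simp only [Function.update_self]
  ring

end

theorem eval_pderiv_Z6 (E : Equation) (a : ℕ → ℝ) (N : ℕ) (I : ℕ → ℝ) (i : ℕ) :
    MvPolynomial.eval I (MvPolynomial.pderiv i (Z6 E a N))
      = ∑ p ∈ Finset.Icc 1 N, ∑ q ∈ Finset.Icc p N, ∑ l ∈ Finset.Icc q N,
        sexticCoeff E a p q l * ((if p = i then I q * I l else 0) + (if q = i then I p * I l else 0)
          + if l = i then I p * I q else 0) := by
  simp only [Z6, map_sum, Nat.floor_natCast]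
  refine Finset.sum_congr rfl fun p _ => Finset.sum_congr rfl fun q _ =>
    Finset.sum_congr rfl fun l _ => ?_
  have hX : ∀ j, MvPolynomial.eval I (MvPolynomial.pderiv i (MvPolynomial.X j : MvPolynomial ℕ ℝ))
      = if j = i then 1 else 0 := fun j => by
    rw [MvPolynomial.pderiv_X]
    by_cases hj : j = i
    · subst hj; simp
    · simp [hj]
  simp only [Derivation.leibniz, MvPolynomial.pderiv_C, smul_eq_mul, map_add, map_mul, hX,
    MvPolynomial.eval_X, MvPolynomial.eval_C, mul_zero, add_zero]
  split_ifs <;> simp <;> ring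

theorem Z6_natFloor (E : Equation) (a : ℕ → ℝ) (N : ℝ) : Z6 E a (⌊N⌋₊ : ℕ) = Z6 E a N := by
  simp [Z6]

/-- A derivative of the cubic `Z6` has at most three quadratic products for each of at most N³
triples, and each product varies by at most 2ηd. -/
theorem abs_eval_pderiv_Z6_sub_le (E : Equation) (a : ℕ → ℝ) {N : ℕ} {C η d : ℝ}
    (hC : ∀ p q l : ℕ, p ≤ N → q ≤ N → l ≤ N → |sexticCoeff E a p q l| ≤ C) (hd : 0 ≤ d)
    (hη : 0 ≤ η) {I I' : ℕ → ℝ}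
    (hI : ∀ p, 1 ≤ p → p ≤ N → |I p| ≤ η) (hI' : ∀ p, 1 ≤ p → p ≤ N → |I' p| ≤ η)
    (hd' : ∀ p, |I p - I' p| ≤ d) (i : ℕ) :
    |MvPolynomial.eval I (MvPolynomial.pderiv i (Z6 E a N))
      - MvPolynomial.eval I' (MvPolynomial.pderiv i (Z6 E a N))|
      ≤ 6 * C * N ^ 3 * η * d := by
  have hC0 : 0 ≤ C := (abs_nonneg _).trans (hC 0 0 0 (by simp) (by simp) (by simp))
  have hprod : ∀ p q, 1 ≤ p → p ≤ N → 1 ≤ q → q ≤ N → ∀ P : Prop, [Decidable P] →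
      |(if P then I p * I q else 0) - (if P then I' p * I' q else 0)| ≤ 2 * η * d := by
    intro p q hp hpN hq hqN P _
    split_ifs
    · rw [show I p * I q - I' p * I' q = I p * (I q - I' q) + (I p - I' p) * I' q by ring]
      refine (abs_add_le _ _).trans ?_
      rw [abs_mul, abs_mul]
      have h1 := mul_le_mul (hI p hp hpN) (hd' q) (abs_nonneg _) hη
      have h2 := mul_le_mul (hd' p) (hI' q hq hqN) (abs_nonneg _) hd
      linarith
    · simp; positivity
  have hsum : ∀ (S : Finset ℕ), S ⊆ Finset.Icc 1 N → ∀ f g : ℕ → ℝ, ∀ B, 0 ≤ B →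
      (∀ p ∈ S, |f p - g p| ≤ B) → |∑ p ∈ S, f p - ∑ p ∈ S, g p| ≤ N * B := by
    intro S hS f g B hB hfg
    rw [← Finset.sum_sub_distrib]
    refine (Finset.abs_sum_le_sum_abs _ _).trans ((Finset.sum_le_sum hfg).trans ?_)
    rw [Finset.sum_const, nsmul_eq_mul]
    refine mul_le_mul_of_nonneg_right ?_ hB
    have := Finset.card_le_card hS
    rw [Nat.card_Icc] at this
    exact_mod_cast (by omega : S.card ≤ N)
  have hsub : ∀ p, 1 ≤ p → Finset.Icc p N ⊆ Finset.Icc 1 N := fun p hp =>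
    Finset.Icc_subset_Icc_left hp
  rw [eval_pderiv_Z6, eval_pderiv_Z6, show 6 * C * (N : ℝ) ^ 3 * η * d
    = N * (N * (N * (C * (3 * (2 * η * d))))) by ring]
  refine hsum _ subset_rfl _ _ _ (by positivity) fun p hp => ?_
  rw [Finset.mem_Icc] at hp
  refine hsum _ (hsub p hp.1) _ _ _ (by positivity) fun q hq => ?_
  rw [Finset.mem_Icc] at hq
  refine hsum _ (hsub q (hp.1.trans hq.1)) _ _ _ (by positivity) fun l hl => ?_
  rw [Finset.mem_Icc] at hl
  have hq1 := hp.1.trans hq.1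
  have hl1 := hq1.trans hl.1
  rw [← mul_sub, abs_mul]
  refine mul_le_mul (hC p q l hp.2 hq.2 hl.2) ?_ (abs_nonneg _) hC0
  have e1 := abs_le.1 (hprod q l hq1 hq.2 hl1 hl.2 (p = i))
  have e2 := abs_le.1 (hprod p l hp.1 hp.2 hl1 hl.2 (q = i))
  have e3 := abs_le.1 (hprod p q hp.1 hp.2 hq1 hq.2 (l = i))
  rw [abs_le]
  constructor <;> linarith [e1.1, e1.2, e2.1, e2.2, e3.1, e3.2]

/-- `f` is a polynomial function of degree at most two with leading coefficient `A`. -/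
def IsQuadratic (A : ℝ) (f : ℝ → ℝ) : Prop := ∃ B C : ℝ, ∀ x, f x = A * x ^ 2 + B * x + C

theorem isQuadratic_const (c : ℝ) : IsQuadratic 0 fun _ => c := ⟨0, c, fun x => by ring⟩

theorem IsQuadratic.add {A A' : ℝ} {f g : ℝ → ℝ} (hf : IsQuadratic A f) (hg : IsQuadratic A' g) :
    IsQuadratic (A + A') fun x => f x + g x := by
  obtain ⟨B, C, h⟩ := hf
  obtain ⟨B', C', h'⟩ := hg
  exact ⟨B + B', C + C', fun x => by simp only [h, h']; ring⟩

theorem IsQuadratic.const_mul {A : ℝ} {f : ℝ → ℝ} (c : ℝ) (hf : IsQuadratic A f) :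
    IsQuadratic (c * A) fun x => c * f x := by
  obtain ⟨B, C, h⟩ := hf
  exact ⟨c * B, c * C, fun x => by simp only [h]; ring⟩

theorem IsQuadratic.sum {ι : Type*} (S : Finset ι) {A : ι → ℝ} {f : ι → ℝ → ℝ}
    (hf : ∀ i ∈ S, IsQuadratic (A i) (f i)) :
    IsQuadratic (∑ i ∈ S, A i) fun x => ∑ i ∈ S, f i x := by
  classical
  induction S using Finset.induction_on with
  | empty => simpa using isQuadratic_const 0
  | insert i S hi ih =>
    simp only [Finset.sum_insert hi]
    exact (hf i (Finset.mem_insert_self _ _)).add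
      (ih fun j hj => hf j (Finset.mem_insert_of_mem hj))

theorem isQuadratic_update_mul_update (I : ℕ → ℝ) (p q l : ℕ) (P : Prop) [Decidable P] :
    IsQuadratic (if P ∧ q = p ∧ l = p then 1 else 0) fun x =>
      if P then Function.update I p x q * Function.update I p x l else 0 := by
  by_cases hP : P
  · by_cases hq : q = p <;> by_cases hl : l = p <;> simp only [hP, hq, hl, Function.update_self,
      Function.update_of_ne, ne_eq, not_false_eq_true, if_true, and_self, and_true, and_false,
      if_false]
    · exact ⟨0, 0, fun x => by ring⟩
    · exact ⟨I l, 0, fun x => by ring⟩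
    · exact ⟨I q, 0, fun x => by ring⟩
    · exact isQuadratic_const _
  · simpa [hP] using isQuadratic_const 0

/-- Only the monomial I_p² I_i yields I_p² after differentiation in I_i; since p < i, its ordered
indices are (p, p, i). -/
theorem isQuadratic_eval_pderiv_Z6 (E : Equation) (a : ℕ → ℝ) {N p i : ℕ} (hp : 1 ≤ p)
    (hpi : p < i) (hi : i ≤ N) (I : ℕ → ℝ) :
    IsQuadratic (sexticCoeff E a p p i) fun x =>
      MvPolynomial.eval (Function.update I p x) (MvPolynomial.pderiv i (Z6 E a N)) := by
  simp only [eval_pderiv_Z6]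
  have key := IsQuadratic.sum (Finset.Icc 1 N) fun p' _ =>
    IsQuadratic.sum (Finset.Icc p' N) fun q _ => IsQuadratic.sum (Finset.Icc q N) fun l _ =>
      (((isQuadratic_update_mul_update I p q l (p' = i)).add
        (isQuadratic_update_mul_update I p p' l (q = i))).add
        (isQuadratic_update_mul_update I p p' q (l = i))).const_mul (sexticCoeff E a p' q l)
  convert key using 1
  symm
  rw [Finset.sum_eq_single_of_mem p (Finset.mem_Icc.2 ⟨hp, by omega⟩),
    Finset.sum_eq_single_of_mem p (Finset.mem_Icc.2 ⟨le_rfl, by omega⟩),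
    Finset.sum_eq_single_of_mem i (Finset.mem_Icc.2 ⟨hpi.le, hi⟩)]
  · simp [hpi.ne, hpi.ne']
  · intro l _ hl
    simp [hpi.ne, hl]
  · intro q hq hqp
    refine Finset.sum_eq_zero fun l hl => ?_
    rw [Finset.mem_Icc] at hq hl
    rw [if_neg (by omega), if_neg (by omega), if_neg (by omega)]
    ring
  · intro p' _ hp'
    refine Finset.sum_eq_zero fun q hq => Finset.sum_eq_zero fun l hl => ?_
    rw [Finset.mem_Icc] at hq hl
    rw [if_neg (by omega), if_neg (by omega), if_neg (by omega)]
    ring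

section

variable {n : ℕ} {m : Fin (n + 2) → ℤ} {k : Fin (n + 2) → ℕ}

/-- The small divisors are quadratic functions of the actions which come before all the `k j`. -/
theorem isQuadratic_Delta46 (E : Equation) (a : ℕ → ℝ) (h : IsMultIndex m k) {N p : ℕ}
    (hN : k 0 ≤ N) (hp : 1 ≤ p) (hpk : p < k (Fin.last _)) (hpκ : p < kappa E a m k)
    (I : ℕ → ℝ) :
    IsQuadratic (quadCoeff E a m k p) fun x => Delta46 E a m k N (Function.update I p x) := by
  have h1 : IsQuadratic 0 fun x => Delta4 E a m k (Function.update I p x) := by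
    have : (fun x => Delta4 E a m k (Function.update I p x))
        = fun _ => Delta4 E a m k (Function.update I p 0) := by
      funext x
      rw [Delta4_update E a h hp I x 0, delta4_of_lt_kappa E a hp hpκ, zero_mul, add_zero]
    rw [this]
    exact isQuadratic_const _
  have h2 := h1.add (IsQuadratic.sum Finset.univ fun j _ =>
    (isQuadratic_eval_pderiv_Z6 E a hp (hpk.trans_le (h.last_le j)) ((h.le_zero j).trans hN)
      I).const_mul ((m j : ℝ) * (k j : ℝ)))
  rw [zero_add] at h2
  exact h2

theorem abs_Delta6_sub_le (E : Equation) (a : ℕ → ℝ) (h : IsMultIndex m k) {N : ℕ} {C η d : ℝ}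
    (hN : k 0 ≤ N)
    (hC : ∀ p q l : ℕ, p ≤ N → q ≤ N → l ≤ N → |sexticCoeff E a p q l| ≤ C) (hd : 0 ≤ d)
    (hη : 0 ≤ η) {I I' : ℕ → ℝ}
    (hI : ∀ p, 1 ≤ p → p ≤ N → |I p| ≤ η) (hI' : ∀ p, 1 ≤ p → p ≤ N → |I' p| ≤ η)
    (hd' : ∀ p, |I p - I' p| ≤ d) :
    |Delta6 E a m k N I - Delta6 E a m k N I'| ≤ l1 m * (6 * C * N ^ 4 * η * d) := by
  have hC0 : 0 ≤ C := (abs_nonneg _).trans (hC 0 0 0 (by simp) (by simp) (by simp))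
  rw [Delta6, Delta6, ← Finset.sum_sub_distrib]
  refine (Finset.abs_sum_le_sum_abs _ _).trans ?_
  rw [l1, Nat.cast_sum, Finset.sum_mul]
  refine Finset.sum_le_sum fun j _ => ?_
  rw [← mul_sub, abs_mul, abs_mul, Nat.abs_cast, Nat.cast_natAbs, Int.cast_abs,
    show 6 * C * (N : ℝ) ^ 4 * η * d = N * (6 * C * (N : ℝ) ^ 3 * η * d) by ring, mul_assoc]
  refine mul_le_mul_of_nonneg_left ?_ (abs_nonneg _)
  refine mul_le_mul ?_ (abs_eval_pderiv_Z6_sub_le E a hC hd hη hI hI' hd' _) (abs_nonneg _)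
    (by positivity)
  exact_mod_cast (h.le_zero j).trans hN

theorem measurable_Delta4 (E : Equation) (a : ℕ → ℝ) (h : IsMultIndex m k) :
    Measurable (Delta4 E a m k) := by
  rw [funext (Delta4_eq_sum E a h le_rfl)]
  fun_prop

theorem measurable_Delta46 (E : Equation) (a : ℕ → ℝ) (h : IsMultIndex m k) (N : ℝ) :
    Measurable (Delta46 E a m k N) := by
  refine (measurable_Delta4 E a h).add (Finset.measurable_fun_sum _ fun j _ => ?_)
  exact ((MvPolynomial.continuous_eval _).measurable).const_mul _

theorem Delta4_congr (E : Equation) (a : ℕ → ℝ) (h : IsMultIndex m k) {N : ℕ} (hN : k 0 ≤ N)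
    {I I' : ℕ → ℝ} (hI : ∀ p, 1 ≤ p → p ≤ N → I p = I' p) :
    Delta4 E a m k I = Delta4 E a m k I' := by
  rw [Delta4_eq_sum E a h hN, Delta4_eq_sum E a h hN]
  refine Finset.sum_congr rfl fun p hp => ?_
  rw [Finset.mem_Icc] at hp
  rw [hI p hp.1 hp.2]

theorem Delta46_congr (E : Equation) (a : ℕ → ℝ) (h : IsMultIndex m k) {N : ℕ} (hN : k 0 ≤ N)
    {I I' : ℕ → ℝ} (hI : ∀ p, 1 ≤ p → p ≤ N → I p = I' p) :
    Delta46 E a m k N I = Delta46 E a m k N I' := by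
  rw [Delta46, Delta46, Delta4_congr E a h hN hI, Delta6, Delta6]
  congr 1
  refine Finset.sum_congr rfl fun j _ => ?_
  rw [eval_pderiv_Z6, eval_pderiv_Z6]
  congr 1
  refine Finset.sum_congr rfl fun p hp => Finset.sum_congr rfl fun q hq =>
    Finset.sum_congr rfl fun l hl => ?_
  rw [Finset.mem_Icc] at hp hq hl
  rw [hI p hp.1 hp.2, hI q (by omega) hq.2, hI l (by omega) hl.2]

theorem Delta46_natFloor (E : Equation) (a : ℕ → ℝ) (N : ℝ) (I : ℕ → ℝ) :
    Delta46 E a m k (⌊N⌋₊ : ℕ) I = Delta46 E a m k N I := by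
  simp only [Delta46, Delta6, Z6_natFloor]

end

/-! ### Fubini along one coordinate, and sublevel sets -/

section

variable {Ω : Type*} [MeasurableSpace Ω] {μ : Measure Ω}

/-- The probability that a sequence of independent random variables, the `q`-th one being uniformly
distributed, belongs to a cylinder whose sections along the `q`-th coordinate are small. -/
theorem measure_le_of_volume_update_le [IsProbabilityMeasure μ] {I : ℕ → Ω → ℝ}
    (hm : ∀ k : ℕ, 1 ≤ k → Measurable (I k)) (hi : iIndepFun (fun k : ℕ+ => I k) μ) {q : ℕ}
    (hq : 1 ≤ q) {y₀ d : ℝ} (hd : 0 < d)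
    (hu : pdf.IsUniform (I q) (Set.Ioo y₀ (y₀ + d)) μ volume) {N : ℕ} {A : Set (ℕ → ℝ)}
    (hA : MeasurableSet A)
    (hN : ∀ x x' : ℕ → ℝ, (∀ p, 1 ≤ p → p ≤ N → x p = x' p) → x ∈ A → x' ∈ A) {v : ℝ}
    (hv : ∀ x : ℕ → ℝ, volume {y | Function.update x q y ∈ A} ≤ ENNReal.ofReal v) :
    μ {w | (fun k => I k w) ∈ A} ≤ ENNReal.ofReal (v / d) := by
  classical
  set q' : ℕ+ := ⟨q, hq⟩ with hq'
  -- `N` may be zero, hence the bound N + 1; the extra coordinate is harmless.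
  set T : Finset ℕ+ := (Finset.Icc 1 N.succPNat).erase q' with hT
  have hmemT : ∀ p : ℕ+, (p : ℕ) ≤ N → p ≠ q' → p ∈ T := fun p hp hpq =>
    Finset.mem_erase.2 ⟨hpq, Finset.mem_Icc.2 ⟨one_le, (PNat.coe_le_coe _ _).1 (hp.trans (Nat.le_succ N))⟩⟩
  set ext : (T → ℝ) → ℕ → ℝ := fun y k =>
    if h : ∃ hk : 0 < k, (⟨k, hk⟩ : ℕ+) ∈ T then y ⟨⟨k, h.1⟩, h.2⟩ else 0 with hext
  have hext_meas : Measurable ext := by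
    rw [measurable_pi_iff]
    intro k
    by_cases h : ∃ hk : 0 < k, (⟨k, hk⟩ : ℕ+) ∈ T
    · simp only [hext, dif_pos h]
      exact measurable_pi_apply _
    · simp only [hext, dif_neg h]
      exact measurable_const
  set Y : Ω → T → ℝ := fun w k => I (k : ℕ+) w with hY
  have hYm : Measurable Y := measurable_pi_iff.2 fun k => hm _ (k : ℕ+).2
  have hXm : Measurable (I q) := hm q hq
  have hindep : IndepFun (I q) Y μ := by
    have h1 := hi.indepFun_finset {q'} T (by simp [hT]) fun k => hm _ k.2
    have h2 : Measurable fun z : ({q'} : Finset ℕ+) → ℝ => z ⟨q', Finset.mem_singleton_self _⟩ :=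
      measurable_pi_apply _
    exact h1.comp h2 measurable_id
  set B : Set (ℝ × (T → ℝ)) := {z | Function.update (ext z.2) q z.1 ∈ A} with hB
  have hBm : MeasurableSet B := by
    have : Measurable fun z : ℝ × (T → ℝ) => Function.update (ext z.2) q z.1 :=
      measurable_update'.comp ((hext_meas.comp measurable_snd).prodMk measurable_fst)
    exact this hA
  -- Coordinates outside `T` other than `q` are replaced by zero, which is allowed because
  -- membership in `A` depends only on coordinates 1, …, N.
  have hset : {w | (fun k => I k w) ∈ A} ⊆ (fun w => (I q w, Y w)) ⁻¹' B := by
    intro w hw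
    refine hN _ _ (fun p hp hpN => ?_) hw
    by_cases hpq : p = q
    · subst hpq; simp
    · have : ∃ hk : 0 < p, (⟨p, hk⟩ : ℕ+) ∈ T := ⟨hp, hmemT ⟨p, hp⟩ hpN fun h => hpq (congrArg PNat.val h)⟩
      simp only [Function.update_of_ne hpq, hext, dif_pos this, hY]
      rfl
  refine (measure_mono hset).trans ?_
  rw [← Measure.map_apply (hXm.prodMk hYm) hBm,
    hindep.map_prod_eq_prod_map_map hXm.aemeasurable hYm.aemeasurable]
  have : IsProbabilityMeasure (μ.map Y) := Measure.isProbabilityMeasure_map hYm.aemeasurable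
  have : IsProbabilityMeasure (μ.map (I q)) := Measure.isProbabilityMeasure_map hXm.aemeasurable
  rw [Measure.prod_apply_symm hBm]
  refine (lintegral_mono (g := fun _ => ENNReal.ofReal (v / d)) fun y => ?_).trans (by simp)
  have hu' : μ.map (I q) = cond volume (Set.Ioo y₀ (y₀ + d)) := hu
  rw [hu', cond_apply measurableSet_Ioo, Real.volume_Ioo, add_sub_cancel_left,
    ENNReal.ofReal_div_of_pos hd, ENNReal.div_eq_inv_mul]
  refine mul_le_mul' le_rfl ?_
  exact (measure_mono Set.inter_subset_right).trans (hv (ext y))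

theorem ae_mem_Ioo_of_isUniform {X : Ω → ℝ} {y₀ d : ℝ} (hd : 0 < d)
    (hu : pdf.IsUniform X (Set.Ioo y₀ (y₀ + d)) μ volume) : ∀ᵐ w ∂μ, X w ∈ Set.Ioo y₀ (y₀ + d) := by
  have h0 : volume (Set.Ioo y₀ (y₀ + d)) ≠ 0 := by simp [hd]
  have h1 : volume (Set.Ioo y₀ (y₀ + d)) ≠ ⊤ := by simp
  have := hu.measure_preimage h0 h1 (measurableSet_Ioo (a := y₀) (b := y₀ + d)).compl
  rw [Set.inter_compl_self, measure_empty, ENNReal.zero_div] at this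
  exact this

end

theorem volume_le_of_abs_sub_le {S : Set ℝ} {d : ℝ} (h : ∀ x ∈ S, ∀ y ∈ S, |x - y| ≤ d) :
    volume S ≤ ENNReal.ofReal d := by
  refine (Real.volume_le_diam S).trans (Metric.ediam_le fun x hx y hy => ?_)
  rw [edist_dist, Real.dist_eq]
  exact ENNReal.ofReal_le_ofReal (h x hx y hy)

/-- On `S` the function expands distances by at least `c` while its image has diameter at most 2ε,
so the diameter of `S` is controlled. `S` need not be an interval, which allows further constraints
to be built into it. -/
theorem volume_le_of_le_abs_sub {S : Set ℝ} {h : ℝ → ℝ} {ε c : ℝ} (hc : 0 < c)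
    (hε : ∀ x ∈ S, |h x| ≤ ε) (hS : ∀ x ∈ S, ∀ y ∈ S, c * |x - y| ≤ |h x - h y|) :
    volume S ≤ ENNReal.ofReal (2 * ε / c) := by
  refine volume_le_of_abs_sub_le fun x hx y hy => ?_
  rw [le_div_iff₀ hc]
  have h1 := hS x hx y hy
  have h2 := abs_le.1 (hε x hx)
  have h3 := abs_le.1 (hε y hy)
  have h4 : |h x - h y| ≤ 2 * ε := abs_le.2 ⟨by linarith, by linarith⟩
  linarith

/-- Sublevel sets of quadratic functions. -/
theorem IsQuadratic.volume_le {A : ℝ} {f : ℝ → ℝ} (hf : IsQuadratic A f) (hA : A ≠ 0) (ε : ℝ) :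
    volume {x | |f x| ≤ ε} ≤ ENNReal.ofReal (2 * √(2 * ε / |A|)) := by
  obtain ⟨B, C, hf⟩ := hf
  set t : ℝ := -(B / (2 * A)) with ht
  have hA' : 0 < |A| := abs_pos.2 hA
  -- `t` is the vertex. On one side of it |x - y| ≤ |(x - t) + (y - t)|, hence |f x - f y| ≥ |A| (x
  -- - y)².
  have key : ∀ x y, |f x| ≤ ε → |f y| ≤ ε → 0 ≤ (x - t) * (y - t) → |x - y| ≤ √(2 * ε / |A|) := by
    intro x y hx hy hxy
    rw [← Real.sqrt_sq_eq_abs]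
    refine Real.sqrt_le_sqrt ?_
    rw [le_div_iff₀ hA', ← abs_of_nonneg (sq_nonneg (x - y)), ← abs_mul]
    have h1 : |(x - y) ^ 2| ≤ |(x - y) * ((x - t) + (y - t))| := by
      rw [sq, abs_mul, abs_mul]
      refine mul_le_mul_of_nonneg_left (sq_le_sq.1 ?_) (abs_nonneg _)
      nlinarith
    have h2 : (x - y) * ((x - t) + (y - t)) * A = f x - f y := by
      rw [hf, hf, ht]; field_simp; ring
    calc |(x - y) ^ 2 * A| = |(x - y) ^ 2| * |A| := abs_mul _ _
      _ ≤ |(x - y) * ((x - t) + (y - t))| * |A| := mul_le_mul_of_nonneg_right h1 hA'.le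
      _ = |f x - f y| := by rw [← abs_mul, h2]
      _ ≤ 2 * ε := by
        have h2 := abs_le.1 hx
        have h3 := abs_le.1 hy
        exact abs_le.2 ⟨by linarith, by linarith⟩
  have hsub : {x | |f x| ≤ ε} ⊆ {x | |f x| ≤ ε ∧ t ≤ x} ∪ {x | |f x| ≤ ε ∧ x ≤ t} := fun x hx =>
    (le_total t x).imp (fun h => ⟨hx, h⟩) fun h => ⟨hx, h⟩
  rw [two_mul, ENNReal.ofReal_add (Real.sqrt_nonneg _) (Real.sqrt_nonneg _)]
  refine (measure_mono hsub).trans ((measure_union_le _ _).trans (add_le_add ?_ ?_))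
  · exact volume_le_of_abs_sub_le fun x hx y hy =>
      key x y hx.1 hy.1 (mul_nonneg (sub_nonneg.2 hx.2) (sub_nonneg.2 hy.2))
  · exact volume_le_of_abs_sub_le fun x hx y hy =>
      key x y hx.1 hy.1 (mul_nonneg_of_nonpos_of_nonpos (sub_nonpos.2 hx.2) (sub_nonpos.2 hy.2))

/-! ### Actions and norm of the cosine series -/

theorem action_cosSeries {I : ℕ → ℝ} {k : ℕ} (hk : 1 ≤ k) (hI : 0 ≤ I k) :
    action (cosSeries I) k = I k := by
  have : k ≠ 0 := by omega
  simp [action, cosSeries, this, Real.sq_sqrt hI]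

theorem hasSum_normSq_cosSeries {s : ℝ} {I : ℕ → ℝ} (hI : ∀ k : ℕ, 1 ≤ k → 0 ≤ I k)
    (hs : Summable fun k : ℕ+ => I k * (k : ℝ) ^ (2 * s)) :
    HasSum (fun k : ℤ => |(k : ℝ)| ^ (2 * s) * ‖cosSeries I k‖ ^ 2)
      (2 * ∑' k : ℕ+, I k * (k : ℝ) ^ (2 * s)) := by
  set g : ℕ → ℝ := fun k => I k * (k : ℝ) ^ (2 * s) with hg
  have hs1 : Summable fun k : ℕ => g (k + 1) := (summable_pnat_iff_summable_succ (f := g)).1 hs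
  have h1 : HasSum (fun k : ℕ => g (k + 1)) (∑' k : ℕ+, g k) := by
    rw [tsum_pnat_eq_tsum_succ (f := g)]
    exact hs1.hasSum
  have key : ∀ f : ℤ → ℝ, f 0 = 0 → (∀ k, k ≠ 0 → f k = g k.natAbs) →
      HasSum f ((∑' k : ℕ+, g k) + ∑' k : ℕ+, g k) := by
    intro f f0 hf
    have h2 : HasSum (fun k : ℕ => f k) (∑' k : ℕ+, g k) := by
      rw [← hasSum_nat_add_iff' 1, Finset.sum_range_one, Nat.cast_zero, f0, sub_zero]
      refine h1.congr_fun fun k => ?_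
      rw [hf _ (by omega), Int.natAbs_natCast]
    have h3 : HasSum (fun k : ℕ => f (-(k + 1))) (∑' k : ℕ+, g k) := by
      refine h1.congr_fun fun k => ?_
      have : (-((k : ℤ) + 1)).natAbs = k + 1 := by omega
      rw [hf _ (by omega), this]
    exact h2.of_nat_of_neg_add_one h3
  rw [two_mul (∑' k : ℕ+, I k * (k : ℝ) ^ (2 * s))]
  refine key (fun k => |(k : ℝ)| ^ (2 * s) * ‖cosSeries I k‖ ^ 2) (by simp [cosSeries])
    fun k hk => ?_
  have h0 : 0 ≤ I k.natAbs := hI _ (Int.natAbs_pos.2 hk)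
  simp only [cosSeries, hk, if_false, Complex.norm_real, Real.norm_eq_abs, sq_abs,
    Real.sq_sqrt h0, hg]
  rw [mul_comm, Nat.cast_natAbs, Int.cast_abs]

theorem hasSum_pnat_rpow_neg {ν : ℝ} (hν : 1 < ν) :
    HasSum (fun k : ℕ+ => (k : ℝ) ^ (-ν)) (riemannZeta (ν : ℂ)).re := by
  have hs : Summable fun k : ℕ => (k : ℝ) ^ (-ν) := Real.summable_nat_rpow.2 (by linarith)
  have hs1 : Summable fun k : ℕ+ => (k : ℝ) ^ (-ν) :=
    (summable_pnat_iff_summable_succ (f := fun k : ℕ => (k : ℝ) ^ (-ν))).2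
      ((summable_nat_add_iff 1).2 hs)
  have hz : riemannZeta (ν : ℂ) = ((∑' k : ℕ+, (k : ℝ) ^ (-ν) : ℝ) : ℂ) := by
    rw [zeta_eq_tsum_one_div_nat_add_one_cpow (by simpa using hν),
      tsum_pnat_eq_tsum_succ (f := fun k : ℕ => (k : ℝ) ^ (-ν)), Complex.ofReal_tsum]
    refine tsum_congr fun k => ?_
    rw [Complex.ofReal_cpow (by positivity), Complex.ofReal_neg, Complex.cpow_neg, one_div]
    simp
  rw [hz, Complex.ofReal_re]
  exact hs1.hasSum

/-! ### Probability that one given small divisor is small -/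

section

variable {Ω : Type*} [MeasurableSpace Ω]

/-- Independent random variables, the `k`-th one being uniformly distributed in
`J_k + σ (0, k ^ (-2 s - ν))`. -/
structure IsRandomActions (s ν σ : ℝ) (J : ℕ → ℝ) (μ : Measure Ω) (I : ℕ → Ω → ℝ) : Prop where
  measurable : ∀ k : ℕ, 1 ≤ k → Measurable (I k)
  iIndepFun : iIndepFun (fun k : ℕ+ => I k) μ
  isUniform : ∀ k : ℕ, 1 ≤ k →
    pdf.IsUniform (I k) (Set.Ioo (J k) (J k + σ * (k : ℝ) ^ (-2 * s - ν))) μ volume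

variable {μ : Measure Ω} [IsProbabilityMeasure μ] {s ν σ : ℝ} {J : ℕ → ℝ} {I : ℕ → Ω → ℝ}

theorem IsRandomActions.measure_le (hI : IsRandomActions s ν σ J μ I) (hσ : 0 < σ) {q : ℕ}
    (hq : 1 ≤ q) {N : ℕ} {A : Set (ℕ → ℝ)} (hA : MeasurableSet A)
    (hN : ∀ x x' : ℕ → ℝ, (∀ p, 1 ≤ p → p ≤ N → x p = x' p) → x ∈ A → x' ∈ A) {v : ℝ}
    (hv : ∀ x : ℕ → ℝ, volume {y | Function.update x q y ∈ A} ≤ ENNReal.ofReal v) :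
    μ {w | (fun k => I k w) ∈ A} ≤ ENNReal.ofReal (v / (σ * (q : ℝ) ^ (-2 * s - ν))) := by
  have hq' : (0 : ℝ) < q := by exact_mod_cast hq
  exact measure_le_of_volume_update_le hI.measurable hI.iIndepFun hq (by positivity)
    (hI.isUniform q hq) hA hN hv

variable {n : ℕ} {m : Fin (n + 2) → ℤ} {k : Fin (n + 2) → ℕ}

theorem IsRandomActions.measure_Delta4_le (hI : IsRandomActions s ν σ J μ I) (hσ : 0 < σ)
    (E : Equation) (a : ℕ → ℝ) (h : IsMultIndex m k) {N : ℕ} (hN : k 0 ≤ N) {c : ℝ} (hc : 0 < c)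
    {q : ℕ} (hq : 1 ≤ q) (hδ : c ≤ |delta4 E a m k q|) (ε : ℝ) :
    μ {w | |Delta4 E a m k fun p => I p w| ≤ ε}
      ≤ ENNReal.ofReal (2 * ε / c / (σ * (q : ℝ) ^ (-2 * s - ν))) := by
  refine hI.measure_le hσ hq (N := N) (A := {x | |Delta4 E a m k x| ≤ ε})
    (measurableSet_le (measurable_Delta4 E a h).abs measurable_const) ?_ fun x => ?_
  · intro x x' hx hxA
    rwa [Set.mem_ofPred_eq, ← Delta4_congr E a h hN hx]
  · refine volume_le_of_le_abs_sub (h := fun y => Delta4 E a m k (Function.update x q y)) hc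
      (fun y hy => hy) fun y _ z _ => ?_
    rw [Delta4_update E a h hq x y z, add_sub_cancel_left, abs_mul]
    exact mul_le_mul_of_nonneg_right hδ (abs_nonneg _)

/-- Between two points of a section at which all actions are at most η, the sextic part varies by at
most c/2 times the distance, so a slope c/2 survives from Δ⁽⁴⁾. -/
theorem IsRandomActions.measure_Delta46_le (hI : IsRandomActions s ν σ J μ I) (hσ : 0 < σ)
    (E : Equation) (a : ℕ → ℝ) (h : IsMultIndex m k) {N : ℕ} (hN : k 0 ≤ N) {c : ℝ} (hc : 0 < c)
    {q : ℕ} (hq : 1 ≤ q) (hδ : c ≤ |delta4 E a m k q|) {C η : ℝ}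
    (hC : ∀ p q l : ℕ, p ≤ N → q ≤ N → l ≤ N → |sexticCoeff E a p q l| ≤ C) (hη : 0 ≤ η)
    (hCη : l1 m * (6 * C * N ^ 4 * η) ≤ c / 2) (ε : ℝ) :
    μ {w | (∀ p, 1 ≤ p → p ≤ N → |I p w| ≤ η) ∧ |Delta46 E a m k N fun p => I p w| ≤ ε}
      ≤ ENNReal.ofReal (2 * ε / (c / 2) / (σ * (q : ℝ) ^ (-2 * s - ν))) := by
  have hmeas : MeasurableSet {x : ℕ → ℝ | ∀ p, 1 ≤ p → p ≤ N → |x p| ≤ η} := by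
    have : {x : ℕ → ℝ | ∀ p, 1 ≤ p → p ≤ N → |x p| ≤ η}
        = ⋂ p, ⋂ (_ : 1 ≤ p), ⋂ (_ : p ≤ N), {x | |x p| ≤ η} := by ext; simp
    rw [this]
    exact MeasurableSet.iInter fun p => MeasurableSet.iInter fun _ => MeasurableSet.iInter fun _ =>
      measurableSet_le (measurable_pi_apply p).abs measurable_const
  refine hI.measure_le hσ hq (N := N) (A := {x | (∀ p, 1 ≤ p → p ≤ N → |x p| ≤ η) ∧
    |Delta46 E a m k N x| ≤ ε}) (hmeas.inter
      (measurableSet_le (measurable_Delta46 E a h N).abs measurable_const)) ?_ fun x => ?_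
  · rintro x x' hx ⟨hxA, hxA'⟩
    exact ⟨fun p hp hp' => by rw [← hx p hp hp']; exact hxA p hp hp',
      by rwa [← Delta46_congr E a h hN hx]⟩
  · refine volume_le_of_le_abs_sub (h := fun y => Delta46 E a m k N (Function.update x q y))
      (half_pos hc) (fun y hy => hy.2) fun y hy z hz => ?_
    have h4 := Delta4_update E a h hq x y z
    have h6 := abs_Delta6_sub_le E a h hN hC (abs_nonneg (y - z)) hη hy.1 hz.1 fun p => by
      by_cases hp : p = q
      · subst hp; simp
      · simp [hp]
    have h7 : c * |y - z| ≤ |delta4 E a m k q * (y - z)| := by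
      rw [abs_mul]
      exact mul_le_mul_of_nonneg_right hδ (abs_nonneg _)
    have h8 : (l1 m : ℝ) * (6 * C * N ^ 4 * η * |y - z|) ≤ c / 2 * |y - z| := by
      rw [show (l1 m : ℝ) * (6 * C * N ^ 4 * η * |y - z|)
        = l1 m * (6 * C * N ^ 4 * η) * |y - z| by ring]
      exact mul_le_mul_of_nonneg_right hCη (abs_nonneg _)
    have h9 : delta4 E a m k q * (y - z)
        = (Delta46 E a m k N (Function.update x q y) - Delta46 E a m k N (Function.update x q z))
        - (Delta6 E a m k N (Function.update x q y) - Delta6 E a m k N (Function.update x q z)) := by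
      rw [Delta46, Delta46, h4]; ring
    have h10 := abs_sub
      (Delta46 E a m k N (Function.update x q y) - Delta46 E a m k N (Function.update x q z))
      (Delta6 E a m k N (Function.update x q y) - Delta6 E a m k N (Function.update x q z))
    rw [← h9] at h10
    linarith

theorem IsRandomActions.measure_Delta46_le_of_quadCoeff (hI : IsRandomActions s ν σ J μ I)
    (hσ : 0 < σ) (E : Equation) (a : ℕ → ℝ) (h : IsMultIndex m k) {N : ℕ} (hN : k 0 ≤ N) {q : ℕ}
    (hq : 1 ≤ q) (hqk : q < k (Fin.last _)) (hqκ : q < kappa E a m k)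
    (hA : quadCoeff E a m k q ≠ 0) (ε : ℝ) :
    μ {w | |Delta46 E a m k N fun p => I p w| ≤ ε}
      ≤ ENNReal.ofReal (2 * √(2 * ε / |quadCoeff E a m k q|) / (σ * (q : ℝ) ^ (-2 * s - ν))) := by
  refine hI.measure_le hσ hq (N := N) (A := {x | |Delta46 E a m k N x| ≤ ε})
    (measurableSet_le (measurable_Delta46 E a h N).abs measurable_const) ?_ fun x => ?_
  · intro x x' hx hxA
    rwa [Set.mem_ofPred_eq, ← Delta46_congr E a h hN hx]
  · exact (isQuadratic_Delta46 E a h hN hq hqk hqκ x).volume_le hA ε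

end

/-! ### Power counting in N -/

theorem rpow_neg_div_rpow_le {s ν q N : ℝ} (hq : 1 ≤ q) (hqN : q ≤ N) (hν : ν ≤ 9) :
    q ^ (-2 * s) / q ^ (-2 * s - ν) ≤ N ^ 9 := by
  have hq0 : 0 < q := one_pos.trans_le hq
  rw [← Real.rpow_sub hq0, show -2 * s - (-2 * s - ν) = ν by ring]
  calc q ^ ν ≤ q ^ (9 : ℝ) := Real.rpow_le_rpow_of_exponent_le hq hν
    _ = q ^ 9 := by norm_cast
    _ ≤ N ^ 9 := pow_le_pow_left₀ hq0.le hqN 9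

theorem rpow_neg_mul_natCast {N : ℝ} (hN : 0 ≤ N) (b M : ℕ) :
    N ^ (-(b : ℝ) * (M : ℝ)) = (N ^ (b * M))⁻¹ := by
  rw [neg_mul, Real.rpow_neg hN, ← Nat.cast_mul, Real.rpow_natCast]

theorem pow_mul_inv_pow_le {N : ℝ} (hN : 1 ≤ N) {b e d : ℕ} (h : b + e ≤ d) :
    N ^ b * (N ^ d)⁻¹ ≤ 1 / N ^ e := by
  have hN0 : 0 < N := one_pos.trans_le hN
  rw [← div_eq_mul_inv, div_le_div_iff₀ (by positivity) (by positivity), one_mul, ← pow_add]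
  exact pow_le_pow_right₀ hN h

/-- One power of N is lost through the slope and nine through q^ν. The gain N^(5M) covers these ten
and the n + 4 needed by the union bound, because n + 2 ≤ M and M ≥ 5. The parameter σ cancels. -/
theorem sublevel_bound_of_slope {c N T γ σ ζ s ν q : ℝ} {M n : ℕ} (hc : 0 < c) (hN : 1 ≤ N)
    (hT : T ≤ (N ^ (5 * M))⁻¹) (hγ : 0 ≤ γ) (hσ : 0 < σ) (hζ : 0 ≤ ζ) (hq : 1 ≤ q)
    (hqN : q ≤ N) (hν : ν ≤ 9) (hM : 5 ≤ M) (hn : n + 2 ≤ M) :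
    2 * (γ * T * (4 * σ * ζ) * q ^ (-2 * s)) / (c / N) / (σ * q ^ (-2 * s - ν))
      ≤ 8 / c * (ζ * γ) / N ^ (n + 4) := by
  have hq0 : 0 < q := one_pos.trans_le hq
  have hN0 : 0 < N := one_pos.trans_le hN
  have hq' : 0 < q ^ (-2 * s - ν) := Real.rpow_pos_of_pos hq0 _
  have h1 := rpow_neg_div_rpow_le (s := s) hq hqN hν
  have h2 := pow_mul_inv_pow_le hN (show 10 + (n + 4) ≤ 5 * M by omega)
  calc 2 * (γ * T * (4 * σ * ζ) * q ^ (-2 * s)) / (c / N) / (σ * q ^ (-2 * s - ν))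
      = 8 / c * (ζ * γ) * (N * (q ^ (-2 * s) / q ^ (-2 * s - ν)) * T) := by field_simp; ring
    _ ≤ 8 / c * (ζ * γ) * (N * N ^ 9 * (N ^ (5 * M))⁻¹) := by
        have h3 : 0 ≤ q ^ (-2 * s) / q ^ (-2 * s - ν) := by positivity
        have h4 : N * (q ^ (-2 * s) / q ^ (-2 * s - ν)) * T
            ≤ N * (q ^ (-2 * s) / q ^ (-2 * s - ν)) * (N ^ (5 * M))⁻¹ :=
          mul_le_mul_of_nonneg_left hT (by positivity)
        refine mul_le_mul_of_nonneg_left (h4.trans ?_) (by positivity)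
        gcongr
    _ ≤ 8 / c * (ζ * γ) * (1 / N ^ (n + 4)) := by
        rw [show N * N ^ 9 = N ^ 10 by ring]
        exact mul_le_mul_of_nonneg_left h2 (by positivity)
    _ = _ := by ring

/-- The threshold contains (γσ)², so the square root leaves γσ to the first power and σ cancels
against the interval length. Of the exponent (21 - 8)M/2, the part 6M suffices; the weight q^(2s)
costs at most one power of N. -/
theorem sublevel_bound_of_quadratic {c N A γ σ ζ s ν q : ℝ} {M n : ℕ} (hc : 0 < c) (hN : 1 ≤ N)
    (hA : c ≤ |A| * N ^ (8 * M)) (hγ : 0 ≤ γ) (hσ : 0 < σ) (hζ : 0 ≤ ζ) (hq : 1 ≤ q)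
    (hqN : q ≤ N) (hqs : q ^ (2 * s) ≤ N) (hν : ν ≤ 9) (hM : 5 ≤ M) (hn : n + 2 ≤ M) :
    2 * √(2 * (γ * (N ^ (21 * M))⁻¹ * (4 * σ * ζ) * (γ * (4 * σ * ζ))) / |A|)
        / (σ * q ^ (-2 * s - ν))
      ≤ 8 * √(2 / c) * (ζ * γ) / N ^ (n + 4) := by
  have hq0 : 0 < q := one_pos.trans_le hq
  have hN0 : 0 < N := one_pos.trans_le hN
  have hA0 : 0 < |A| := by
    refine lt_of_le_of_ne (abs_nonneg _) fun h => ?_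
    rw [← h, zero_mul] at hA
    linarith
  have h1 : (N ^ (21 * M))⁻¹ / |A| ≤ ((N ^ (6 * M))⁻¹) ^ 2 / c := by
    rw [div_le_div_iff₀ hA0 hc]
    have e1 : (N ^ (21 * M))⁻¹ * N ^ (8 * M) ≤ ((N ^ (6 * M))⁻¹) ^ 2 := by
      rw [mul_comm, inv_pow, ← pow_mul]
      have := pow_mul_inv_pow_le hN (show 8 * M + 6 * M * 2 ≤ 21 * M by omega)
      rwa [one_div] at this
    calc (N ^ (21 * M))⁻¹ * c ≤ (N ^ (21 * M))⁻¹ * (|A| * N ^ (8 * M)) := by gcongr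
      _ = (N ^ (21 * M))⁻¹ * N ^ (8 * M) * |A| := by ring
      _ ≤ _ := by gcongr
  have h2 : √(2 * (γ * (N ^ (21 * M))⁻¹ * (4 * σ * ζ) * (γ * (4 * σ * ζ))) / |A|)
      ≤ √(2 / c) * ((4 * σ * ζ * γ) * (N ^ (6 * M))⁻¹) := by
    rw [← Real.sqrt_sq (show 0 ≤ (4 * σ * ζ * γ) * (N ^ (6 * M))⁻¹ by positivity),
      ← Real.sqrt_mul (by positivity)]
    refine Real.sqrt_le_sqrt ?_
    calc 2 * (γ * (N ^ (21 * M))⁻¹ * (4 * σ * ζ) * (γ * (4 * σ * ζ))) / |A|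
        = 2 * (4 * σ * ζ * γ) ^ 2 * ((N ^ (21 * M))⁻¹ / |A|) := by ring
      _ ≤ 2 * (4 * σ * ζ * γ) ^ 2 * (((N ^ (6 * M))⁻¹) ^ 2 / c) := by gcongr
      _ = _ := by ring
  have h3 : 1 / q ^ (-2 * s - ν) ≤ N * N ^ 9 := by
    rw [one_div, ← Real.rpow_neg hq0.le, show -(-2 * s - ν) = 2 * s + ν by ring,
      Real.rpow_add hq0]
    refine mul_le_mul hqs ?_ (by positivity) hN0.le
    calc q ^ ν ≤ q ^ (9 : ℝ) := Real.rpow_le_rpow_of_exponent_le hq hν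
      _ = q ^ 9 := by norm_cast
      _ ≤ N ^ 9 := pow_le_pow_left₀ hq0.le hqN 9
  have h4 := pow_mul_inv_pow_le hN (show 10 + (n + 4) ≤ 6 * M by omega)
  have hq' : 0 < q ^ (-2 * s - ν) := Real.rpow_pos_of_pos hq0 _
  calc 2 * √(2 * (γ * (N ^ (21 * M))⁻¹ * (4 * σ * ζ) * (γ * (4 * σ * ζ))) / |A|)
        / (σ * q ^ (-2 * s - ν))
      ≤ 2 * (√(2 / c) * ((4 * σ * ζ * γ) * (N ^ (6 * M))⁻¹)) / (σ * q ^ (-2 * s - ν)) := by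
        gcongr
    _ = 8 * √(2 / c) * (ζ * γ) * (1 / q ^ (-2 * s - ν) * (N ^ (6 * M))⁻¹) := by
        field_simp
        ring
    _ ≤ 8 * √(2 / c) * (ζ * γ) * (N * N ^ 9 * (N ^ (6 * M))⁻¹) := by gcongr
    _ ≤ 8 * √(2 / c) * (ζ * γ) * (1 / N ^ (n + 4)) := by
        rw [show N * N ^ 9 = N ^ 10 by ring]
        gcongr
    _ = _ := by ring

/-- The sequences of actions for which one of the small divisors indexed by `(m, k)` is too small,
`B` being a bound on the square of the norm. -/
def resonantActions (E : Equation) (a : ℕ → ℝ) (s γ B : ℝ) (K N : ℕ) {n : ℕ}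
    (m : Fin (n + 2) → ℤ) (k : Fin (n + 2) → ℕ) : Set (ℕ → ℝ) :=
  {x | |Delta4 E a m k x|
      ≤ γ * (N : ℝ) ^ (-5 * (l1 m : ℝ)) * B * (kappa E a m k : ℝ) ^ (-2 * s)} ∪
  ({x | (∀ p, 1 ≤ p → p ≤ N → |x p| ≤ ((N : ℝ) ^ 20)⁻¹) ∧ |Delta46 E a m k N x|
      ≤ γ * (N : ℝ) ^ (-21 * (l1 m : ℝ)) * B * (kappa E a m k : ℝ) ^ (-2 * s)} ∪
  {x | K < kappa E a m k ∧ |Delta46 E a m k N x|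
      ≤ γ * (N : ℝ) ^ (-21 * (l1 m : ℝ)) * B * (γ * B)})

theorem exists_measure_resonantActions_le (E : Equation) (a : ℕ → ℝ) (hE : NonDegenerate E a)
    (R : ℕ) : ∃ (D : ℝ) (K : ℕ), 0 < D ∧ 1 ≤ K ∧
    ∀ {Ω : Type*} [MeasurableSpace Ω] (μ : Measure Ω) [IsProbabilityMeasure μ]
      (s ν σ ζ γ : ℝ) (J : ℕ → ℝ) (I : ℕ → Ω → ℝ), 0 ≤ s → ν ≤ 9 → 0 < σ → 0 ≤ ζ → 0 ≤ γ →
      IsRandomActions s ν σ J μ I → ∀ N : ℕ, K ≤ N → D ≤ N → (K : ℝ) ^ (2 * s) ≤ N →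
      ∀ (n : ℕ) (m : Fin (n + 2) → ℤ) (k : Fin (n + 2) → ℕ), IsMultIndex m k → l1 m ≤ R →
        k 0 ≤ N → μ {w | (fun p => I p w) ∈ resonantActions E a s γ (4 * σ * ζ) K N m k}
          ≤ ENNReal.ofReal (D * (ζ * γ) / (N : ℝ) ^ (n + 4)) := by
  obtain ⟨c₁, hc₁, H₁⟩ := exists_kappa_bound E a hE R
  obtain ⟨c₂, hc₂, H₂⟩ := exists_quadCoeff_bound E a hE R
  obtain ⟨C, hC, H₃⟩ := exists_sexticCoeff_bound E a
  -- The first three terms bound the three events. The term in C makes N ≥ D large enough for the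
  -- sextic perturbation of the slope to be at most half. K = 8(4R + 1) is the range required by
  -- `exists_quadCoeff_bound`; κ > K also excludes κ ≤ 2R + 2.
  refine ⟨8 / c₁ + (8 / (c₁ / 2) + 8 * √(2 / c₂)) + 12 * R * C / c₁, 8 * (4 * R + 1),
    by positivity, by omega, ?_⟩
  intro Ω _ μ _ s ν σ ζ γ J I hs hν hσ hζ hγ hI N hKN hDN hKs n m k h hR hkN
  obtain ⟨hκ1, hκ2, hκ3⟩ := H₁ n m k h hR
  have hN1 : (1 : ℝ) ≤ N := by exact_mod_cast (by omega : 1 ≤ N)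
  have hN0 : (0 : ℝ) < N := one_pos.trans_le hN1
  have hκN : kappa E a m k ≤ N := by
    rcases hκ3 with h' | ⟨h', _⟩
    · omega
    · rw [h']; exact (h.last_le 0).trans hkN
  have hκ1' : (1 : ℝ) ≤ kappa E a m k := by exact_mod_cast hκ1
  have hκN' : (kappa E a m k : ℝ) ≤ N := by exact_mod_cast hκN
  have hδ : c₁ / N ≤ |delta4 E a m k (kappa E a m k)| := by
    rw [div_le_iff₀ hN0]
    refine hκ2.trans (mul_le_mul_of_nonneg_left ?_ (abs_nonneg _))
    exact_mod_cast hkN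
  have hM := h.five_le
  have hn := h.le_l1
  have e5 : (N : ℝ) ^ (-5 * (l1 m : ℝ)) = ((N : ℝ) ^ (5 * l1 m))⁻¹ := by
    simpa using rpow_neg_mul_natCast hN0.le 5 (l1 m)
  have e21 : (N : ℝ) ^ (-21 * (l1 m : ℝ)) = ((N : ℝ) ^ (21 * l1 m))⁻¹ := by
    simpa using rpow_neg_mul_natCast hN0.le 21 (l1 m)
  have b1 : μ {w | |Delta4 E a m k fun p => I p w|
      ≤ γ * (N : ℝ) ^ (-5 * (l1 m : ℝ)) * (4 * σ * ζ) * (kappa E a m k : ℝ) ^ (-2 * s)}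
      ≤ ENNReal.ofReal (8 / c₁ * (ζ * γ) / (N : ℝ) ^ (n + 4)) := by
    refine (hI.measure_Delta4_le hσ E a h hkN (by positivity) hκ1 hδ _).trans
      (ENNReal.ofReal_le_ofReal ?_)
    exact sublevel_bound_of_slope hc₁ hN1 e5.le hγ hσ hζ hκ1' hκN' hν hM hn
  have b2 : μ {w | (∀ p, 1 ≤ p → p ≤ N → |I p w| ≤ ((N : ℝ) ^ 20)⁻¹) ∧
      |Delta46 E a m k N fun p => I p w|
      ≤ γ * (N : ℝ) ^ (-21 * (l1 m : ℝ)) * (4 * σ * ζ) * (kappa E a m k : ℝ) ^ (-2 * s)}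
      ≤ ENNReal.ofReal (8 / (c₁ / 2) * (ζ * γ) / (N : ℝ) ^ (n + 4)) := by
    refine (hI.measure_Delta46_le hσ E a h hkN (by positivity) hκ1 hδ (C := C * (N : ℝ) ^ 3)
      (fun p q l hp hq hl => H₃ N hN1 p q l (by exact_mod_cast hp) (by exact_mod_cast hq)
        (by exact_mod_cast hl)) (by positivity) ?_ _).trans (ENNReal.ofReal_le_ofReal ?_)
    · have hRC : 12 * R * C ≤ c₁ * N := by
        rw [← div_le_iff₀' hc₁]
        refine le_trans ?_ hDN
        have : 0 ≤ 8 / c₁ + (8 / (c₁ / 2) + 8 * √(2 / c₂)) := by positivity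
        linarith
      have hlR : (l1 m : ℝ) ≤ R := by exact_mod_cast hR
      calc (l1 m : ℝ) * (6 * (C * (N : ℝ) ^ 3) * (N : ℝ) ^ 4 * ((N : ℝ) ^ 20)⁻¹)
          = 12 * l1 m * C / (2 * (N : ℝ) ^ 13) := by field_simp; ring
        _ ≤ 12 * R * C / (2 * (N : ℝ) ^ 13) := by gcongr
        _ ≤ c₁ * N / (2 * (N : ℝ) ^ 13) := by gcongr
        _ ≤ c₁ * N / (2 * (N : ℝ) ^ 2) := by
            gcongr
            norm_num
        _ = c₁ / N / 2 := by field_simp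
    · rw [show c₁ / (N : ℝ) / 2 = c₁ / 2 / N by ring]
      refine sublevel_bound_of_slope (by positivity) hN1 (e21.le.trans ?_) hγ hσ hζ hκ1' hκN' hν
        hM hn
      gcongr
      norm_num
  have b3 : μ {w | 8 * (4 * R + 1) < kappa E a m k ∧ |Delta46 E a m k N fun p => I p w|
      ≤ γ * (N : ℝ) ^ (-21 * (l1 m : ℝ)) * (4 * σ * ζ) * (γ * (4 * σ * ζ))}
      ≤ ENNReal.ofReal (8 * √(2 / c₂) * (ζ * γ) / (N : ℝ) ^ (n + 4)) := by
    by_cases hκ : 8 * (4 * R + 1) < kappa E a m k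
    · obtain ⟨hκl, hS⟩ := hκ3.resolve_left (by omega)
      obtain ⟨p, hp1, hp2, hp3⟩ := H₂ n m k h hR (by omega) hS
      have hA : c₂ ≤ |quadCoeff E a m k p| * (N : ℝ) ^ (8 * l1 m) :=
        hp3.trans (by gcongr)
      have hA0 : quadCoeff E a m k p ≠ 0 := by
        intro h0
        rw [h0, abs_zero, zero_mul] at hA
        linarith
      have hpK : (p : ℝ) ≤ (8 * (4 * R + 1) : ℕ) := by exact_mod_cast (by omega)
      simp only [hκ, true_and]
      refine (hI.measure_Delta46_le_of_quadCoeff hσ E a h hkN hp1 (by omega) (by omega) hA0 _).trans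
        (ENNReal.ofReal_le_ofReal ?_)
      rw [e21]
      exact sublevel_bound_of_quadratic hc₂ hN1 hA hγ hσ hζ (by exact_mod_cast hp1)
        (by exact_mod_cast (by omega : p ≤ N))
        ((Real.rpow_le_rpow (by positivity) hpK (by positivity)).trans hKs) hν hM hn
    · simp [hκ]
  refine (measure_union_le _ _).trans ((add_le_add b1 ((measure_union_le _ _).trans
    (add_le_add b2 b3))).trans ?_)
  rw [← ENNReal.ofReal_add (by positivity) (by positivity),
    ← ENNReal.ofReal_add (by positivity) (by positivity)]
  refine ENNReal.ofReal_le_ofReal ?_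
  rw [← add_div, ← add_div]
  gcongr
  have : 0 ≤ 12 * R * C / c₁ * (ζ * γ) := by positivity
  linarith

/-! ### Union bound over the multi-indices and over N -/

section

variable {Ω : Type*} [MeasurableSpace Ω] {μ : Measure Ω}

/-- The N^(n+2) choices of `k` leave 1/N² out of the individual bound, and the number of `m` is
bounded independently of N. -/
theorem measure_iUnion_multIndex_le {R N : ℕ} (hN : 1 ≤ N) {X : ℝ} (hX : 0 ≤ X)
    (A : ∀ n : ℕ, (Fin (n + 2) → ℤ) → (Fin (n + 2) → ℕ) → Set Ω)
    (hA : ∀ n m k, μ (A n m k) ≤ ENNReal.ofReal (X / (N : ℝ) ^ (n + 4))) :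
    μ (⋃ n ∈ Finset.range R, ⋃ m ∈ Fintype.piFinset fun _ => Finset.Icc (-(R : ℤ)) R,
      ⋃ k ∈ Fintype.piFinset fun _ => Finset.Icc 1 N, A n m k)
      ≤ ENNReal.ofReal (R * (2 * R + 1) ^ (R + 1) * X / (N : ℝ) ^ 2) := by
  have hN0 : (0 : ℝ) < N := by exact_mod_cast hN
  refine (measure_biUnion_finset_le _ _).trans ((Finset.sum_le_sum (g := fun _ =>
    ENNReal.ofReal ((2 * R + 1) ^ (R + 1) * X / (N : ℝ) ^ 2)) fun n hn => ?_).trans ?_)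
  · refine (measure_biUnion_finset_le _ _).trans ((Finset.sum_le_sum (g := fun _ =>
      ENNReal.ofReal (X / (N : ℝ) ^ 2)) fun m _ => ?_).trans ?_)
    · refine (measure_biUnion_finset_le _ _).trans
        ((Finset.sum_le_sum fun k _ => hA n m k).trans ?_)
      rw [Finset.sum_const, nsmul_eq_mul, Fintype.card_piFinset, ← ENNReal.ofReal_natCast,
        ← ENNReal.ofReal_mul (by positivity)]
      refine ENNReal.ofReal_le_ofReal (le_of_eq ?_)
      simp only [Nat.card_Icc, Nat.add_sub_cancel, Finset.prod_const, Finset.card_univ,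
        Fintype.card_fin, Nat.cast_pow]
      rw [show n + 4 = (n + 2) + 2 by ring, pow_add _ (n + 2) 2]
      field_simp
    · rw [Finset.sum_const, nsmul_eq_mul, Fintype.card_piFinset, ← ENNReal.ofReal_natCast,
        ← ENNReal.ofReal_mul (by positivity)]
      refine ENNReal.ofReal_le_ofReal ?_
      rw [mul_div_assoc]
      refine mul_le_mul_of_nonneg_right ?_ (by positivity)
      have hcard : (Finset.Icc (-(R : ℤ)) R).card = 2 * R + 1 := by
        rw [Int.card_Icc]; omega
      simp only [hcard, Finset.prod_const, Finset.card_univ, Fintype.card_fin]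
      push_cast
      refine pow_le_pow_right₀ (by linarith [(R.cast_nonneg : (0 : ℝ) ≤ R)]) ?_
      have := Finset.mem_range.1 hn
      omega
  · rw [Finset.sum_const, nsmul_eq_mul, Finset.card_range, ← ENNReal.ofReal_natCast,
      ← ENNReal.ofReal_mul (by positivity)]
    exact ENNReal.ofReal_le_ofReal (le_of_eq (by ring))

/-- Telescoping, from 1/x² ≤ 2/x - 2/(x + 1) for x ≥ 1. -/
theorem sum_range_inv_sq_le {g : ℕ} (hg : 1 ≤ g) (t : ℕ) :
    ∑ i ∈ Finset.range t, 1 / ((i + g : ℕ) : ℝ) ^ 2 ≤ 2 / g - 2 / ((t + g : ℕ) : ℝ) := by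
  induction t with
  | zero => simp
  | succ t ih =>
    rw [Finset.sum_range_succ]
    have h1 : (1 : ℝ) ≤ (t + g : ℕ) := by exact_mod_cast (by omega)
    have h2 : ((t + 1 + g : ℕ) : ℝ) = (t + g : ℕ) + 1 := by push_cast; ring
    rw [h2]
    set x : ℝ := ((t + g : ℕ) : ℝ)
    have h3 : 1 / x ^ 2 ≤ 2 / x - 2 / (x + 1) := by
      rw [div_sub_div _ _ (by positivity) (by positivity),
        div_le_div_iff₀ (by positivity) (by positivity)]
      nlinarith
    linarith

theorem measure_iUnion_le_of_inv_sq (A : ℕ → Set Ω) {g : ℕ} (hg : 1 ≤ g) {Y : ℝ} (hY : 0 ≤ Y)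
    (hA : ∀ N, g ≤ N → μ (A N) ≤ ENNReal.ofReal (Y / (N : ℝ) ^ 2)) :
    μ (⋃ i : ℕ, A (i + g)) ≤ ENNReal.ofReal (2 * Y / g) := by
  refine (measure_iUnion_le _).trans (ENNReal.tsum_le_of_sum_range_le fun t => ?_)
  refine (Finset.sum_le_sum fun i _ => hA (i + g) (Nat.le_add_left _ _)).trans ?_
  rw [← ENNReal.ofReal_sum_of_nonneg fun i _ => by positivity]
  refine ENNReal.ofReal_le_ofReal ?_
  have h1 := sum_range_inv_sq_le hg t
  have h2 : (0 : ℝ) ≤ 2 / ((t + g : ℕ) : ℝ) := by positivity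
  calc ∑ i ∈ Finset.range t, Y / ((i + g : ℕ) : ℝ) ^ 2
      = Y * ∑ i ∈ Finset.range t, 1 / ((i + g : ℕ) : ℝ) ^ 2 := by
        rw [Finset.mul_sum]
        exact Finset.sum_congr rfl fun i _ => by ring
    _ ≤ Y * (2 / g) := mul_le_mul_of_nonneg_left (by linarith) hY
    _ = 2 * Y / g := by ring

end

/-! ### From bad events to the non-resonant set -/

theorem exists_continuous_floor_le (D : ℕ → ℝ) :
    ∃ G : ℝ → ℝ, Continuous G ∧ ∀ r, D ⌊r⌋₊ ≤ G r := by
  -- The constants depend on r through its integer part and may jump. Near r that part is at most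
  -- ⌊r⌋ + 1, so a finite sum is a local majorant; convexity of half-lines lets these be glued
  -- continuously.
  obtain ⟨G, hG⟩ := exists_continuous_forall_mem_convex_of_local_const (X := ℝ) (E := ℝ)
    (t := fun r => Set.Ici (D ⌊r⌋₊)) (fun r => convex_Ici _) fun r => by
      refine ⟨∑ i ∈ Finset.range (⌊r⌋₊ + 2), |D i|, ?_⟩
      filter_upwards [eventually_lt_nhds (show r < ⌊r⌋₊ + 1 + 1 by
        linarith [Nat.lt_floor_add_one r])] with y hy
      refine (le_abs_self _).trans (Finset.single_le_sum (f := fun i => |D i|)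
        (fun i _ => abs_nonneg _) (Finset.mem_range.2 ?_))
      refine (Nat.floor_lt' (by omega)).2 ?_
      push_cast
      linarith
  exact ⟨G, G.continuous, hG⟩

/-- Replacing N by its integer part and the squared norm by `B` only raises the thresholds, while
the admissible `(m, k)` and `Z6` do not change. Which term attains the maximum decides which of the
last two sets of `resonantActions` is invoked. -/
theorem cosSeries_mem_U (E : Equation) (a : ℕ → ℝ) (hE : NonDegenerate E a) {s r γ B N : ℝ}
    {K : ℕ} {x : ℕ → ℝ} (hs : 0 ≤ s) (hγ : 0 < γ) (hγ1 : γ < 1)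
    (hx : ∀ k, 1 ≤ k → 0 ≤ x k) (hsum : Summable fun k : ℕ+ => x k * (k : ℝ) ^ (2 * s))
    (hB : normSq s (cosSeries x) ≤ B) (hN1 : 1 ≤ ⌊N⌋₊) (hK : (K : ℝ) ^ (2 * s) ≤ ⌊N⌋₊)
    (hN : N ≤ (γ / normSq s (cosSeries x)) ^ (1 / (21 * r + 5)))
    (hres : ∀ (n : ℕ) (m : Fin (n + 2) → ℤ) (k : Fin (n + 2) → ℕ), IsMultIndex m k →
      l1 m ≤ ⌊r⌋₊ → k 0 ≤ ⌊N⌋₊ → x ∉ resonantActions E a s γ B K ⌊N⌋₊ m k) :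
    cosSeries x ∈ U E a s γ N r := by
  have hHas := hasSum_normSq_cosSeries hx hsum
  have hdot : cosSeries x ∈ HDot s := by
    refine ⟨by simp [cosSeries], fun k => ?_, hHas.summable⟩
    by_cases hk : k = 0
    · simp [hk, cosSeries]
    · simp [hk, cosSeries]
  set T := normSq s (cosSeries x) with hT
  have hterm : ∀ k : ℤ, 0 ≤ |(k : ℝ)| ^ (2 * s) * ‖cosSeries x k‖ ^ 2 := fun k => by positivity
  have hT0 : 0 ≤ T := tsum_nonneg hterm
  have hN1' : (1 : ℝ) ≤ ⌊N⌋₊ := by exact_mod_cast hN1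
  have hNN : (⌊N⌋₊ : ℝ) ≤ N := Nat.floor_le (by
    by_contra hneg
    rw [Nat.floor_of_nonpos (by linarith)] at hN1
    omega)
  have hN1r : 1 ≤ N := hN1'.trans hNN
  have hB0 : 0 ≤ B := hT0.trans hB
  have hxT : ∀ p, 1 ≤ p → x p ≤ T := by
    intro p hp
    have h1 := hHas.summable.le_tsum (p : ℤ) fun k _ => hterm k
    refine le_trans ?_ h1
    have h2 : ‖cosSeries x (p : ℤ)‖ ^ 2 = x p := action_cosSeries hp (hx p hp)
    rw [h2]
    have hp' : (1 : ℝ) ≤ |((p : ℤ) : ℝ)| := by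
      rw [Int.cast_natCast, Nat.abs_cast]; exact_mod_cast hp
    exact le_mul_of_one_le_left (hx p hp) (Real.one_le_rpow hp' (by positivity))
  have hact : ∀ p, 1 ≤ p → p ≤ ⌊N⌋₊ → action (cosSeries x) p = x p := fun p hp _ =>
    action_cosSeries hp (hx p hp)
  -- the bound on the norm, for `r ≥ 5`
  have hTN : 5 ≤ r → T * N ^ 20 ≤ γ := by
    intro hr
    rcases hT0.eq_or_lt with h0 | hpos
    · rw [← h0, zero_mul]; exact hγ.le
    · have he : 0 < 21 * r + 5 := by linarith
      have h1 : N ^ (21 * r + 5) ≤ γ / T := by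
        calc N ^ (21 * r + 5) ≤ ((γ / T) ^ (1 / (21 * r + 5))) ^ (21 * r + 5) :=
              Real.rpow_le_rpow (by linarith) hN he.le
          _ = γ / T := by
              rw [← Real.rpow_mul (by positivity), one_div, inv_mul_cancel₀ he.ne', Real.rpow_one]
      have h2 : N ^ 20 ≤ N ^ (21 * r + 5) := by
        rw [← Real.rpow_natCast]
        exact Real.rpow_le_rpow_of_exponent_le hN1r (by push_cast; linarith)
      have h3 := h2.trans h1
      rw [le_div_iff₀ hpos] at h3
      linarith
  have hpow : ∀ e : ℝ, e ≤ 0 → N ^ e ≤ (⌊N⌋₊ : ℝ) ^ e := fun e he =>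
    Real.rpow_le_rpow_of_nonpos (by linarith) hNN he
  have hnot : ∀ (n : ℕ) (m : Fin (n + 2) → ℤ) (k : Fin (n + 2) → ℕ), IsMultIndex m k →
      (l1 m : ℝ) ≤ r → (k 0 : ℝ) ≤ N →
      k 0 ≤ ⌊N⌋₊ ∧ x ∉ resonantActions E a s γ B K ⌊N⌋₊ m k := by
    intro n m k h hr hkN
    have hk := Nat.le_floor hkN
    exact ⟨hk, hres n m k h (Nat.le_floor hr) hk⟩
  refine ⟨⟨hdot, fun n m k h h5 hr hkN => ?_⟩, ⟨hdot, fun n m k h h5 hr hkN => ?_⟩⟩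
  · obtain ⟨hk, hx'⟩ := hnot n m k h hr hkN
    rw [Delta4_congr E a h hk hact]
    have h1 : ¬ |Delta4 E a m k x| ≤ _ := fun h => hx' (Or.inl h)
    refine lt_of_le_of_lt ?_ (not_le.1 h1)
    have := hpow (-5 * (l1 m : ℝ)) (by linarith [(l1 m).cast_nonneg (α := ℝ)])
    gcongr
  · obtain ⟨hk, hx'⟩ := hnot n m k h hr hkN
    rw [← Delta46_natFloor, Delta46_congr E a h hk hact]
    have h5r : 5 ≤ r := le_trans (by exact_mod_cast h5) hr
    have hTN := hTN h5r
    have hpw := hpow (-21 * (l1 m : ℝ)) (by linarith [(l1 m).cast_nonneg (α := ℝ)])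
    have hN20 : (⌊N⌋₊ : ℝ) ^ 20 ≤ N ^ 20 := by gcongr
    rcases le_total (γ * T) ((kappa E a m k : ℝ) ^ (-2 * s)) with hmax | hmax
    · rw [max_eq_left hmax]
      have h1 : ¬ |Delta46 E a m k ⌊N⌋₊ x| ≤ _ := fun h => hx' (Or.inr (Or.inl ⟨fun p hp hpN => by
        rw [abs_of_nonneg (hx p hp), ← one_div, le_div_iff₀ (by positivity)]
        calc x p * (⌊N⌋₊ : ℝ) ^ 20 ≤ T * N ^ 20 := by
              have := hxT p hp
              gcongr
          _ ≤ 1 := by linarith, h⟩))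
      refine lt_of_le_of_lt ?_ (not_le.1 h1)
      gcongr
    · rw [max_eq_right hmax]
      obtain ⟨_, _, Hκ⟩ := exists_kappa_bound E a hE (l1 m)
      have hκ1 : (1 : ℝ) ≤ kappa E a m k := by exact_mod_cast (Hκ n m k h le_rfl).1
      -- If κ ≤ K then κ^(2s) ≤ N, and the assumption κ^(-2s) ≤ γT would give 1 ≤ γTN ≤ γ² < 1.
      have hκ : K < kappa E a m k := by
        by_contra hle
        have hle' : (kappa E a m k : ℝ) ≤ K := by exact_mod_cast not_lt.1 hle
        have h1 : (kappa E a m k : ℝ) ^ (2 * s) ≤ N :=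
          (Real.rpow_le_rpow (by positivity) hle' (by positivity)).trans (hK.trans hNN)
        rw [neg_mul, Real.rpow_neg (by positivity), inv_le_iff_one_le_mul₀ (by positivity)] at hmax
        have h2 : γ * T * (kappa E a m k : ℝ) ^ (2 * s) ≤ γ * T * N := by gcongr
        have h3 : T * N ≤ T * N ^ 20 :=
          mul_le_mul_of_nonneg_left (le_self_pow₀ hN1r (by norm_num)) hT0
        nlinarith
      have h1 : ¬ |Delta46 E a m k ⌊N⌋₊ x| ≤ _ := fun h => hx' (Or.inr (Or.inr ⟨hκ, h⟩))
      refine lt_of_le_of_lt ?_ (not_le.1 h1)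
      gcongr

/-- The probability that some small divisor indexed by `(m, k)` with `|m|₁ ≤ R` and `k_1 ≤ N`, for
some `N ≥ g`, is too small. -/
theorem exists_measure_exists_mem_resonantActions_le (E : Equation) (a : ℕ → ℝ)
    (hE : NonDegenerate E a) (R : ℕ) : ∃ D : ℝ, 1 ≤ D ∧ ∃ K : ℕ, (K : ℝ) ≤ D ∧
    ∀ {Ω : Type*} [MeasurableSpace Ω] (μ : Measure Ω) [IsProbabilityMeasure μ]
      (s ν σ ζ γ : ℝ) (J : ℕ → ℝ) (I : ℕ → Ω → ℝ), 0 ≤ s → ν ≤ 9 → 0 < σ → 0 ≤ ζ → 0 ≤ γ →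
      IsRandomActions s ν σ J μ I → ∀ g : ℕ, D ≤ g → (K : ℝ) ^ (2 * s) ≤ g →
      μ {w | ∃ N : ℕ, g ≤ N ∧ ∃ (n : ℕ) (m : Fin (n + 2) → ℤ) (k : Fin (n + 2) → ℕ),
        IsMultIndex m k ∧ l1 m ≤ R ∧ k 0 ≤ N ∧
          (fun p => I p w) ∈ resonantActions E a s γ (4 * σ * ζ) K N m k}
        ≤ ENNReal.ofReal (D * (ζ * γ) / g) := by
  obtain ⟨D, K, hD, hK, H⟩ := exists_measure_resonantActions_le E a hE R
  -- A single constant serves both as the lower bound on g and in the probability; the factor 2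
  -- comes from the tail of ∑ 1/N².
  refine ⟨1 + D + K + 2 * (R * (2 * R + 1) ^ (R + 1) * D), ?_, K, ?_, ?_⟩
  · have : 0 ≤ D + K + 2 * (R * (2 * R + 1) ^ (R + 1) * D) := by positivity
    linarith
  · have : 0 ≤ 1 + D + 2 * (R * (2 * R + 1) ^ (R + 1) * D) := by positivity
    linarith
  intro Ω _ μ _ s ν σ ζ γ J I hs hν hσ hζ hγ hI g hg hgK
  have hX : 0 ≤ D * (ζ * γ) := by positivity
  have hpos : 0 ≤ 2 * (R * (2 * R + 1) ^ (R + 1) * D) := by positivity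
  have hKg : K ≤ g := by
    have : (K : ℝ) ≤ g := by linarith
    exact_mod_cast this
  have hDg : D ≤ g := by linarith [(K.cast_nonneg : (0 : ℝ) ≤ K)]
  set A : ℕ → ∀ n : ℕ, (Fin (n + 2) → ℤ) → (Fin (n + 2) → ℕ) → Set Ω := fun N n m k =>
    {w | (IsMultIndex m k ∧ l1 m ≤ R ∧ k 0 ≤ N) ∧
      (fun p => I p w) ∈ resonantActions E a s γ (4 * σ * ζ) K N m k} with hA
  have hAle : ∀ N, g ≤ N → ∀ n m k,
      μ (A N n m k) ≤ ENNReal.ofReal (D * (ζ * γ) / (N : ℝ) ^ (n + 4)) := by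
    intro N hN n m k
    have hN' : (g : ℝ) ≤ N := by exact_mod_cast hN
    by_cases h : IsMultIndex m k ∧ l1 m ≤ R ∧ k 0 ≤ N
    · simp only [hA, h, true_and]
      exact H μ s ν σ ζ γ J I hs hν hσ hζ hγ hI N (hKg.trans hN) (hDg.trans hN') (hgK.trans hN')
        n m k h.1 h.2.1 h.2.2
    · simp [hA, h]
  have hAN := fun N (hN : g ≤ N) =>
    measure_iUnion_multIndex_le (R := R) (show 1 ≤ N by omega) hX (A N) (hAle N hN)
  refine (measure_mono ?_).trans ((measure_iUnion_le_of_inv_sq _ (by omega) (by positivity)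
    hAN).trans (ENNReal.ofReal_le_ofReal ?_))
  · rintro w ⟨N, hN, n, m, k, h, hR, hk, hw⟩
    obtain ⟨i, rfl⟩ := Nat.exists_eq_add_of_le' hN
    simp only [Set.mem_iUnion, Finset.mem_range, Fintype.mem_piFinset, Finset.mem_Icc]
    refine ⟨i, n, by have := h.le_l1; omega, m, fun j => ?_, k, fun j =>
      ⟨h.index_pos j, (h.le_zero j).trans hk⟩, ⟨h, hR, hk⟩, hw⟩
    have := natAbs_le_l1 m j
    omega
  · have : 0 ≤ (1 + D + K) * (ζ * γ) := by positivity
    refine div_le_div_of_nonneg_right ?_ (by positivity)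
    linarith

theorem IsRandomActions.ae_mem_Ioo {Ω : Type*} [MeasurableSpace Ω] {μ : Measure Ω} {s ν σ : ℝ}
    {J : ℕ → ℝ} {I : ℕ → Ω → ℝ} (hI : IsRandomActions s ν σ J μ I) (hσ : 0 < σ) :
    ∀ᵐ w ∂μ, ∀ k : ℕ, 1 ≤ k → I k w ∈ Set.Ioo (J k) (J k + σ * (k : ℝ) ^ (-2 * s - ν)) := by
  refine ae_all_iff.2 fun k => ?_
  by_cases hk : 1 ≤ k
  · have hk' : (0 : ℝ) < k := by exact_mod_cast hk
    filter_upwards [ae_mem_Ioo_of_isUniform (by positivity) (hI.isUniform k hk)] with w hw _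
    exact hw
  · exact Filter.Eventually.of_forall fun w h => absurd h hk

theorem normSq_cosSeries_le {s ν σ : ℝ} (hν : 1 < ν) (hσ : 0 < σ) {J x : ℕ → ℝ}
    (hJ : ∀ k : ℕ, 1 ≤ k → 0 ≤ J k) (hJs : Summable fun k : ℕ+ => J k * (k : ℝ) ^ (2 * s))
    (hx : ∀ k : ℕ, 1 ≤ k → x k ∈ Set.Ioo (J k) (J k + σ * (k : ℝ) ^ (-2 * s - ν))) :
    (Summable fun k : ℕ+ => x k * (k : ℝ) ^ (2 * s)) ∧
      normSq s (cosSeries x) ≤ 2 * ∑' k : ℕ+, J k * (k : ℝ) ^ (2 * s)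
        + 2 * σ * (riemannZeta (ν : ℂ)).re := by
  have hx0 : ∀ k, 1 ≤ k → 0 ≤ x k := fun k hk => (hJ k hk).trans (hx k hk).1.le
  have hz := hasSum_pnat_rpow_neg hν
  have hadd := hJs.hasSum.add (hz.mul_left σ)
  have hle : ∀ k : ℕ+, x k * (k : ℝ) ^ (2 * s) ≤ J k * (k : ℝ) ^ (2 * s) + σ * (k : ℝ) ^ (-ν) := by
    intro k
    have hk : (0 : ℝ) < k := by exact_mod_cast k.2
    calc x k * (k : ℝ) ^ (2 * s) ≤ (J k + σ * (k : ℝ) ^ (-2 * s - ν)) * (k : ℝ) ^ (2 * s) := by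
          have := (hx k k.2).2.le
          gcongr
      _ = J k * (k : ℝ) ^ (2 * s) + σ * ((k : ℝ) ^ (-2 * s - ν) * (k : ℝ) ^ (2 * s)) := by ring
      _ = _ := by
          rw [← Real.rpow_add hk, show -2 * s - ν + 2 * s = -ν by ring]
  have hsum : Summable fun k : ℕ+ => x k * (k : ℝ) ^ (2 * s) :=
    Summable.of_nonneg_of_le (fun k => mul_nonneg (hx0 k k.2) (by positivity)) hle hadd.summable
  refine ⟨hsum, ?_⟩
  have h1 : normSq s (cosSeries x) = 2 * ∑' k : ℕ+, x k * (k : ℝ) ^ (2 * s) :=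
    (hasSum_normSq_cosSeries hx0 hsum).tsum_eq
  have h2 := hsum.tsum_le_tsum hle hadd.summable
  rw [hadd.tsum_eq] at h2
  rw [h1]
  linarith

/-! ### Continuity of the threshold, and conclusion -/

theorem continuousOn_riemannZeta_re :
    ContinuousOn (fun ν : ℝ => (riemannZeta (ν : ℂ)).re) (Set.Ioi 1) := fun ν hν => by
  have h1 : ContinuousAt riemannZeta (ν : ℂ) := (differentiableAt_riemannZeta (by
    rw [Ne, ← Complex.ofReal_one, Complex.ofReal_inj]
    exact (Set.mem_Ioi.1 hν).ne')).continuousAt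
  exact (Complex.continuous_re.continuousAt.comp
    (h1.comp Complex.continuous_ofReal.continuousAt)).continuousWithinAt

theorem continuousOn_threshold {G : ℝ → ℝ} (hG : Continuous G) (hG0 : ∀ r, 0 < G r) :
    ContinuousOn (fun p : ℝ × ℝ × ℝ × ℝ => G p.1 ^ (2 * p.2.1)
      + G p.1 * (1 + (riemannZeta (p.2.2.1 : ℂ)).re / p.2.2.2) + 1)
      (Set.Ici 2 ×ˢ Set.Ici 0 ×ˢ Set.Ioc 1 9 ×ˢ Set.Ioo 0 1) := by
  have h1 : Continuous fun p : ℝ × ℝ × ℝ × ℝ => G p.1 := hG.comp continuous_fst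
  have h2 : Continuous fun p : ℝ × ℝ × ℝ × ℝ => 2 * p.2.1 := by fun_prop
  have h3 : ContinuousOn (fun p : ℝ × ℝ × ℝ × ℝ => (riemannZeta (p.2.2.1 : ℂ)).re)
      (Set.Ici 2 ×ˢ Set.Ici 0 ×ˢ Set.Ioc 1 9 ×ˢ Set.Ioo 0 1) :=
    continuousOn_riemannZeta_re.comp (f := fun p : ℝ × ℝ × ℝ × ℝ => p.2.2.1)
      (by fun_prop) fun p hp => hp.2.2.1.1
  have h4 : ContinuousOn (fun p : ℝ × ℝ × ℝ × ℝ => p.2.2.2)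
      (Set.Ici 2 ×ˢ Set.Ici 0 ×ˢ Set.Ioc 1 9 ×ˢ Set.Ioo 0 1) := by fun_prop
  refine (ContinuousOn.add ?_ (h1.continuousOn.mul (continuousOn_const.add
    (h3.div h4 fun p hp => hp.2.2.2.1.ne')))).add continuousOn_const
  exact h1.continuousOn.rpow h2.continuousOn fun p _ => Or.inl (hG0 p.1).ne'

end RationalNormalForm

theorem proposition4p6
    (E : RationalNormalForm.Equation) (f : ℝ → ℝ) (hf : ContDiff ℝ ∞ f)
    (hfa : AnalyticAt ℝ f 0) (hf0 : f 0 = 0) (hf1 : deriv f 0 = 0)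
    (hE : RationalNormalForm.NonDegenerate E (RationalNormalForm.taylorCoeff f)) :
    ∃ σ₀ N₀ : ℝ × ℝ × ℝ × ℝ → ℝ,
      ContinuousOn σ₀ (Set.Ici 2 ×ˢ Set.Ici 0 ×ˢ Set.Ioc 1 9 ×ˢ Set.Ioo 0 1) ∧
      ContinuousOn N₀ (Set.Ici 2 ×ˢ Set.Ici 0 ×ˢ Set.Ioc 1 9 ×ˢ Set.Ioo 0 1) ∧
      ∀ r s ν lam : ℝ, 2 ≤ r → 0 ≤ s → ν ∈ Set.Ioc 1 9 → lam ∈ Set.Ioo 0 1 →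
        0 < σ₀ (r, s, ν, lam) ∧
        ∀ σ γ : ℝ, 0 < σ → σ ≤ σ₀ (r, s, ν, lam) → γ ∈ Set.Ioo 0 1 →
        ∀ (J : ℕ → ℝ), (∀ k : ℕ, 1 ≤ k → 0 ≤ J k) →
          (Summable fun k : ℕ+ => J k * (k : ℝ) ^ (2 * s)) →
          2 * ∑' k : ℕ+, J k * (k : ℝ) ^ (2 * s) + 2 * σ * (riemannZeta (ν : ℂ)).re
            ≤ 4 * σ * (riemannZeta (ν : ℂ)).re →
        ∀ (Ω : Type*) [MeasurableSpace Ω] (μ : MeasureTheory.Measure Ω)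
          [MeasureTheory.IsProbabilityMeasure μ] (I : ℕ → Ω → ℝ),
          (∀ k : ℕ, 1 ≤ k → Measurable (I k)) →
          ProbabilityTheory.iIndepFun (fun k : ℕ+ => I k) μ →
          (∀ k : ℕ, 1 ≤ k → MeasureTheory.pdf.IsUniform (I k)
            (Set.Ioo (J k) (J k + σ * (k : ℝ) ^ (-2 * s - ν))) μ MeasureTheory.volume) →
          1 - lam * γ ≤ μ.real {x | ∀ N : ℝ, N₀ (r, s, ν, lam) ≤ N →
            N ≤ (γ / RationalNormalForm.normSq s
              (RationalNormalForm.cosSeries fun k => I k x)) ^ (1 / (21 * r + 5)) →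
            RationalNormalForm.cosSeries (fun k => I k x) ∈
              RationalNormalForm.U E (RationalNormalForm.taylorCoeff f) s γ N r} := by
  set a := RationalNormalForm.taylorCoeff f
  choose D hD1 K hKD H using
    RationalNormalForm.exists_measure_exists_mem_resonantActions_le E a hE
  obtain ⟨G, hG, hDG⟩ := RationalNormalForm.exists_continuous_floor_le D
  have hG1 : ∀ r, 1 ≤ G r := fun r => (hD1 _).trans (hDG r)
  -- σ₀ can be constant because σ cancels in every probability bound. In N₀, the first term gives
  -- K^(2s) ≤ N, G gives N ≥ D, and Gζ(ν)/λ brings the total probability below λγ. The final 1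
  -- absorbs the passage from ⌈W⌉ to ⌊N⌋.
  refine ⟨fun _ => 1, fun p => G p.1 ^ (2 * p.2.1)
      + G p.1 * (1 + (riemannZeta (p.2.2.1 : ℂ)).re / p.2.2.2) + 1, continuousOn_const,
    RationalNormalForm.continuousOn_threshold hG fun r => one_pos.trans_le (hG1 r), ?_⟩
  intro r s ν lam _ hs hν hlam
  refine ⟨one_pos, ?_⟩
  intro σ γ hσ _ hγ J hJ hJs hJB Ω _ μ _ I hIm hIi hIu
  have hI : RationalNormalForm.IsRandomActions s ν σ J μ I := ⟨hIm, hIi, hIu⟩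
  dsimp only
  set ζ : ℝ := (riemannZeta (ν : ℂ)).re with hζ
  have hζ0 : 0 ≤ ζ := (RationalNormalForm.hasSum_pnat_rpow_neg hν.1).nonneg fun k => by positivity
  set W : ℝ := G r ^ (2 * s) + G r * (1 + ζ / lam) with hW
  have hGr := hG1 r
  have hlam0 := hlam.1
  have hDr := hDG r
  have hGs : 0 ≤ G r ^ (2 * s) := by positivity
  have hGζ : 0 ≤ G r * (ζ / lam) := by positivity
  have hW1 : G r ≤ W := by rw [hW]; linarith
  have hWs : (K ⌊r⌋₊ : ℝ) ^ (2 * s) ≤ W := by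
    have h1 : (K ⌊r⌋₊ : ℝ) ^ (2 * s) ≤ G r ^ (2 * s) :=
      Real.rpow_le_rpow (by positivity) ((hKD _).trans hDr) (by positivity)
    rw [hW]; linarith
  have hWg : W ≤ ⌈W⌉₊ := Nat.le_ceil W
  have hbad := H ⌊r⌋₊ μ s ν σ ζ γ J I hs hν.2 hσ hζ0 hγ.1.le hI ⌈W⌉₊
    (hDr.trans (hW1.trans hWg)) (hWs.trans hWg)
  have hbad' := hbad.trans (ENNReal.ofReal_le_ofReal (show D ⌊r⌋₊ * (ζ * γ) / ⌈W⌉₊ ≤ lam * γ by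
    have hγ0 := hγ.1
    rw [div_le_iff₀ (by linarith)]
    calc D ⌊r⌋₊ * (ζ * γ) ≤ G r * (ζ * γ) := by gcongr
      _ = lam * γ * (G r * (ζ / lam)) := by field_simp
      _ ≤ lam * γ * ⌈W⌉₊ := by
        gcongr
        linarith))
  set S : Set Ω := {x | ∀ N : ℝ, W + 1 ≤ N →
    N ≤ (γ / RationalNormalForm.normSq s
      (RationalNormalForm.cosSeries fun k => I k x)) ^ (1 / (21 * r + 5)) →
    RationalNormalForm.cosSeries (fun k => I k x) ∈ RationalNormalForm.U E a s γ N r} with hS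
  have hSc : μ Sᶜ ≤ ENNReal.ofReal (lam * γ) := by
    refine (measure_mono_ae ?_).trans hbad'
    filter_upwards [hI.ae_mem_Ioo hσ] with w hw hwS
    by_contra hgood
    refine hwS fun N hWN hN => ?_
    obtain ⟨hsum, hnorm⟩ := RationalNormalForm.normSq_cosSeries_le hν.1 hσ hJ hJs hw
    have hWN' : ⌈W⌉₊ ≤ ⌊N⌋₊ :=
      Nat.le_floor ((Nat.ceil_lt_add_one (by linarith)).le.trans hWN)
    have hWN'' : (⌈W⌉₊ : ℝ) ≤ ⌊N⌋₊ := by exact_mod_cast hWN'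
    refine RationalNormalForm.cosSeries_mem_U E a hE (K := K ⌊r⌋₊) hs hγ.1 hγ.2
      (fun k hk => (hJ k hk).trans (hw k hk).1.le) hsum (hnorm.trans hJB) ?_
      (hWs.trans (hWg.trans hWN'')) hN fun n m k h hr hk hmem =>
        hgood ⟨⌊N⌋₊, hWN', n, m, k, h, hr, hk, hmem⟩
    have : (1 : ℝ) ≤ ⌊N⌋₊ := by linarith
    exact_mod_cast this
  -- `S` is not known to be measurable; subadditivity of the outer measure is enough.
  have h1 : (1 : ENNReal) ≤ μ S + ENNReal.ofReal (lam * γ) := by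
    rw [← measure_univ (μ := μ), ← Set.union_compl_self S]
    exact (measure_union_le _ _).trans (by gcongr)
  have h2 := ENNReal.toReal_mono (by finiteness) h1
  rw [ENNReal.toReal_one, ENNReal.toReal_add (by finiteness) (by finiteness),
    ENNReal.toReal_ofReal (mul_nonneg hlam0.le hγ.1.le)] at h2
  rw [Measure.real]
  linarith
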